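/- Let $\mathbf{k}$ be a field of characteristic zero and let $\mathbf{C}$ be a set of colors. A \emph{dg operad} is a $\mathbf{C}$-colored symmetric operad with units in the category of $\mathbb{Z}$-graded chain complexes over $\mathbf{k}$, with differential of degree $-1$; it consists of chain complexes $\mathcal{P}\binom{c}{c_1,\dots,c_n}$, for $n\ge 0$ and $c,c_1,\dots,c_n\in\mathbf{C}$, with right actions of the symmetric groups permuting the colors $c_i$, with units in $\mathcal{P}\binom{c}{c}$, and with compositions. Morphisms of dg operads are families of chain maps that preserve this structure. The trivial dg operad $\mathbf{1}$ has $\mathbf{1}\binom{c}{c}=\mathbf{k}$ for every $c\in\mathbf{C}$, and all its other components are $0$; let $\eta\colon\mathbf{1}\to\mathcal{P}$ be the morphism given by the units of $\mathcal{P}$. A dg operad $\mathcal{P}$ is \emph{augmented} if there is a morphism of dg operads $\epsilon\colon\mathcal{P}\to\mathbf{1}$ with $\epsilon\eta=\mathrm{id}_{\mathbf{1}}$. The \emph{free product} $\mathcal{S}*\mathcal{Q}$ is the coproduct of $\mathcal{S}$ and $\mathcal{Q}$ in the category of dg operads. The homology $H_*(\mathcal{P})$ is a dg operad with zero differential. \textbf{Theorem.}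 For augmented dg operads $\mathcal{S}$ and $\mathcal{Q}$ there is an isomorphism of dg operads \[ H_*(\mathcal{S})*H_*(\mathcal{Q})\;\cong\;H_*(\mathcal{S}*\mathcal{Q}), \] whose restrictions to $H_*(\mathcal{S})$ and $H_*(\mathcal{Q})$ are the maps induced by the canonical morphisms $\mathcal{S}\to\mathcal{S}*\mathcal{Q}$ and $\mathcal{Q}\to\mathcal{S}*\mathcal{Q}$. It is functorial: for all morphisms $F\colon\mathcal{S}\to\mathcal{S}'$ and $G\colon\mathcal{Q}\to\mathcal{Q}'$ of dg operads between augmented dg operads, the isomorphisms for $(\mathcal{S},\mathcal{Q})$ and $(\mathcal{S}',\mathcal{Q}')$ intertwine $H_*(F)*H_*(G)$ with $H_*(F*G)$. -/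

import Mathlib

open CategoryTheory CategoryTheory.Limits

set_option linter.unusedVariables false

universe u

namespace ColoredOperad

/-! ### Positions of inputs in a partial composition

Inputs are numbered from `0`.  If `x` has `m` inputs and `y` has `n` inputs, then `x ∘ᵢ y` has
`m + n - 1` inputs: the inputs of `x` before `i`, then the inputs of `y`, then the inputs of `x`
after `i`. -/

/-- Input `j ≠ i` of `x` becomes input `s` of `x ∘ᵢ y`, where `y` has `n` inputs. -/
def OuterPos {m r : ℕ} (i : Fin m) (n : ℕ) (j : Fin m) (s : Fin r) : Prop :=
  (j < i ∧ (s : ℕ) = j) ∨ (i < j ∧ (s : ℕ) + 1 = j + n)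

/-- Input `j` of `y` becomes input `s` of `x ∘ᵢ y`. -/
def InnerPos {m n r : ℕ} (i : Fin m) (j : Fin n) (s : Fin r) : Prop :=
  (s : ℕ) = i + j

/-- `x ∘ᵢ y` is defined for `x` with input colors `c` and `y` with input colors `e` and output
color `b`, and its input colors are `f`. -/
structure IsGraft {C : Type u} {m n r : ℕ} (i : Fin m) (b : C)
    (c : Fin m → C) (e : Fin n → C) (f : Fin r → C) : Prop where
  arity : m + n = r + 1
  color : c i = b
  outer : ∀ (j : Fin m) (s : Fin r), OuterPos i n j s → f s = c j
  inner : ∀ (j : Fin n) (s : Fin r), InnerPos i j s → f s = e j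

/-- The places in which the unit operad is nonzero: one input, of the same color as the output,
and degree zero. -/
def IsUnitPlace {C : Type u} {n : ℕ} (c : Fin n → C) (a : C) (p : ℤ) : Prop :=
  n = 1 ∧ (∀ i, c i = a) ∧ p = 0

end ColoredOperad

open ColoredOperad

/-- A `C`-colored (symmetric, unital) operad in the category of `ℤ`-graded chain complexes over
`k`, with differential of degree `-1`, given by its partial compositions. -/
structure DgOperad (k : Type u) [Field k] (C : Type u) where
  /-- `X c a p`: the elements of degree `p`, with input colors `c 0, …, c (n - 1)` and output
  color `a`. -/
  X : ∀ {n : ℕ}, (Fin n → C) → C → ℤ → Type u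
  [addCommGroup : ∀ {n : ℕ} (c : Fin n → C) (a : C) (p : ℤ), AddCommGroup (X c a p)]
  [module : ∀ {n : ℕ} (c : Fin n → C) (a : C) (p : ℤ), Module k (X c a p)]
  /-- The differential. -/
  d : ∀ {n : ℕ} {c : Fin n → C} {a : C} {p q : ℤ}, q + 1 = p → X c a p →ₗ[k] X c a q
  /-- The right action of the symmetric groups. -/
  act : ∀ {n : ℕ} {c : Fin n → C} {a : C} {p : ℤ} (σ : Equiv.Perm (Fin n)),
    X c a p →ₗ[k] X (c ∘ σ) a p
  /-- The unit of color `a`, an element of `X (a; a)` of degree `0`. -/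
  one : ∀ {n : ℕ} {c : Fin n → C} {a : C} {p : ℤ}, IsUnitPlace c a p → X c a p
  /-- The partial composition `x ∘ᵢ y`. -/
  comp : ∀ {m n r : ℕ} {i : Fin m} {a b : C} {c : Fin m → C} {e : Fin n → C} {f : Fin r → C}
    {p q t : ℤ}, IsGraft i b c e f → p + q = t → X c a p →ₗ[k] X e b q →ₗ[k] X f a t
  d_d : ∀ {n : ℕ} {c : Fin n → C} {a : C} {p q t : ℤ} (h : q + 1 = p) (h' : t + 1 = q)
    (x : X c a p), d h' (d h x) = 0
  d_act : ∀ {n : ℕ} {c : Fin n → C} {a : C} {p q : ℤ} (h : q + 1 = p) (σ : Equiv.Perm (Fin n))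
    (x : X c a p), d h (act σ x) = act σ (d h x)
  d_one : ∀ {n : ℕ} {c : Fin n → C} {a : C} {p q : ℤ} (h : q + 1 = p) (hu : IsUnitPlace c a p),
    d h (one hu) = 0
  d_comp : ∀ {m n r : ℕ} {i : Fin m} {a b : C} {c : Fin m → C} {e : Fin n → C} {f : Fin r → C}
    {p q t p' q' t' : ℤ} (hg : IsGraft i b c e f) (h : p + q = t)
    (hp : p' + 1 = p) (hq : q' + 1 = q) (ht : t' + 1 = t)
    (h₁ : p' + q = t') (h₂ : p + q' = t') (x : X c a p) (y : X e b q),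
    d ht (comp hg h x y) = comp hg h₁ (d hp x) y + ((-1 : k) ^ p) • comp hg h₂ x (d hq y)
  act_one : ∀ {n : ℕ} {c : Fin n → C} {a : C} {p : ℤ} (x : X c a p), act 1 x = x
  act_mul : ∀ {n : ℕ} {c : Fin n → C} {a : C} {p : ℤ} (σ τ : Equiv.Perm (Fin n)) (x : X c a p),
    act (σ * τ) x = act τ (act σ x)
  one_comp : ∀ {m n : ℕ} {i : Fin m} {b : C} {c : Fin m → C} {e : Fin n → C}
    {p q : ℤ} (hg : IsGraft i b c e e) (h : p + q = q) (hu : IsUnitPlace c b p) (y : X e b q),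
    comp hg h (one hu) y = y
  comp_one : ∀ {m n : ℕ} {i : Fin m} {a b : C} {c : Fin m → C} {e : Fin n → C}
    {p q : ℤ} (hg : IsGraft i b c e c) (h : p + q = p) (hu : IsUnitPlace e b q) (x : X c a p),
    comp hg h x (one hu) = x
  /-- Sequential associativity: `(x ∘ᵢ y) ∘ₛ z = x ∘ᵢ (y ∘ⱼ z)`, where `s` is the position in
  `x ∘ᵢ y` of the input `j` of `y`. -/
  assoc : ∀ {m n l r r' v : ℕ} {i : Fin m} {j : Fin n} {s : Fin r} {a b b' : C}
    {c : Fin m → C} {e : Fin n → C} {g : Fin l → C} {f : Fin r → C} {f' : Fin r' → C}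
    {w : Fin v → C} {p q t pq qt pqt : ℤ}
    (h₁ : IsGraft i b c e f) (h₂ : IsGraft s b' f g w)
    (h₃ : IsGraft j b' e g f') (h₄ : IsGraft i b c f' w) (_ : InnerPos i j s)
    (d₁ : p + q = pq) (d₂ : pq + t = pqt) (d₃ : q + t = qt) (d₄ : p + qt = pqt)
    (x : X c a p) (y : X e b q) (z : X g b' t),
    comp h₂ d₂ (comp h₁ d₁ x y) z = comp h₄ d₄ x (comp h₃ d₃ y z)
  /-- Parallel associativity: `(x ∘ᵢ y) ∘ₛ z = (-1)^(|y||z|) (x ∘ⱼ z) ∘ₛ' y` for `i ≠ j`, where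
  `s` is the position in `x ∘ᵢ y` of the input `j` of `x`, and `s'` that in `x ∘ⱼ z` of its
  input `i`. -/
  comm : ∀ {m n l r r' v : ℕ} {i j : Fin m} {s : Fin r} {s' : Fin r'} {a b b' : C}
    {c : Fin m → C} {e : Fin n → C} {g : Fin l → C} {f : Fin r → C} {f' : Fin r' → C}
    {w : Fin v → C} {p q t pq pt pqt : ℤ}
    (h₁ : IsGraft i b c e f) (h₂ : IsGraft s b' f g w)
    (h₃ : IsGraft j b' c g f') (h₄ : IsGraft s' b f' e w)
    (_ : OuterPos i n j s) (_ : OuterPos j l i s')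
    (d₁ : p + q = pq) (d₂ : pq + t = pqt) (d₃ : p + t = pt) (d₄ : pt + q = pqt)
    (x : X c a p) (y : X e b q) (z : X g b' t),
    comp h₂ d₂ (comp h₁ d₁ x y) z = ((-1 : k) ^ (q * t)) • comp h₄ d₄ (comp h₃ d₃ x z) y
  /-- Equivariance: `(x σ) ∘ᵢ (y τ) = (x ∘_{σ i} y) ρ`, where `ρ` is the block permutation
  determined by `i`, `σ` and `τ`. -/
  comp_act : ∀ {m n r : ℕ} {i : Fin m} {a b : C} {c : Fin m → C} {e : Fin n → C} {f : Fin r → C}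
    {p q t : ℤ} (σ : Equiv.Perm (Fin m)) (τ : Equiv.Perm (Fin n)) (ρ : Equiv.Perm (Fin r))
    (hg : IsGraft (σ i) b c e f) (hg' : IsGraft i b (c ∘ σ) (e ∘ τ) (f ∘ ρ))
    (_ : ∀ j s, OuterPos i n j s → OuterPos (σ i) n (σ j) (ρ s))
    (_ : ∀ (j : Fin n) s, InnerPos i j s → InnerPos (σ i) (τ j) (ρ s))
    (h : p + q = t) (x : X c a p) (y : X e b q),
    comp hg' h (act σ x) (act τ y) = act ρ (comp hg h x y)

namespace DgOperad

attribute [instance] DgOperad.addCommGroup DgOperad.module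

variable {k : Type u} [Field k] {C : Type u}

/-! ### The category of `C`-colored dg operads -/

/-- A morphism of `C`-colored dg operads. -/
@[ext]
structure Hom (P R : DgOperad k C) where
  app : ∀ {n : ℕ} {c : Fin n → C} {a : C} {p : ℤ}, P.X c a p →ₗ[k] R.X c a p
  app_d : ∀ {n : ℕ} {c : Fin n → C} {a : C} {p q : ℤ} (h : q + 1 = p) (x : P.X c a p),
    app (P.d h x) = R.d h (app x)
  app_act : ∀ {n : ℕ} {c : Fin n → C} {a : C} {p : ℤ} (σ : Equiv.Perm (Fin n)) (x : P.X c a p),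
    app (P.act σ x) = R.act σ (app x)
  app_one : ∀ {n : ℕ} {c : Fin n → C} {a : C} {p : ℤ} (hu : IsUnitPlace c a p),
    app (P.one hu) = R.one hu
  app_comp : ∀ {m n r : ℕ} {i : Fin m} {a b : C} {c : Fin m → C} {e : Fin n → C} {f : Fin r → C}
    {p q t : ℤ} (hg : IsGraft i b c e f) (h : p + q = t) (x : P.X c a p) (y : P.X e b q),
    app (P.comp hg h x y) = R.comp hg h (app x) (app y)

instance : Category (DgOperad k C) where
  Hom := Hom
  id P :=
    { app := LinearMap.id
      app_d := fun _ _ => rfl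
      app_act := fun _ _ => rfl
      app_one := fun _ => rfl
      app_comp := fun _ _ _ _ => rfl }
  comp F G :=
    { app := G.app ∘ₗ F.app
      app_d := fun h x => by simp [F.app_d, G.app_d]
      app_act := fun σ x => by simp [F.app_act, G.app_act]
      app_one := fun hu => by simp [F.app_one, G.app_one]
      app_comp := fun hg h x y => by simp [F.app_comp, G.app_comp] }

theorem hom_ext {P R : DgOperad k C} {F G : P ⟶ R}
    (h : ∀ {n : ℕ} {c : Fin n → C} {a : C} {p : ℤ} (x : P.X c a p),
      Hom.app F x = Hom.app G x) : F = G := by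
  apply Hom.ext
  funext n c a p
  exact LinearMap.ext fun x => h x

@[simp]
theorem id_app (P : DgOperad k C) {n : ℕ} {c : Fin n → C} {a : C} {p : ℤ} (x : P.X c a p) :
    Hom.app (𝟙 P) x = x := rfl

@[simp]
theorem comp_app {P R T : DgOperad k C} (F : P ⟶ R) (G : R ⟶ T)
    {n : ℕ} {c : Fin n → C} {a : C} {p : ℤ} (x : P.X c a p) :
    Hom.app (F ≫ G) x = Hom.app G (Hom.app F x) := rfl

/-! ### The unit operad and augmentations -/

/-- `k` in the places of the unit, and `0` elsewhere. -/
def unitX (k : Type u) [Field k] {C : Type u} {n : ℕ} (c : Fin n → C) (a : C) (p : ℤ) :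
    Submodule k k where
  carrier := {x | ¬ IsUnitPlace c a p → x = 0}
  add_mem' hx hy h := by rw [hx h, hy h, add_zero]
  zero_mem' _ := rfl
  smul_mem' r x hx h := by rw [hx h, smul_zero]

theorem isUnitPlace_graft {m n r : ℕ} {i : Fin m} {a b : C} {c : Fin m → C} {e : Fin n → C}
    {f : Fin r → C} {p q t : ℤ} (hg : IsGraft i b c e f) (h : p + q = t)
    (hx : IsUnitPlace c a p) (hy : IsUnitPlace e b q) : IsUnitPlace f a t := by
  obtain ⟨rfl, hc, rfl⟩ := hx
  obtain ⟨rfl, he, rfl⟩ := hy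
  have hr : r = 1 := by have := hg.arity; omega
  subst hr
  refine ⟨rfl, fun s => ?_, by omega⟩
  have h1 : InnerPos i (0 : Fin 1) s := by
    simp [InnerPos, Subsingleton.elim i 0, Subsingleton.elim s 0]
  rw [hg.inner 0 s h1, he 0, ← hg.color, hc]

theorem isUnitPlace_perm {n : ℕ} {c : Fin n → C} {a : C} {p : ℤ} (σ : Equiv.Perm (Fin n)) :
    IsUnitPlace (c ∘ σ) a p ↔ IsUnitPlace c a p := by
  unfold IsUnitPlace
  refine and_congr_right fun _ => and_congr_left fun _ => ?_
  exact ⟨fun h i => by simpa using h (σ.symm i), fun h i => h _⟩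

/-- The action of the symmetric groups on the trivial operad. -/
def unitAct {n : ℕ} {c : Fin n → C} {a : C} {p : ℤ} (σ : Equiv.Perm (Fin n)) :
    unitX k c a p →ₗ[k] unitX k (c ∘ σ) a p where
  toFun x := ⟨x.1, fun h => x.2 fun h' => h ((isUnitPlace_perm σ).2 h')⟩
  map_add' _ _ := rfl
  map_smul' _ _ := rfl

/-- The composition in the trivial operad is the product of `k`. -/
def unitComp {m n r : ℕ} {i : Fin m} {a b : C} {c : Fin m → C} {e : Fin n → C}
    {f : Fin r → C} {p q t : ℤ} (hg : IsGraft i b c e f) (h : p + q = t) :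
    unitX k c a p →ₗ[k] unitX k e b q →ₗ[k] unitX k f a t :=
  LinearMap.mk₂ k
    (fun x y => ⟨x.1 * y.1, fun hn => by
      by_contra h0
      rw [mul_eq_zero, not_or] at h0
      exact hn (isUnitPlace_graft hg h (by_contra fun hx => h0.1 (x.2 hx))
        (by_contra fun hy => h0.2 (y.2 hy)))⟩)
    (fun x x' y => Subtype.ext (add_mul _ _ _))
    (fun r x y => Subtype.ext (mul_assoc _ _ _))
    (fun x y y' => Subtype.ext (mul_add _ _ _))
    (fun r x y => Subtype.ext (mul_left_comm _ _ _))

/-- The trivial `C`-colored operad: `k` in the places of the unit, `0` elsewhere. -/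
def unit (k : Type u) [Field k] (C : Type u) : DgOperad k C where
  X c a p := unitX k c a p
  d _ := 0
  act σ := unitAct σ
  one hu := ⟨1, fun h => absurd hu h⟩
  comp hg h := unitComp hg h
  d_d _ _ _ := rfl
  d_act _ σ _ := (map_zero (unitAct σ)).symm
  d_one _ _ := rfl
  d_comp := by
    intro m n r i a b c e f p q t p' q' t' hg h hp hq ht h₁ h₂ x y
    refine Subtype.ext ?_
    change (0 : k) = 0 * y.1 + (-1) ^ p * (x.1 * 0)
    simp
  act_one _ := rfl
  act_mul _ _ _ := rfl
  one_comp _ _ _ y := Subtype.ext (one_mul _)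
  comp_one _ _ _ x := Subtype.ext (mul_one _)
  assoc := by
    intros
    exact Subtype.ext (mul_assoc _ _ _)
  comm := by
    intro m n l r r' v i j s s' a b b' c e g f f' w p q t pq pt pqt h₁ h₂ h₃ h₄ hs hs'
      d₁ d₂ d₃ d₄ x y z
    have hx : x.1 = 0 := by
      refine x.2 fun hx => ?_
      have hm := hx.1
      subst hm
      simp [OuterPos, Subsingleton.elim i j] at hs
    refine Subtype.ext ?_
    change x.1 * y.1 * z.1 = (-1) ^ (q * t) * (x.1 * z.1 * y.1)
    simp [hx]
  comp_act _ _ _ _ _ _ _ _ _ _ := rfl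

theorem act_one' (P : DgOperad k C) {n : ℕ} {c : Fin n → C} {a : C} {p : ℤ}
    (σ : Equiv.Perm (Fin n)) (hu : IsUnitPlace c a p) (hu' : IsUnitPlace (c ∘ σ) a p) :
    P.act σ (P.one hu) = P.one hu' := by
  have hn := hu.1
  subst hn
  have hσ : σ = 1 := Subsingleton.elim _ _
  subst hσ
  exact P.act_one _

theorem comp_one_one (P : DgOperad k C) {m n r : ℕ} {i : Fin m} {a b : C} {c : Fin m → C}
    {e : Fin n → C} {f : Fin r → C} {p q t : ℤ} (hg : IsGraft i b c e f) (h : p + q = t)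
    (hx : IsUnitPlace c a p) (hy : IsUnitPlace e b q) (hf : IsUnitPlace f a t) :
    P.comp hg h (P.one hx) (P.one hy) = P.one hf := by
  have hm := hx.1
  have hn := hy.1
  have hr := hf.1
  subst hm hn hr
  have hab : b = a := by rw [← hg.color, hx.2.1]
  subst hab
  have hcf : c = f := by
    funext j
    rw [hx.2.1, hf.2.1]
  subst hcf
  have hp : p = t := by rw [hx.2.2, hf.2.2]
  subst hp
  exact P.comp_one hg h hy _

/-- The element `x • 1` of `P`. -/
noncomputable def smulOne (P : DgOperad k C) {n : ℕ} (c : Fin n → C) (a : C) (p : ℤ) :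
    unitX k c a p →ₗ[k] P.X c a p :=
  open Classical in
  if hu : IsUnitPlace c a p then
    LinearMap.toSpanSingleton k (P.X c a p) (P.one hu) ∘ₗ (unitX k c a p).subtype
  else 0

theorem smulOne_apply (P : DgOperad k C) {n : ℕ} {c : Fin n → C} {a : C} {p : ℤ}
    (hu : IsUnitPlace c a p) (x : unitX k c a p) :
    P.smulOne c a p x = (x : k) • P.one hu := by
  rw [smulOne, dif_pos hu]
  rfl

theorem unitX_eq_zero {n : ℕ} {c : Fin n → C} {a : C} {p : ℤ}
    (hu : ¬ IsUnitPlace c a p) (x : unitX k c a p) : x = 0 :=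
  Subtype.ext (x.2 hu)

theorem smulOne_act (P : DgOperad k C) {n : ℕ} {c : Fin n → C} {a : C} {p : ℤ}
    (σ : Equiv.Perm (Fin n)) (x : unitX k c a p) :
    P.smulOne (c ∘ σ) a p (unitAct σ x) = P.act σ (P.smulOne c a p x) := by
  by_cases hu : IsUnitPlace c a p
  · have hu' := (isUnitPlace_perm σ).2 hu
    rw [smulOne_apply P hu, smulOne_apply P hu', map_smul, act_one' P σ hu hu']
    rfl
  · rw [unitX_eq_zero hu x, map_zero, map_zero, map_zero, map_zero]

theorem smulOne_comp (P : DgOperad k C) {m n r : ℕ} {i : Fin m} {a b : C} {c : Fin m → C}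
    {e : Fin n → C} {f : Fin r → C} {p q t : ℤ} (hg : IsGraft i b c e f) (h : p + q = t)
    (x : unitX k c a p) (y : unitX k e b q) :
    P.smulOne f a t (unitComp hg h x y) =
      P.comp hg h (P.smulOne c a p x) (P.smulOne e b q y) := by
  by_cases hx : IsUnitPlace c a p
  · by_cases hy : IsUnitPlace e b q
    · have hf := isUnitPlace_graft hg h hx hy
      rw [smulOne_apply P hx, smulOne_apply P hy, smulOne_apply P hf, map_smul,
        map_smul, LinearMap.smul_apply, comp_one_one P hg h hx hy hf, smul_smul, mul_comm]
      rfl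
    · rw [unitX_eq_zero hy y, map_zero, map_zero, map_zero, map_zero]
  · rw [unitX_eq_zero hx x, map_zero, map_zero, map_zero, LinearMap.zero_apply,
      LinearMap.zero_apply, map_zero]

theorem d_smulOne (P : DgOperad k C) {n : ℕ} {c : Fin n → C} {a : C} {p q : ℤ} (h : q + 1 = p)
    (x : unitX k c a p) : P.d h (P.smulOne c a p x) = 0 := by
  by_cases hu : IsUnitPlace c a p
  · rw [smulOne_apply P hu, map_smul, P.d_one, smul_zero]
  · rw [unitX_eq_zero hu x, map_zero, map_zero]

/-- The morphism from the trivial operad to `P` given by the units of `P`. -/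
noncomputable def unitHom (P : DgOperad k C) : unit k C ⟶ P :=
  Hom.mk (P := unit k C) (R := P) (fun {n c a p} => P.smulOne c a p)
    (fun {n c a p q} h x => (map_zero (P.smulOne c a q)).trans (P.d_smulOne h x).symm)
    (fun σ x => P.smulOne_act σ x)
    (fun {n c a p} hu => (P.smulOne_apply hu _).trans (one_smul k _))
    (fun hg h x y => P.smulOne_comp hg h x y)

/-- `P` is augmented: there is a morphism of dg operads `ε : P ⟶ 1` with `ε η = id`. -/
def IsAugmented (P : DgOperad k C) : Prop :=
  ∃ ε : P ⟶ unit k C, unitHom P ≫ ε = 𝟙 (unit k C)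

/-! ### Homology -/

/-- The cycles of degree `p`. -/
def cycles (P : DgOperad k C) {n : ℕ} (c : Fin n → C) (a : C) (p : ℤ) :
    Submodule k (P.X c a p) :=
  LinearMap.ker (P.d (c := c) (a := a) (sub_add_cancel p 1))

/-- The boundaries of degree `p`, inside the cycles. -/
def boundaries (P : DgOperad k C) {n : ℕ} (c : Fin n → C) (a : C) (p : ℤ) :
    Submodule k (P.cycles c a p) :=
  (LinearMap.range (P.d (c := c) (a := a) (rfl : p + 1 = p + 1))).comap
    (P.cycles c a p).subtype

/-- Homology: cycles modulo boundaries. -/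
abbrev homologyX (P : DgOperad k C) {n : ℕ} (c : Fin n → C) (a : C) (p : ℤ) : Type u :=
  P.cycles c a p ⧸ P.boundaries c a p

theorem d_cycle (P : DgOperad k C) {n : ℕ} {c : Fin n → C} {a : C} {p q : ℤ} (h : q + 1 = p)
    (x : P.cycles c a p) : P.d h (x : P.X c a p) = 0 := by
  obtain rfl : q = p - 1 := by omega
  exact x.2

theorem mem_cycles (P : DgOperad k C) {n : ℕ} {c : Fin n → C} {a : C} {p : ℤ} {x : P.X c a p} :
    x ∈ P.cycles c a p ↔ P.d (sub_add_cancel p 1) x = 0 := Iff.rfl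

theorem mem_boundaries (P : DgOperad k C) {n : ℕ} {c : Fin n → C} {a : C} {p : ℤ}
    {x : P.cycles c a p} :
    x ∈ P.boundaries c a p ↔ ∃ w : P.X c a (p + 1), P.d rfl w = (x : P.X c a p) := Iff.rfl

/-- The composition of cycles. -/
def cyclesComp (P : DgOperad k C) {m n r : ℕ} {i : Fin m} {a b : C} {c : Fin m → C}
    {e : Fin n → C} {f : Fin r → C} {p q t : ℤ} (hg : IsGraft i b c e f) (h : p + q = t) :
    P.cycles c a p →ₗ[k] P.cycles e b q →ₗ[k] P.cycles f a t :=
  LinearMap.mk₂ k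
    (fun x y => ⟨P.comp hg h x y, by
      rw [mem_cycles, P.d_comp hg h (sub_add_cancel p 1) (sub_add_cancel q 1) _
        (by omega) (by omega), d_cycle, d_cycle]
      simp⟩)
    (fun x x' y => Subtype.ext (by simp))
    (fun r x y => Subtype.ext (by simp))
    (fun x y y' => Subtype.ext (by simp))
    (fun r x y => Subtype.ext (by simp))

theorem cyclesComp_coe (P : DgOperad k C) {m n r : ℕ} {i : Fin m} {a b : C} {c : Fin m → C}
    {e : Fin n → C} {f : Fin r → C} {p q t : ℤ} (hg : IsGraft i b c e f) (h : p + q = t)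
    (x : P.cycles c a p) (y : P.cycles e b q) :
    (P.cyclesComp hg h x y : P.X f a t) = P.comp hg h x y := rfl

theorem cyclesComp_mem_right (P : DgOperad k C) {m n r : ℕ} {i : Fin m} {a b : C}
    {c : Fin m → C} {e : Fin n → C} {f : Fin r → C} {p q t : ℤ} (hg : IsGraft i b c e f)
    (h : p + q = t) (x : P.cycles c a p) {y : P.cycles e b q} (hy : y ∈ P.boundaries e b q) :
    P.cyclesComp hg h x y ∈ P.boundaries f a t := by
  obtain ⟨w, hw⟩ := P.mem_boundaries.1 hy
  refine P.mem_boundaries.2 ⟨((-1 : k) ^ p) • P.comp hg (by omega) (x : P.X c a p) w, ?_⟩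
  rw [map_smul, P.d_comp hg (t := t + 1) (by omega) (sub_add_cancel p 1) rfl rfl
    (by omega) h, d_cycle, hw, smul_add, smul_smul, ← mul_zpow, cyclesComp_coe]
  simp

theorem cyclesComp_mem_left (P : DgOperad k C) {m n r : ℕ} {i : Fin m} {a b : C}
    {c : Fin m → C} {e : Fin n → C} {f : Fin r → C} {p q t : ℤ} (hg : IsGraft i b c e f)
    (h : p + q = t) {x : P.cycles c a p} (hx : x ∈ P.boundaries c a p) (y : P.cycles e b q) :
    P.cyclesComp hg h x y ∈ P.boundaries f a t := by
  obtain ⟨w, hw⟩ := P.mem_boundaries.1 hx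
  refine P.mem_boundaries.2 ⟨P.comp hg (by omega) w (y : P.X e b q), ?_⟩
  rw [P.d_comp hg (t := t + 1) (by omega) rfl (sub_add_cancel q 1) rfl h (by omega),
    d_cycle, hw, cyclesComp_coe]
  simp

/-- The composition of homology classes, `[x] ∘ᵢ [y] = [x ∘ᵢ y]`. -/
def homologyComp (P : DgOperad k C) {m n r : ℕ} {i : Fin m} {a b : C} {c : Fin m → C}
    {e : Fin n → C} {f : Fin r → C} {p q t : ℤ} (hg : IsGraft i b c e f) (h : p + q = t) :
    P.homologyX c a p →ₗ[k] P.homologyX e b q →ₗ[k] P.homologyX f a t :=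
  Submodule.liftQ (P.boundaries c a p)
    (LinearMap.flip (Submodule.liftQ (P.boundaries e b q)
      (LinearMap.flip ((P.cyclesComp hg h).compr₂ (P.boundaries f a t).mkQ))
      (fun y hy => LinearMap.ext fun x =>
        (Submodule.Quotient.mk_eq_zero _).2 (P.cyclesComp_mem_right hg h x hy))))
    (fun x hx => LinearMap.ext fun y => by
      obtain ⟨y, rfl⟩ := Submodule.mkQ_surjective _ y
      exact (Submodule.Quotient.mk_eq_zero _).2 (P.cyclesComp_mem_left hg h hx y))

/-- The action on cycles. -/
def cyclesAct (P : DgOperad k C) {n : ℕ} {c : Fin n → C} {a : C} {p : ℤ}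
    (σ : Equiv.Perm (Fin n)) : P.cycles c a p →ₗ[k] P.cycles (c ∘ σ) a p :=
  (P.act σ).restrict fun x hx => by
    rw [mem_cycles] at hx ⊢
    rw [P.d_act, hx, map_zero]

/-- The action on homology classes. -/
def homologyAct (P : DgOperad k C) {n : ℕ} {c : Fin n → C} {a : C} {p : ℤ}
    (σ : Equiv.Perm (Fin n)) : P.homologyX c a p →ₗ[k] P.homologyX (c ∘ σ) a p :=
  Submodule.mapQ _ _ (P.cyclesAct σ) (by
    intro x hx
    obtain ⟨w, hw⟩ := P.mem_boundaries.1 hx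
    refine P.mem_boundaries.2 ⟨P.act σ w, ?_⟩
    rw [P.d_act, hw]
    rfl)

/-- The homology class of a cycle. -/
abbrev cls (P : DgOperad k C) {n : ℕ} {c : Fin n → C} {a : C} {p : ℤ} (x : P.cycles c a p) :
    P.homologyX c a p :=
  Submodule.Quotient.mk x

theorem cls_surjective (P : DgOperad k C) {n : ℕ} {c : Fin n → C} {a : C} {p : ℤ}
    (x : P.homologyX c a p) : ∃ y, P.cls y = x :=
  Submodule.Quotient.mk_surjective _ x

theorem homologyComp_cls (P : DgOperad k C) {m n r : ℕ} {i : Fin m} {a b : C} {c : Fin m → C}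
    {e : Fin n → C} {f : Fin r → C} {p q t : ℤ} (hg : IsGraft i b c e f) (h : p + q = t)
    (x : P.cycles c a p) (y : P.cycles e b q) :
    P.homologyComp hg h (P.cls x) (P.cls y) = P.cls (P.cyclesComp hg h x y) := rfl

theorem homologyAct_cls (P : DgOperad k C) {n : ℕ} {c : Fin n → C} {a : C} {p : ℤ}
    (σ : Equiv.Perm (Fin n)) (x : P.cycles c a p) :
    P.homologyAct σ (P.cls x) = P.cls (P.cyclesAct σ x) := rfl

/-- The homology operad `H(P)`, with zero differential. -/
def homologyOperad (P : DgOperad k C) : DgOperad k C where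
  X c a p := P.homologyX c a p
  d _ := 0
  act σ := P.homologyAct σ
  one hu := P.cls ⟨P.one hu, P.d_one _ hu⟩
  comp hg h := P.homologyComp hg h
  d_d _ _ _ := rfl
  d_act _ σ _ := (map_zero (P.homologyAct σ)).symm
  d_one _ _ := rfl
  d_comp := by intros; simp
  act_one x := by
    obtain ⟨x, rfl⟩ := P.cls_surjective x
    exact congrArg P.cls (Subtype.ext (P.act_one _))
  act_mul σ τ x := by
    obtain ⟨x, rfl⟩ := P.cls_surjective x
    exact congrArg P.cls (Subtype.ext (P.act_mul σ τ _))
  one_comp hg h hu y := by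
    obtain ⟨y, rfl⟩ := P.cls_surjective y
    exact congrArg P.cls (Subtype.ext (P.one_comp hg h hu _))
  comp_one hg h hu x := by
    obtain ⟨x, rfl⟩ := P.cls_surjective x
    exact congrArg P.cls (Subtype.ext (P.comp_one hg h hu _))
  assoc h₁ h₂ h₃ h₄ hs d₁ d₂ d₃ d₄ x y z := by
    obtain ⟨x, rfl⟩ := P.cls_surjective x
    obtain ⟨y, rfl⟩ := P.cls_surjective y
    obtain ⟨z, rfl⟩ := P.cls_surjective z
    exact congrArg P.cls (Subtype.ext (P.assoc h₁ h₂ h₃ h₄ hs d₁ d₂ d₃ d₄ _ _ _))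
  comm h₁ h₂ h₃ h₄ hs hs' d₁ d₂ d₃ d₄ x y z := by
    obtain ⟨x, rfl⟩ := P.cls_surjective x
    obtain ⟨y, rfl⟩ := P.cls_surjective y
    obtain ⟨z, rfl⟩ := P.cls_surjective z
    exact congrArg P.cls (Subtype.ext (P.comm h₁ h₂ h₃ h₄ hs hs' d₁ d₂ d₃ d₄ _ _ _))
  comp_act σ τ ρ hg hg' ho hi h x y := by
    obtain ⟨x, rfl⟩ := P.cls_surjective x
    obtain ⟨y, rfl⟩ := P.cls_surjective y
    exact congrArg P.cls (Subtype.ext (P.comp_act σ τ ρ hg hg' ho hi h _ _))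

/-- A morphism restricted to cycles. -/
def cyclesMap {P R : DgOperad k C} (F : P ⟶ R) {n : ℕ} (c : Fin n → C) (a : C) (p : ℤ) :
    P.cycles c a p →ₗ[k] R.cycles c a p :=
  (Hom.app F).restrict fun x hx => by
    rw [mem_cycles] at hx ⊢
    rw [← Hom.app_d, hx, map_zero]

/-- The morphism `H(F)`, `[x] ↦ [F x]`. -/
def homologyMap {P R : DgOperad k C} (F : P ⟶ R) : P.homologyOperad ⟶ R.homologyOperad :=
  Hom.mk (P := P.homologyOperad) (R := R.homologyOperad)
    (fun {n c a p} => Submodule.mapQ (P.boundaries c a p) (R.boundaries c a p)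
      (cyclesMap F c a p) (by
        intro x hx
        obtain ⟨w, hw⟩ := P.mem_boundaries.1 hx
        refine R.mem_boundaries.2 ⟨Hom.app F w, ?_⟩
        rw [← Hom.app_d, hw]
        rfl))
    (by
      intro n c a p q h x
      exact map_zero _)
    (by
      intro n c a p σ x
      obtain ⟨x, rfl⟩ := P.cls_surjective x
      exact congrArg R.cls (Subtype.ext (Hom.app_act F σ _)))
    (by
      intro n c a p hu
      exact congrArg R.cls (Subtype.ext (Hom.app_one F hu)))
    (by
      intro m n r i a b c e f p q t hg h x y
      obtain ⟨x, rfl⟩ := P.cls_surjective x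
      obtain ⟨y, rfl⟩ := P.cls_surjective y
      exact congrArg R.cls (Subtype.ext (Hom.app_comp F hg h _ _)))

/-- The homology functor, from dg operads to dg operads (with zero differential). -/
def homology (k : Type u) [Field k] (C : Type u) : DgOperad k C ⥤ DgOperad k C where
  obj P := P.homologyOperad
  map F := homologyMap F
  map_id P := hom_ext fun x => by
    obtain ⟨x, rfl⟩ := P.cls_surjective x
    rfl
  map_comp {P R T} F G := hom_ext fun x => by
    obtain ⟨x, rfl⟩ := P.cls_surjective x
    rfl

/-! ### The free product

The free product is the coproduct in the category of dg operads, `S ⨿ Q` in Mathlib's notation.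
Here it is shown to exist: it consists of the formal expressions in elements of `S` and `Q`,
modulo the identities that hold under all pairs of morphisms from `S` and `Q` to a dg operad. -/

/-- Formal expressions in elements of `S` and `Q`. -/
inductive Expr (S Q : DgOperad k C) : ∀ {n : ℕ}, (Fin n → C) → C → ℤ → Type u
  | inl {n : ℕ} {c : Fin n → C} {a : C} {p : ℤ} (x : S.X c a p) : Expr S Q c a p
  | inr {n : ℕ} {c : Fin n → C} {a : C} {p : ℤ} (x : Q.X c a p) : Expr S Q c a p
  | zero {n : ℕ} {c : Fin n → C} {a : C} {p : ℤ} : Expr S Q c a p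
  | add {n : ℕ} {c : Fin n → C} {a : C} {p : ℤ} (x y : Expr S Q c a p) : Expr S Q c a p
  | smul {n : ℕ} {c : Fin n → C} {a : C} {p : ℤ} (s : k) (x : Expr S Q c a p) : Expr S Q c a p
  | d {n : ℕ} {c : Fin n → C} {a : C} {p q : ℤ} (h : q + 1 = p) (x : Expr S Q c a p) :
      Expr S Q c a q
  | act {n : ℕ} {c : Fin n → C} {a : C} {p : ℤ} (σ : Equiv.Perm (Fin n)) (x : Expr S Q c a p) :
      Expr S Q (c ∘ σ) a p
  | one {n : ℕ} {c : Fin n → C} {a : C} {p : ℤ} (hu : IsUnitPlace c a p) : Expr S Q c a p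
  | comp {m n r : ℕ} {i : Fin m} {a b : C} {c : Fin m → C} {e : Fin n → C} {f : Fin r → C}
      {p q t : ℤ} (hg : IsGraft i b c e f) (h : p + q = t)
      (x : Expr S Q c a p) (y : Expr S Q e b q) : Expr S Q f a t

variable {S Q : DgOperad k C}

/-- The value of an expression under a pair of morphisms. -/
def Expr.eval {T : DgOperad k C} (F : S ⟶ T) (G : Q ⟶ T) :
    ∀ {n : ℕ} {c : Fin n → C} {a : C} {p : ℤ}, Expr S Q c a p → T.X c a p
  | _, _, _, _, .inl x => Hom.app F x
  | _, _, _, _, .inr x => Hom.app G x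
  | _, _, _, _, .zero => 0
  | _, _, _, _, .add x y => x.eval F G + y.eval F G
  | _, _, _, _, .smul s x => s • x.eval F G
  | _, _, _, _, .d h x => T.d h (x.eval F G)
  | _, _, _, _, .act σ x => T.act σ (x.eval F G)
  | _, _, _, _, .one hu => T.one hu
  | _, _, _, _, .comp hg h x y => T.comp hg h (x.eval F G) (y.eval F G)

/-- Two expressions are identified if they have the same value under all pairs of morphisms. -/
def exprSetoid (S Q : DgOperad k C) {n : ℕ} (c : Fin n → C) (a : C) (p : ℤ) :
    Setoid (Expr S Q c a p) where
  r x y := ∀ (T : DgOperad k C) (F : S ⟶ T) (G : Q ⟶ T), x.eval F G = y.eval F G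
  iseqv :=
    { refl := fun _ _ _ _ => rfl
      symm := fun h T F G => (h T F G).symm
      trans := fun h h' T F G => (h T F G).trans (h' T F G) }

/-- The elements of the free product. -/
def FreeX (S Q : DgOperad k C) {n : ℕ} (c : Fin n → C) (a : C) (p : ℤ) : Type u :=
  Quotient (exprSetoid S Q c a p)

instance {n : ℕ} (c : Fin n → C) (a : C) (p : ℤ) : Zero (FreeX S Q c a p) :=
  ⟨Quotient.mk _ .zero⟩

instance {n : ℕ} (c : Fin n → C) (a : C) (p : ℤ) : Add (FreeX S Q c a p) :=
  ⟨Quotient.map₂ .add fun _ _ h _ _ h' T F G => congrArg₂ (· + ·) (h T F G) (h' T F G)⟩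

instance {n : ℕ} (c : Fin n → C) (a : C) (p : ℤ) : Neg (FreeX S Q c a p) :=
  ⟨Quotient.map (.smul (-1)) fun _ _ h T F G => congrArg ((-1 : k) • ·) (h T F G)⟩

instance {n : ℕ} (c : Fin n → C) (a : C) (p : ℤ) : AddCommGroup (FreeX S Q c a p) where
  add_assoc := by
    rintro ⟨x⟩ ⟨y⟩ ⟨z⟩
    exact Quotient.sound fun T F G => add_assoc _ _ _
  zero_add := by
    rintro ⟨x⟩
    exact Quotient.sound fun T F G => zero_add _
  add_zero := by
    rintro ⟨x⟩
    exact Quotient.sound fun T F G => add_zero _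
  neg_add_cancel := by
    rintro ⟨x⟩
    refine Quotient.sound fun T F G => ?_
    change (-1 : k) • x.eval F G + x.eval F G = 0
    rw [neg_one_smul, neg_add_cancel]
  add_comm := by
    rintro ⟨x⟩ ⟨y⟩
    exact Quotient.sound fun T F G => add_comm _ _
  nsmul := nsmulRec
  zsmul := zsmulRec

instance {n : ℕ} (c : Fin n → C) (a : C) (p : ℤ) : Module k (FreeX S Q c a p) where
  smul s := Quotient.map (.smul s) fun _ _ h T F G => congrArg (s • ·) (h T F G)
  one_smul := by
    rintro ⟨x⟩
    exact Quotient.sound fun T F G => one_smul _ _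
  mul_smul := by
    rintro s t ⟨x⟩
    exact Quotient.sound fun T F G => mul_smul _ _ _
  smul_zero s := Quotient.sound fun T F G => smul_zero _
  smul_add := by
    rintro s ⟨x⟩ ⟨y⟩
    exact Quotient.sound fun T F G => smul_add _ _ _
  add_smul := by
    rintro s t ⟨x⟩
    exact Quotient.sound fun T F G => add_smul _ _ _
  zero_smul := by
    rintro ⟨x⟩
    exact Quotient.sound fun T F G => zero_smul _ _

/-- The free product of `S` and `Q`. -/
def freeProduct (S Q : DgOperad k C) : DgOperad k C where
  X c a p := FreeX S Q c a p
  d h :=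
    { toFun := Quotient.map (.d h) fun _ _ e T F G => congrArg (T.d h) (e T F G)
      map_add' := by
        rintro ⟨x⟩ ⟨y⟩
        exact Quotient.sound fun T F G => map_add _ _ _
      map_smul' := by
        rintro s ⟨x⟩
        exact Quotient.sound fun T F G => map_smul _ _ _ }
  act σ :=
    { toFun := Quotient.map (.act σ) fun _ _ e T F G => congrArg (T.act σ) (e T F G)
      map_add' := by
        rintro ⟨x⟩ ⟨y⟩
        exact Quotient.sound fun T F G => map_add _ _ _
      map_smul' := by
        rintro s ⟨x⟩
        exact Quotient.sound fun T F G => map_smul _ _ _ }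
  one hu := Quotient.mk _ (.one hu)
  comp hg h := LinearMap.mk₂ k
    (Quotient.map₂ (.comp hg h) fun _ _ e _ _ e' T F G =>
      congrArg₂ (fun x y => T.comp hg h x y) (e T F G) (e' T F G))
    (by
      rintro ⟨x⟩ ⟨x'⟩ ⟨y⟩
      exact Quotient.sound fun T F G => LinearMap.map_add₂ _ _ _ _)
    (by
      rintro s ⟨x⟩ ⟨y⟩
      exact Quotient.sound fun T F G => LinearMap.map_smul₂ _ _ _ _)
    (by
      rintro ⟨x⟩ ⟨y⟩ ⟨y'⟩
      exact Quotient.sound fun T F G => map_add _ _ _)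
    (by
      rintro s ⟨x⟩ ⟨y⟩
      exact Quotient.sound fun T F G => map_smul _ _ _)
  d_d h h' := by
    rintro ⟨x⟩
    exact Quotient.sound fun T F G => T.d_d h h' _
  d_act h σ := by
    rintro ⟨x⟩
    exact Quotient.sound fun T F G => T.d_act h σ _
  d_one h hu := Quotient.sound fun T F G => T.d_one h hu
  d_comp hg h hp hq ht h₁ h₂ := by
    rintro ⟨x⟩ ⟨y⟩
    exact Quotient.sound fun T F G => T.d_comp hg h hp hq ht h₁ h₂ _ _
  act_one := by
    rintro n c a p ⟨x⟩
    exact Quotient.sound fun T F G => T.act_one _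
  act_mul σ τ := by
    rintro ⟨x⟩
    exact Quotient.sound fun T F G => T.act_mul σ τ _
  one_comp hg h hu := by
    rintro ⟨y⟩
    exact Quotient.sound fun T F G => T.one_comp hg h hu _
  comp_one hg h hu := by
    rintro ⟨x⟩
    exact Quotient.sound fun T F G => T.comp_one hg h hu _
  assoc h₁ h₂ h₃ h₄ hs d₁ d₂ d₃ d₄ := by
    rintro ⟨x⟩ ⟨y⟩ ⟨z⟩
    exact Quotient.sound fun T F G => T.assoc h₁ h₂ h₃ h₄ hs d₁ d₂ d₃ d₄ _ _ _
  comm h₁ h₂ h₃ h₄ hs hs' d₁ d₂ d₃ d₄ := by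
    rintro ⟨x⟩ ⟨y⟩ ⟨z⟩
    exact Quotient.sound fun T F G => T.comm h₁ h₂ h₃ h₄ hs hs' d₁ d₂ d₃ d₄ _ _ _
  comp_act σ τ ρ hg hg' ho hi h := by
    rintro ⟨x⟩ ⟨y⟩
    exact Quotient.sound fun T F G => T.comp_act σ τ ρ hg hg' ho hi h _ _

/-- The inclusion of the first factor. -/
def freeInl (S Q : DgOperad k C) : S ⟶ freeProduct S Q :=
  Hom.mk (P := S) (R := freeProduct S Q)
    (fun {n c a p} =>
      { toFun := fun x => Quotient.mk (exprSetoid S Q c a p) (.inl x)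
        map_add' := fun _ _ => Quotient.sound fun T F G => map_add _ _ _
        map_smul' := fun _ _ => Quotient.sound fun T F G => map_smul _ _ _ })
    (fun h x => Quotient.sound fun T F G => Hom.app_d F h x)
    (fun σ x => Quotient.sound fun T F G => Hom.app_act F σ x)
    (fun hu => Quotient.sound fun T F G => Hom.app_one F hu)
    (fun hg h x y => Quotient.sound fun T F G => Hom.app_comp F hg h x y)

/-- The inclusion of the second factor. -/
def freeInr (S Q : DgOperad k C) : Q ⟶ freeProduct S Q :=
  Hom.mk (P := Q) (R := freeProduct S Q)
    (fun {n c a p} =>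
      { toFun := fun x => Quotient.mk (exprSetoid S Q c a p) (.inr x)
        map_add' := fun _ _ => Quotient.sound fun T F G => map_add _ _ _
        map_smul' := fun _ _ => Quotient.sound fun T F G => map_smul _ _ _ })
    (fun h x => Quotient.sound fun T F G => Hom.app_d G h x)
    (fun σ x => Quotient.sound fun T F G => Hom.app_act G σ x)
    (fun hu => Quotient.sound fun T F G => Hom.app_one G hu)
    (fun hg h x y => Quotient.sound fun T F G => Hom.app_comp G hg h x y)

/-- The morphism from the free product given by a pair of morphisms. -/
def freeDesc {T : DgOperad k C} (F : S ⟶ T) (G : Q ⟶ T) : freeProduct S Q ⟶ T :=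
  Hom.mk (P := freeProduct S Q) (R := T)
    (fun {n c a p} =>
      { toFun := Quotient.lift (fun x : Expr S Q c a p => x.eval F G) fun _ _ h => h T F G
        map_add' := by
          rintro ⟨x⟩ ⟨y⟩
          rfl
        map_smul' := by
          rintro s ⟨x⟩
          rfl })
    (by
      rintro n c a p q h ⟨x⟩
      rfl)
    (by
      rintro n c a p σ ⟨x⟩
      rfl)
    (fun hu => rfl)
    (by
      rintro m n r i a b c e f p q t hg h ⟨x⟩ ⟨y⟩
      rfl)

theorem app_mk_eq_eval {T : DgOperad k C} (K : freeProduct S Q ⟶ T)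
    {n : ℕ} {c : Fin n → C} {a : C} {p : ℤ} (x : Expr S Q c a p) :
    Hom.app K (Quotient.mk (exprSetoid S Q c a p) x : FreeX S Q c a p) =
      x.eval (freeInl S Q ≫ K) (freeInr S Q ≫ K) := by
  induction x with
  | inl x => rfl
  | inr x => rfl
  | zero => exact map_zero (Hom.app K)
  | add x y hx hy => exact (map_add (Hom.app K) _ _).trans (congrArg₂ (· + ·) hx hy)
  | smul s x hx => exact (map_smul (Hom.app K) _ _).trans (congrArg (s • ·) hx)
  | d h x hx => exact (Hom.app_d K h _).trans (congrArg (T.d h) hx)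
  | act σ x hx => exact (Hom.app_act K σ _).trans (congrArg (T.act σ) hx)
  | one hu => exact Hom.app_one K hu
  | comp hg h x y hx hy =>
    exact (Hom.app_comp K hg h _ _).trans
      (congrArg₂ (fun x y => T.comp hg h x y) hx hy)

/-- The free product is the coproduct of `S` and `Q`. -/
def freeIsColimit (S Q : DgOperad k C) :
    IsColimit (BinaryCofan.mk (freeInl S Q) (freeInr S Q)) :=
  BinaryCofan.IsColimit.mk _ (fun F G => freeDesc F G) (fun _ _ => rfl) (fun _ _ => rfl) (by
    rintro T F G K rfl rfl
    refine hom_ext fun x => ?_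
    obtain ⟨x⟩ := x
    exact app_mk_eq_eval K x)

instance : HasBinaryCoproducts (DgOperad k C) :=
  have (S Q : DgOperad k C) : HasColimit (pair S Q) := ⟨⟨⟨_, freeIsColimit S Q⟩⟩⟩
  hasBinaryCoproducts_of_hasColimit_pair _

end DgOperad

/-! As a complex, the free product of augmented operads does not see the compositions of its
factors. Its elements have a normal form: sums of words, built from a unit by grafting letters that
are taken from the factors modulo their units, where a letter grafted on a letter of the same factor
gives zero. Once this normal form is available (`toWords`, bijective by `toWords_surjective` and
`toWords_injective`), the theorem becomes a Künneth statement about words, in which only the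
complexes, the symmetric actions and the units of the factors intervene.

To bring elements into normal form, the factors must act on words. At a given input, an element acts
in three ways at once (`op`): it becomes a new letter, it multiplies the letter that carries the
input if that letter comes from the same factor, and its augmentation acts as a scalar. The lemmas
`op_assoc`, `op_comm`, `op_perm` and `wordsD_op` show that the operations on words generated in this
way form a dg operad (`genOperad`). The universal property of the free product gives a morphism to
it, and evaluation at the unit gives `toWords`. This map is triangular for the number of letters:
the action differs from grafting by words that are no longer than before. Surjectivity follows by
induction. For injectivity, the associated graded of the free product is itself a module over the
grafts (`grModule`), so words map to it, and this map recovers the leading part of an element from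
its normal form (`IsWord.lift_toWords`).

In characteristic zero, an augmented operad contracts onto its homology, compatibly with units and
symmetric actions (`exists_contraction`). The contraction need not respect compositions, but words
do not require this: the inclusion and the projection extend letter by letter, and the homotopy `h`
extends as a derivation. The commutator `N = dh + hd` is then a derivation as well
(`wordsLaplace_graft`), given on letters by the projection complementary to the chosen
representatives of homology; it counts the letters outside these representatives. Hence a word minus
its projection to homology is a sum of eigenvectors of `N` with positive integral eigenvalues
(`eigSum_sub`), and a cycle of this kind is a boundary because the eigenvalues are invertible
(`exists_wordsD_eq_sub`). So the homology of words is words in the homology.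

It remains to compare the normal forms of the two free products (`exists_cycle`). The product of two
representatives differs from the representative of the product by a boundary, so the canonical map
sends an element to the class of a cycle whose normal form is, up to a boundary, the expected one.
This makes `homologyDesc` bijective. Up to the choice of coproducts it is the comparison morphism,
whose naturality is formal. -/

namespace ColoredOperad

/-! ### Positions and block permutations -/

section Positions

variable {m n l r r' v : ℕ}

theorem InnerPos.eq_left {i : Fin m} {j j' : Fin n} {s : Fin r} (h : InnerPos i j s)
    (h' : InnerPos i j' s) : j = j' := by
  simp only [InnerPos, Fin.ext_iff] at *; omega

theorem InnerPos.eq_right {i : Fin m} {j : Fin n} {s s' : Fin r} (h : InnerPos i j s)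
    (h' : InnerPos i j s') : s = s' := by
  simp only [InnerPos, Fin.ext_iff] at *; omega

theorem OuterPos.eq_left {i j j' : Fin m} {s : Fin r} (h : OuterPos i n j s)
    (h' : OuterPos i n j' s) : j = j' := by
  simp only [OuterPos, Fin.lt_def, Fin.ext_iff] at *; omega

theorem OuterPos.eq_right {i j : Fin m} {s s' : Fin r} (h : OuterPos i n j s)
    (h' : OuterPos i n j s') : s = s' := by
  simp only [OuterPos, Fin.lt_def, Fin.ext_iff] at *; omega

theorem OuterPos.not_inner {i j : Fin m} {j' : Fin n} {s : Fin r} (h : OuterPos i n j s)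
    (h' : InnerPos i j' s) : False := by
  simp only [OuterPos, InnerPos, Fin.lt_def] at *; omega

theorem OuterPos.ne {i j : Fin m} {s : Fin r} (h : OuterPos i n j s) : j ≠ i := by
  rintro rfl
  simp only [OuterPos, Fin.lt_def] at h; omega

/-- The dichotomy behind all later case distinctions: an input of a composite comes from the
inserted element or from the other inputs of the outer one. `OuterPos.not_inner` makes it exclusive.
-/
theorem pos_cases (h : m + n = r + 1) (i : Fin m) (s : Fin r) :
    (∃ j : Fin n, InnerPos i j s) ∨ ∃ j, OuterPos i n j s := by
  by_cases h1 : (s : ℕ) < i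
  · exact Or.inr ⟨⟨s, by omega⟩, Or.inl ⟨h1, rfl⟩⟩
  · by_cases h2 : (s : ℕ) < i + n
    · exact Or.inl ⟨⟨s - i, by omega⟩, by simp only [InnerPos]; omega⟩
    · exact Or.inr ⟨⟨s + 1 - n, by omega⟩, by simp only [OuterPos, Fin.lt_def]; omega⟩

theorem exists_innerPos (h : m + n = r + 1) (i : Fin m) (j : Fin n) :
    ∃ s : Fin r, InnerPos i j s :=
  ⟨⟨i + j, by omega⟩, rfl⟩

theorem exists_outerPos (h : m + n = r + 1) {i j : Fin m} (hij : j ≠ i) :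
    ∃ s : Fin r, OuterPos i n j s := by
  have hij' : (j : ℕ) ≠ i := fun h => hij (Fin.ext h)
  by_cases h1 : (j : ℕ) < i
  · exact ⟨⟨j, by omega⟩, Or.inl ⟨h1, rfl⟩⟩
  · exact ⟨⟨j + n - 1, by omega⟩, by simp only [OuterPos, Fin.lt_def]; omega⟩

/-- Grafting at one input shifts the later inputs by a fixed amount, so the final position of a
third input does not depend on the order of two grafts. -/
theorem OuterPos.comm {i j y : Fin m} {s x : Fin r} {s' z : Fin r'} {t : Fin v}
    (hs : OuterPos i n j s) (hs' : OuterPos j l i s') (hx : OuterPos i n y x)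
    (hz : OuterPos j l y z) (ht : OuterPos s' n z t) : OuterPos s l x t := by
  simp only [OuterPos, Fin.lt_def] at *
  obtain h1 | h1 := hs <;> obtain h2 | h2 := hs' <;> obtain h3 | h3 := hx <;>
    obtain h4 | h4 := hz <;> omega

/-- `ρ` is the block permutation of the inputs of `x ∘ᵢ y` determined by a permutation `σ` of the
inputs of `x` and a permutation `τ` of the inputs of `y`. -/
structure BlockPerm (i : Fin m) (σ : Equiv.Perm (Fin m)) (τ : Equiv.Perm (Fin n))
    (ρ : Equiv.Perm (Fin r)) : Prop where
  outer : ∀ j s, OuterPos i n j s → OuterPos (σ i) n (σ j) (ρ s)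
  inner : ∀ (j : Fin n) s, InnerPos i j s → InnerPos (σ i) (τ j) (ρ s)

theorem BlockPerm.unique (h : m + n = r + 1) {i : Fin m} {σ : Equiv.Perm (Fin m)}
    {τ : Equiv.Perm (Fin n)} {ρ ρ' : Equiv.Perm (Fin r)} (h₁ : BlockPerm i σ τ ρ)
    (h₂ : BlockPerm i σ τ ρ') : ρ = ρ' := by
  ext s : 1
  obtain ⟨j, hj⟩ | ⟨j, hj⟩ := pos_cases h i s
  · exact (h₁.inner j s hj).eq_right (h₂.inner j s hj)
  · exact (h₁.outer j s hj).eq_right (h₂.outer j s hj)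

theorem exists_blockPerm (h : m + n = r + 1) (i : Fin m) (σ : Equiv.Perm (Fin m))
    (τ : Equiv.Perm (Fin n)) : ∃ ρ : Equiv.Perm (Fin r), BlockPerm i σ τ ρ := by
  have key : ∀ s : Fin r, ∃ s' : Fin r, (∀ j, OuterPos i n j s → OuterPos (σ i) n (σ j) s') ∧
      ∀ j : Fin n, InnerPos i j s → InnerPos (σ i) (τ j) s' := by
    intro s
    obtain ⟨j, hj⟩ | ⟨j, hj⟩ := pos_cases h i s
    · obtain ⟨s', hs'⟩ := exists_innerPos h (σ i) (τ j)
      refine ⟨s', fun j' hj' => (hj'.not_inner hj).elim, fun j' hj' => ?_⟩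
      rwa [hj'.eq_left hj]
    · obtain ⟨s', hs'⟩ := exists_outerPos h (i := σ i) (j := σ j) (fun e => hj.ne (σ.injective e))
      refine ⟨s', fun j' hj' => ?_, fun j' hj' => (hj.not_inner hj').elim⟩
      rwa [hj'.eq_left hj]
  choose f hf using key
  have hinj : Function.Injective f := by
    intro s s' e
    obtain ⟨j, hj⟩ | ⟨j, hj⟩ := pos_cases h i s <;>
      obtain ⟨j', hj'⟩ | ⟨j', hj'⟩ := pos_cases h i s'
    · have h1 := (hf s).2 j hj
      rw [e] at h1
      have := τ.injective (h1.eq_left ((hf s').2 j' hj'))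
      subst this
      exact hj.eq_right hj'
    · have h1 := (hf s).2 j hj
      rw [e] at h1
      exact (((hf s').1 j' hj').not_inner h1).elim
    · have h1 := (hf s).1 j hj
      rw [e] at h1
      exact (h1.not_inner ((hf s').2 j' hj')).elim
    · have h1 := (hf s).1 j hj
      rw [e] at h1
      have := σ.injective (h1.eq_left ((hf s').1 j' hj'))
      subst this
      exact hj.eq_right hj'
  -- The pointwise images are injective because a position determines the input it comes from; on a
  -- finite set this suffices.
  exact ⟨Equiv.ofBijective f (Finite.injective_iff_bijective.1 hinj),
    ⟨fun j s => (hf s).1 j, fun j s => (hf s).2 j⟩⟩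

theorem BlockPerm.one (i : Fin m) : BlockPerm i 1 (1 : Equiv.Perm (Fin n)) (1 : Equiv.Perm (Fin r)) :=
  ⟨fun _ _ h => h, fun _ _ h => h⟩

theorem BlockPerm.mul {i : Fin m} {σ σ' : Equiv.Perm (Fin m)} {τ τ' : Equiv.Perm (Fin n)}
    {ρ ρ' : Equiv.Perm (Fin r)} (h : BlockPerm (σ' i) σ τ ρ) (h' : BlockPerm i σ' τ' ρ') :
    BlockPerm i (σ * σ') (τ * τ') (ρ * ρ') :=
  ⟨fun j s hs => h.outer _ _ (h'.outer j s hs), fun j s hs => h.inner _ _ (h'.inner j s hs)⟩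

/-- The counterpart of sequential associativity: the block permutation of a threefold nested
composite can be computed with either bracketing. -/
theorem BlockPerm.assoc (hr : m + n = r + 1) (hv : r + l = v + 1) (hr' : n + l = r' + 1)
    {i : Fin m} {j : Fin n} {s : Fin r}
    (hs : InnerPos i j s) {σ : Equiv.Perm (Fin m)} {τ : Equiv.Perm (Fin n)}
    {ω : Equiv.Perm (Fin l)} {ρ : Equiv.Perm (Fin r)} {ρ₁ : Equiv.Perm (Fin r')}
    {ρ₂ : Equiv.Perm (Fin v)} (h : BlockPerm i σ τ ρ) (h₁ : BlockPerm j τ ω ρ₁)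
    (h₂ : BlockPerm s ρ ω ρ₂) : BlockPerm i σ ρ₁ ρ₂ := by
  have hs' := h.inner _ _ hs
  constructor
  · intro a t ht
    obtain ⟨b, hb⟩ := exists_outerPos hr ht.ne
    have h3 := h.outer _ _ hb
    have h4 := h₂.outer b t (by simp only [OuterPos, InnerPos, Fin.lt_def] at *; omega)
    simp only [OuterPos, InnerPos, Fin.lt_def] at *; omega
  · intro a t ht
    obtain ⟨b, hb⟩ | ⟨b, hb⟩ := pos_cases hr' j a
    · have h3 := h₁.inner _ _ hb
      have h4 := h₂.inner b t (by simp only [InnerPos] at *; omega)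
      simp only [InnerPos] at *; omega
    · have h3 := h₁.outer _ _ hb
      obtain ⟨b', hb'⟩ := exists_innerPos hr i b
      have h5 := h.inner _ _ hb'
      have h4 := h₂.outer b' t (by simp only [OuterPos, InnerPos, Fin.lt_def] at *; omega)
      simp only [OuterPos, InnerPos, Fin.lt_def] at *; omega

/-- The counterpart of parallel associativity: the order in which two inputs are filled does not
change the total block permutation. -/
theorem BlockPerm.comm (hr : m + n = r + 1) (hv : r + l = v + 1) (hr' : m + l = r' + 1)
    {i j : Fin m} {s : Fin r} {s' : Fin r'}
    (hs : OuterPos i n j s) (hs' : OuterPos j l i s') {σ : Equiv.Perm (Fin m)}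
    {τ : Equiv.Perm (Fin n)}
    {ω : Equiv.Perm (Fin l)} {ρ : Equiv.Perm (Fin r)} {ρ₁ : Equiv.Perm (Fin r')}
    {ρ₂ : Equiv.Perm (Fin v)} (h : BlockPerm i σ τ ρ) (h₁ : BlockPerm j σ ω ρ₁)
    (h₂ : BlockPerm s ρ ω ρ₂) : BlockPerm s' ρ₁ τ ρ₂ := by
  have h3 := h.outer _ _ hs
  have h4 := h₁.outer _ _ hs'
  constructor
  · intro a t ht
    obtain ⟨b, hb⟩ | ⟨b, hb⟩ := pos_cases hr' j a
    · have h5 := h₁.inner _ _ hb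
      have h6 := h₂.inner b t (by simp only [OuterPos, InnerPos, Fin.lt_def] at *; omega)
      simp only [OuterPos, InnerPos, Fin.lt_def] at *; omega
    · have h5 := h₁.outer _ _ hb
      have hbi : b ≠ i := by
        rintro rfl
        exact ht.ne (hb.eq_right hs')
      obtain ⟨b', hb'⟩ := exists_outerPos hr hbi
      have h6 := h.outer _ _ hb'
      have h9 := h₂.outer b' t (hs.comm hs' hb' hb ht)
      exact h4.comm h3 h5 h6 h9
  · intro a t ht
    obtain ⟨b, hb⟩ := exists_innerPos hr i a
    have h5 := h.inner _ _ hb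
    have h6 := h₂.outer b t (by simp only [OuterPos, InnerPos, Fin.lt_def] at *; omega)
    simp only [OuterPos, InnerPos, Fin.lt_def] at *; omega

end Positions

/-! ### Input colors of composites -/

section Grafts

variable {C : Type u} {m n l r r' v : ℕ} {i : Fin m} {a b b' : C} {c : Fin m → C} {e : Fin n → C}
  {f f' : Fin r → C} {g : Fin l → C} {w : Fin v → C}

theorem IsGraft.eq (h : IsGraft i b c e f) (h' : IsGraft i b c e f') : f = f' := by
  funext s
  obtain ⟨j, hj⟩ | ⟨j, hj⟩ := pos_cases h.arity i s
  · rw [h.inner j s hj, h'.inner j s hj]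
  · rw [h.outer j s hj, h'.outer j s hj]

theorem IsGraft.exists_of_color (hr : m + n = r + 1) (hc : c i = b) (e : Fin n → C) :
    ∃ f : Fin r → C, IsGraft i b c e f := by
  have key : ∀ s : Fin r, ∃ x : C, (∀ j, OuterPos i n j s → x = c j) ∧
      ∀ j : Fin n, InnerPos i j s → x = e j := by
    intro s
    obtain ⟨j, hj⟩ | ⟨j, hj⟩ := pos_cases hr i s
    · exact ⟨e j, fun j' hj' => (hj'.not_inner hj).elim, fun j' hj' => by rw [hj'.eq_left hj]⟩
    · exact ⟨c j, fun j' hj' => by rw [hj'.eq_left hj], fun j' hj' => (hj.not_inner hj').elim⟩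
  choose f hf using key
  exact ⟨f, hr, hc, fun j s => (hf s).1 j, fun j s => (hf s).2 j⟩

theorem IsGraft.perm {σ : Equiv.Perm (Fin m)} {τ : Equiv.Perm (Fin n)} {ρ : Equiv.Perm (Fin r)}
    (h : IsGraft (σ i) b c e f) (hρ : BlockPerm i σ τ ρ) :
    IsGraft i b (c ∘ σ) (e ∘ τ) (f ∘ ρ) :=
  ⟨h.arity, h.color, fun j s hs => h.outer _ _ (hρ.outer j s hs),
    fun j s hs => h.inner _ _ (hρ.inner j s hs)⟩

/-- Undoes a permutation of the colors: a graft with permuted colors comes from a graft at the image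
of the input, whose colors are determined. -/
theorem IsGraft.perm_right {σ : Equiv.Perm (Fin m)} {τ : Equiv.Perm (Fin n)}
    {ρ : Equiv.Perm (Fin r)} {c' : Fin m → C} {e' : Fin n → C}
    (h : IsGraft i b c' e' f') (hc : c' = c ∘ σ) (he : e' = e ∘ τ) (hρ : BlockPerm i σ τ ρ) :
    ∃ f : Fin r → C, IsGraft (σ i) b c e f ∧ f' = f ∘ ρ := by
  subst hc he
  obtain ⟨f, hf⟩ := IsGraft.exists_of_color h.arity (i := σ i) (c := c) (b := b) h.color e
  exact ⟨f, hf, h.eq (hf.perm hρ)⟩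

/-- Provides the intermediate composite of the other bracketing. Its arity is fixed as `n + l - 1`,
which loses nothing because `j` forces `n` to be positive. -/
theorem IsGraft.assoc {j : Fin n} {s : Fin r} (h₁ : IsGraft i b c e f) (h₂ : IsGraft s b' f g w)
    (hs : InnerPos i j s) :
    ∃ f' : Fin (n + l - 1) → C, IsGraft j b' e g f' ∧ IsGraft i b c f' w := by
  have := j.2
  have a1 := h₁.arity
  have a2 := h₂.arity
  obtain ⟨f', hf'⟩ := IsGraft.exists_of_color (r := n + l - 1) (i := j) (c := e) (b := b')
    (by omega) (by rw [← h₁.inner j s hs, h₂.color]) g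
  refine ⟨f', hf', by omega, h₁.color, fun x t ht => ?_, fun x t ht => ?_⟩
  · obtain ⟨y, hy⟩ := exists_outerPos a1 ht.ne
    rw [h₂.outer y t (by simp only [OuterPos, InnerPos, Fin.lt_def] at *; omega),
      h₁.outer x y hy]
  · obtain ⟨y, hy⟩ | ⟨y, hy⟩ := pos_cases hf'.arity j x
    · rw [hf'.inner y x hy, h₂.inner y t (by simp only [InnerPos] at *; omega)]
    · obtain ⟨z, hz⟩ := exists_innerPos a1 i y
      rw [hf'.outer y x hy, ← h₁.inner y z hz,
        h₂.outer z t (by simp only [OuterPos, InnerPos, Fin.lt_def] at *; omega)]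

theorem IsGraft.comm {j : Fin m} {s : Fin r} (h₁ : IsGraft i b c e f) (h₂ : IsGraft s b' f g w)
    (hs : OuterPos i n j s) :
    ∃ (s' : Fin (m + l - 1)) (f' : Fin (m + l - 1) → C), OuterPos j l i s' ∧
      IsGraft j b' c g f' ∧ IsGraft s' b f' e w := by
  have := j.2
  have a1 := h₁.arity
  have a2 := h₂.arity
  obtain ⟨s', hs'⟩ := exists_outerPos (show m + l = m + l - 1 + 1 by omega) hs.ne.symm
  obtain ⟨f', hf'⟩ := IsGraft.exists_of_color (r := m + l - 1) (i := j) (c := c) (b := b')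
    (by omega) (by rw [← h₁.outer j s hs, h₂.color]) g
  refine ⟨s', f', hs', hf', by omega, by rw [hf'.outer i s' hs', h₁.color], fun x t ht => ?_,
    fun x t ht => ?_⟩
  · obtain ⟨y, hy⟩ | ⟨y, hy⟩ := pos_cases hf'.arity j x
    · rw [hf'.inner y x hy,
        h₂.inner y t (by simp only [OuterPos, InnerPos, Fin.lt_def] at *; omega)]
    · have hyi : y ≠ i := by
        rintro rfl
        exact ht.ne (hy.eq_right hs')
      obtain ⟨z, hz⟩ := exists_outerPos a1 hyi
      rw [hf'.outer y x hy, ← h₁.outer y z hz, h₂.outer z t (hs.comm hs' hz hy ht)]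
  · obtain ⟨z, hz⟩ := exists_innerPos a1 i x
    rw [← h₁.inner x z hz,
      h₂.outer z t (by simp only [OuterPos, InnerPos, Fin.lt_def] at *; omega)]

end Grafts

end ColoredOperad

namespace DgOperad

variable {k : Type u} [Field k] {C : Type u} {I : Type}

/-! ### Modules of words

A word is obtained from a unit by successively grafting elements of the dg operads `G ι` on the
inputs.  Words are subject only to the relations that do not involve the composition of the
operads `G ι`; two elements of the same operad grafted on each other give zero. -/

/-- A family of vector spaces on which elements of the `G ι` can be grafted. -/
structure WordModule (G : I → DgOperad k C) where
  X : ∀ {n : ℕ}, (Fin n → C) → C → ℤ → Type u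
  [addCommGroup : ∀ {n : ℕ} (c : Fin n → C) (a : C) (p : ℤ), AddCommGroup (X c a p)]
  [module : ∀ {n : ℕ} (c : Fin n → C) (a : C) (p : ℤ), Module k (X c a p)]
  one : ∀ {n : ℕ} {c : Fin n → C} {a : C} {p : ℤ}, IsUnitPlace c a p → X c a p
  -- The target colors are a variable with an equation, so that permutations can land in colors that
  -- agree with `c ∘ σ` only propositionally.
  perm : ∀ {n : ℕ} {c f : Fin n → C} {a : C} {p : ℤ} (σ : Equiv.Perm (Fin n)),
    f = c ∘ σ → X c a p →ₗ[k] X f a p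
  graft : ∀ (ι : I) {m n r : ℕ} {i : Fin m} {a b : C} {c : Fin m → C} {e : Fin n → C}
    {f : Fin r → C} {p q t : ℤ}, IsGraft i b c e f → p + q = t →
    X c a p →ₗ[k] (G ι).X e b q →ₗ[k] X f a t
  perm_one : ∀ {n : ℕ} {c : Fin n → C} {a : C} {p : ℤ} (h : c = c ∘ (1 : Equiv.Perm (Fin n)))
    (x : X c a p), perm 1 h x = x
  perm_perm : ∀ {n : ℕ} {c f g : Fin n → C} {a : C} {p : ℤ} (σ τ : Equiv.Perm (Fin n))
    (h : f = c ∘ σ) (h' : g = f ∘ τ) (h'' : g = c ∘ (σ * τ : Equiv.Perm (Fin n))) (x : X c a p),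
    perm τ h' (perm σ h x) = perm (σ * τ) h'' x
  graft_perm : ∀ (ι : I) {m n r : ℕ} {i : Fin m} {a b : C} {c c' : Fin m → C} {e : Fin n → C}
    {f f' : Fin r → C} {p q t : ℤ} (σ : Equiv.Perm (Fin m)) (τ : Equiv.Perm (Fin n))
    (ρ : Equiv.Perm (Fin r)) (hg : IsGraft (σ i) b c e f) (hc : c' = c ∘ σ) (hf : f' = f ∘ ρ)
    (hg' : IsGraft i b c' (e ∘ τ) f') (_ : BlockPerm i σ τ ρ) (h : p + q = t)
    (x : X c a p) (y : (G ι).X e b q),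
    graft ι hg' h (perm σ hc x) ((G ι).act τ y) = perm ρ hf (graft ι hg h x y)
  graft_comm : ∀ (ι κ : I) {m n l r r' v : ℕ} {i j : Fin m} {s : Fin r} {s' : Fin r'} {a b b' : C}
    {c : Fin m → C} {e : Fin n → C} {g : Fin l → C} {f : Fin r → C} {f' : Fin r' → C}
    {w : Fin v → C} {p q t pq pt pqt : ℤ}
    (h₁ : IsGraft i b c e f) (h₂ : IsGraft s b' f g w)
    (h₃ : IsGraft j b' c g f') (h₄ : IsGraft s' b f' e w)
    (_ : OuterPos i n j s) (_ : OuterPos j l i s')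
    (d₁ : p + q = pq) (d₂ : pq + t = pqt) (d₃ : p + t = pt) (d₄ : pt + q = pqt)
    (x : X c a p) (y : (G ι).X e b q) (z : (G κ).X g b' t),
    graft κ h₂ d₂ (graft ι h₁ d₁ x y) z =
      ((-1 : k) ^ (q * t)) • graft ι h₄ d₄ (graft κ h₃ d₃ x z) y
  graft_graft : ∀ (ι : I) {m n l r v : ℕ} {i : Fin m} {j : Fin n} {s : Fin r} {a b b' : C}
    {c : Fin m → C} {e : Fin n → C} {g : Fin l → C} {f : Fin r → C}
    {w : Fin v → C} {p q t pq pqt : ℤ}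
    (h₁ : IsGraft i b c e f) (h₂ : IsGraft s b' f g w) (_ : InnerPos i j s)
    (d₁ : p + q = pq) (d₂ : pq + t = pqt)
    (x : X c a p) (y : (G ι).X e b q) (z : (G ι).X g b' t),
    graft ι h₂ d₂ (graft ι h₁ d₁ x y) z = 0
  -- Letters thus matter only modulo units, as in the augmentation ideal, but no augmentation is
  -- needed to state this.
  graft_one : ∀ (ι : I) {m n r : ℕ} {i : Fin m} {a b : C} {c : Fin m → C} {e : Fin n → C}
    {f : Fin r → C} {p q t : ℤ} (hg : IsGraft i b c e f) (h : p + q = t)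
    (hu : IsUnitPlace e b q) (x : X c a p), graft ι hg h x ((G ι).one hu) = 0

attribute [instance] WordModule.addCommGroup WordModule.module

/-- Formal words. -/
inductive Word (G : I → DgOperad k C) : ∀ {n : ℕ}, (Fin n → C) → C → ℤ → Type u
  | zero {n : ℕ} {c : Fin n → C} {a : C} {p : ℤ} : Word G c a p
  | add {n : ℕ} {c : Fin n → C} {a : C} {p : ℤ} (x y : Word G c a p) : Word G c a p
  | smul {n : ℕ} {c : Fin n → C} {a : C} {p : ℤ} (s : k) (x : Word G c a p) : Word G c a p
  | one {n : ℕ} {c : Fin n → C} {a : C} {p : ℤ} (hu : IsUnitPlace c a p) : Word G c a p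
  | perm {n : ℕ} {c f : Fin n → C} {a : C} {p : ℤ} (σ : Equiv.Perm (Fin n)) (h : f = c ∘ σ)
      (x : Word G c a p) : Word G f a p
  | graft (ι : I) {m n r : ℕ} {i : Fin m} {a b : C} {c : Fin m → C} {e : Fin n → C}
      {f : Fin r → C} {p q t : ℤ} (hg : IsGraft i b c e f) (h : p + q = t)
      (x : Word G c a p) (y : (G ι).X e b q) : Word G f a t

variable {G : I → DgOperad k C}

/-- The value of a word in a module. -/
def Word.eval (Y : WordModule G) :
    ∀ {n : ℕ} {c : Fin n → C} {a : C} {p : ℤ}, Word G c a p → Y.X c a p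
  | _, _, _, _, .zero => 0
  | _, _, _, _, .add x y => x.eval Y + y.eval Y
  | _, _, _, _, .smul s x => s • x.eval Y
  | _, _, _, _, .one hu => Y.one hu
  | _, _, _, _, .perm σ h x => Y.perm σ h (x.eval Y)
  | _, _, _, _, .graft ι hg h x y => Y.graft ι hg h (x.eval Y) y

/-- Two words are identified if they have the same value in all modules. -/
def wordSetoid (G : I → DgOperad k C) {n : ℕ} (c : Fin n → C) (a : C) (p : ℤ) :
    Setoid (Word G c a p) where
  r x y := ∀ Y : WordModule G, x.eval Y = y.eval Y
  iseqv :=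
    { refl := fun _ _ => rfl
      symm := fun h Y => (h Y).symm
      trans := fun h h' Y => (h Y).trans (h' Y) }

/-- Words up to equality. -/
def WordX (G : I → DgOperad k C) {n : ℕ} (c : Fin n → C) (a : C) (p : ℤ) : Type u :=
  Quotient (wordSetoid G c a p)

instance {n : ℕ} (c : Fin n → C) (a : C) (p : ℤ) : Zero (WordX G c a p) :=
  ⟨Quotient.mk _ .zero⟩

instance {n : ℕ} (c : Fin n → C) (a : C) (p : ℤ) : Add (WordX G c a p) :=
  ⟨Quotient.map₂ .add fun _ _ h _ _ h' Y => congrArg₂ (· + ·) (h Y) (h' Y)⟩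

instance {n : ℕ} (c : Fin n → C) (a : C) (p : ℤ) : Neg (WordX G c a p) :=
  ⟨Quotient.map (.smul (-1)) fun _ _ h Y => congrArg ((-1 : k) • ·) (h Y)⟩

instance {n : ℕ} (c : Fin n → C) (a : C) (p : ℤ) : AddCommGroup (WordX G c a p) where
  add_assoc := by
    rintro ⟨x⟩ ⟨y⟩ ⟨z⟩
    exact Quotient.sound fun Y => add_assoc _ _ _
  zero_add := by
    rintro ⟨x⟩
    exact Quotient.sound fun Y => zero_add _
  add_zero := by
    rintro ⟨x⟩
    exact Quotient.sound fun Y => add_zero _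
  neg_add_cancel := by
    rintro ⟨x⟩
    refine Quotient.sound fun Y => ?_
    change (-1 : k) • x.eval Y + x.eval Y = 0
    rw [neg_one_smul, neg_add_cancel]
  add_comm := by
    rintro ⟨x⟩ ⟨y⟩
    exact Quotient.sound fun Y => add_comm _ _
  nsmul := nsmulRec
  zsmul := zsmulRec

instance {n : ℕ} (c : Fin n → C) (a : C) (p : ℤ) : Module k (WordX G c a p) where
  smul s := Quotient.map (.smul s) fun _ _ h Y => congrArg (s • ·) (h Y)
  one_smul := by
    rintro ⟨x⟩
    exact Quotient.sound fun Y => one_smul _ _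
  mul_smul := by
    rintro s t ⟨x⟩
    exact Quotient.sound fun Y => mul_smul _ _ _
  smul_zero s := Quotient.sound fun Y => smul_zero _
  smul_add := by
    rintro s ⟨x⟩ ⟨y⟩
    exact Quotient.sound fun Y => smul_add _ _ _
  add_smul := by
    rintro s t ⟨x⟩
    exact Quotient.sound fun Y => add_smul _ _ _
  zero_smul := by
    rintro ⟨x⟩
    exact Quotient.sound fun Y => zero_smul _ _

/-- The initial module, consisting of words up to equality. -/
def words (G : I → DgOperad k C) : WordModule G where
  X c a p := WordX G c a p
  one hu := Quotient.mk _ (.one hu)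
  perm σ h :=
    { toFun := Quotient.map (.perm σ h) fun _ _ e Y => congrArg (Y.perm σ h) (e Y)
      map_add' := by
        rintro ⟨x⟩ ⟨y⟩
        exact Quotient.sound fun Y => map_add _ _ _
      map_smul' := by
        rintro s ⟨x⟩
        exact Quotient.sound fun Y => map_smul _ _ _ }
  graft ι {m n r i a b c e f p q t} hg h := LinearMap.mk₂ k
    (fun (x : WordX G c a p) y => (Quotient.map (fun x => .graft ι hg h x y)
      (fun _ _ (e : ∀ Y : WordModule G, _ = _) Y => congrArg (fun z => Y.graft ι hg h z y) (e Y)) x :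
        WordX G f a t))
    (by
      rintro ⟨x⟩ ⟨x'⟩ y
      exact Quotient.sound fun Y => LinearMap.map_add₂ _ _ _ _)
    (by
      rintro s ⟨x⟩ y
      exact Quotient.sound fun Y => LinearMap.map_smul₂ _ _ _ _)
    (by
      rintro ⟨x⟩ y y'
      exact Quotient.sound fun Y => map_add _ _ _)
    (by
      rintro s ⟨x⟩ y
      exact Quotient.sound fun Y => map_smul _ _ _)
  perm_one h := by
    rintro ⟨x⟩
    exact Quotient.sound fun Y => Y.perm_one h _
  perm_perm σ τ h h' h'' := by
    rintro ⟨x⟩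
    exact Quotient.sound fun Y => Y.perm_perm σ τ h h' h'' _
  graft_perm ι {_ _ _ _ _ _ _ _ _ _ _ _ _ _} σ τ ρ hg hc hf hg' hρ h := by
    rintro ⟨x⟩ y
    exact Quotient.sound fun Y => Y.graft_perm ι σ τ ρ hg hc hf hg' hρ h _ y
  graft_comm ι κ {_ _ _ _ _ _ _ _ _ _ _ _ _ _ _ _ _ _ _ _ _ _ _ _ _} h₁ h₂ h₃ h₄ hs hs' d₁ d₂ d₃ d₄ := by
    rintro ⟨x⟩ y z
    exact Quotient.sound fun Y => Y.graft_comm ι κ h₁ h₂ h₃ h₄ hs hs' d₁ d₂ d₃ d₄ _ y z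
  graft_graft ι {_ _ _ _ _ _ _ _ _ _ _ _ _ _ _ _ _ _ _ _ _} h₁ h₂ hs d₁ d₂ := by
    rintro ⟨x⟩ y z
    exact Quotient.sound fun Y => Y.graft_graft ι h₁ h₂ hs d₁ d₂ _ y z
  graft_one ι {_ _ _ _ _ _ _ _ _ _ _ _} hg h hu := by
    rintro ⟨x⟩
    exact Quotient.sound fun Y => Y.graft_one ι hg h hu _

/-- The unique morphism from the initial module. -/
def WordModule.lift (Y : WordModule G) {n : ℕ} {c : Fin n → C} {a : C} {p : ℤ} :
    (words G).X c a p →ₗ[k] Y.X c a p where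
  toFun := Quotient.lift (fun x : Word G c a p => x.eval Y) fun _ _ h => h Y
  map_add' := by
    rintro ⟨x⟩ ⟨y⟩
    rfl
  map_smul' := by
    rintro s ⟨x⟩
    rfl

namespace WordModule

variable (Y : WordModule G)

@[simp]
theorem lift_perm {n : ℕ} {c f : Fin n → C} {a : C} {p : ℤ} (σ : Equiv.Perm (Fin n))
    (h : f = c ∘ σ) (x : (words G).X c a p) :
    Y.lift ((words G).perm σ h x) = Y.perm σ h (Y.lift x) := by
  obtain ⟨x⟩ := x
  rfl

@[simp]
theorem lift_graft (ι : I) {m n r : ℕ} {i : Fin m} {a b : C} {c : Fin m → C} {e : Fin n → C}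
    {f : Fin r → C} {p q t : ℤ} (hg : IsGraft i b c e f) (h : p + q = t)
    (x : (words G).X c a p) (y : (G ι).X e b q) :
    Y.lift ((words G).graft ι hg h x y) = Y.graft ι hg h (Y.lift x) y := by
  obtain ⟨x⟩ := x
  rfl

end WordModule

/-- Every class is represented by a formal word. The motive ranges over all colors and degrees
because permutations and grafts change them. -/
theorem words_induction
    {motive : ∀ {n : ℕ} {c : Fin n → C} {a : C} {p : ℤ}, (words G).X c a p → Prop}
    (zero : ∀ {n : ℕ} {c : Fin n → C} {a : C} {p : ℤ}, motive (0 : (words G).X c a p))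
    (add : ∀ {n : ℕ} {c : Fin n → C} {a : C} {p : ℤ} (x y : (words G).X c a p),
      motive x → motive y → motive (x + y))
    (smul : ∀ {n : ℕ} {c : Fin n → C} {a : C} {p : ℤ} (s : k) (x : (words G).X c a p),
      motive x → motive (s • x))
    (one : ∀ {n : ℕ} {c : Fin n → C} {a : C} {p : ℤ} (hu : IsUnitPlace c a p),
      motive ((words G).one hu))
    (perm : ∀ {n : ℕ} {c f : Fin n → C} {a : C} {p : ℤ} (σ : Equiv.Perm (Fin n))
      (h : f = c ∘ σ) (x : (words G).X c a p), motive x → motive ((words G).perm σ h x))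
    (graft : ∀ (ι : I) {m n r : ℕ} {i : Fin m} {a b : C} {c : Fin m → C} {e : Fin n → C}
      {f : Fin r → C} {p q t : ℤ} (hg : IsGraft i b c e f) (h : p + q = t)
      (x : (words G).X c a p) (y : (G ι).X e b q), motive x →
      motive ((words G).graft ι hg h x y))
    {n : ℕ} {c : Fin n → C} {a : C} {p : ℤ} (x : (words G).X c a p) : motive x := by
  suffices h : ∀ {n : ℕ} {c : Fin n → C} {a : C} {p : ℤ} (x : Word G c a p),
      motive (Quotient.mk (wordSetoid G c a p) x : (words G).X c a p) from Quotient.ind h x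
  intro n c a p x
  induction x with
  | zero => exact zero
  | add x y hx hy => exact add _ _ hx hy
  | smul s x hx => exact smul s _ hx
  | one hu => exact one hu
  | perm σ h x hx => exact perm σ h _ hx
  | graft ι hg h x y hx => exact graft ι hg h _ y hx

end DgOperad

namespace DgOperad

variable {k : Type u} [Field k] {C : Type u} {I : Type}

/-! ### Functoriality and derivations of words -/

theorem neg_one_zpow_eq {a b : ℤ} (h : Even (a - b)) : (-1 : k) ^ a = (-1 : k) ^ b := by
  rw [← sub_add_cancel a b, zpow_add₀ (neg_ne_zero.2 one_ne_zero), h.neg_one_zpow, one_mul]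

theorem neg_one_zpow_smul_smul {V : Type*} [AddCommGroup V] [Module k V] (a b : ℤ) (x : V) :
    (-1 : k) ^ a • (-1 : k) ^ b • x = (-1 : k) ^ (a + b) • x := by
  rw [smul_smul, zpow_add₀ (neg_ne_zero.2 one_ne_zero)]

theorem neg_one_zpow_smul_self {V : Type*} [AddCommGroup V] [Module k V] (a : ℤ) (x : V) :
    (-1 : k) ^ a • (-1 : k) ^ a • x = x := by
  rw [neg_one_zpow_smul_smul, (Even.add_self a).neg_one_zpow, one_smul]

theorem neg_one_zpow_smul_congr {V : Type*} [AddCommGroup V] [Module k V] {a b : ℤ} {x y : V}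
    (h : Even (a - b)) (hxy : x = y) : (-1 : k) ^ a • x = (-1 : k) ^ b • y := by
  rw [neg_one_zpow_eq h, hxy]

theorem neg_one_zpow_succ {a b : ℤ} (h : a + 1 = b) : (-1 : k) ^ b = -(-1) ^ a := by
  rw [← h, zpow_add₀ (neg_ne_zero.2 one_ne_zero), zpow_one, mul_neg, mul_one]

/-- A family of linear maps that preserves the units and the action of the symmetric groups. -/
structure SymmMap (P R : DgOperad k C) where
  app : ∀ {n : ℕ} {c : Fin n → C} {a : C} {p : ℤ}, P.X c a p →ₗ[k] R.X c a p
  app_act : ∀ {n : ℕ} {c : Fin n → C} {a : C} {p : ℤ} (σ : Equiv.Perm (Fin n)) (x : P.X c a p),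
    app (P.act σ x) = R.act σ (app x)
  app_one : ∀ {n : ℕ} {c : Fin n → C} {a : C} {p : ℤ} (hu : IsUnitPlace c a p),
    app (P.one hu) = R.one hu

/-- A family of linear maps of degree `r` that kills the units and preserves the action of the
symmetric groups. -/
structure SymmDeriv (P : DgOperad k C) (r : ℤ) where
  app : ∀ {n : ℕ} {c : Fin n → C} {a : C} {p q : ℤ}, p + r = q → P.X c a p →ₗ[k] P.X c a q
  app_act : ∀ {n : ℕ} {c : Fin n → C} {a : C} {p q : ℤ} (h : p + r = q) (σ : Equiv.Perm (Fin n))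
    (x : P.X c a p), app h (P.act σ x) = P.act σ (app h x)
  app_one : ∀ {n : ℕ} {c : Fin n → C} {a : C} {p q : ℤ} (h : p + r = q) (hu : IsUnitPlace c a p),
    app h (P.one hu) = 0

variable {G G' : I → DgOperad k C}

/-- Words in the `G' ι` form a module over the `G ι`. -/
def WordModule.pullback (φ : ∀ ι, SymmMap (G ι) (G' ι)) (Y : WordModule G') : WordModule G where
  X c a p := Y.X c a p
  one hu := Y.one hu
  perm σ h := Y.perm σ h
  graft ι {m n r i a b c e f p q t} hg h := (Y.graft ι hg h).compl₂ (φ ι).app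
  perm_one := Y.perm_one
  perm_perm := Y.perm_perm
  graft_perm ι {_ _ _ _ _ _ _ _ _ _ _ _ _ _} σ τ ρ hg hc hf hg' hρ h x y := by
    simp only [LinearMap.compl₂_apply, (φ ι).app_act]
    exact Y.graft_perm ι σ τ ρ hg hc hf hg' hρ h _ _
  graft_comm ι κ {_ _ _ _ _ _ _ _ _ _ _ _ _ _ _ _ _ _ _ _ _ _ _ _ _} h₁ h₂ h₃ h₄ hs hs' d₁ d₂ d₃ d₄ x y z :=
    Y.graft_comm ι κ h₁ h₂ h₃ h₄ hs hs' d₁ d₂ d₃ d₄ _ _ _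
  graft_graft ι {_ _ _ _ _ _ _ _ _ _ _ _ _ _ _ _ _ _ _ _ _} h₁ h₂ hs d₁ d₂ x y z :=
    Y.graft_graft ι h₁ h₂ hs d₁ d₂ _ _ _
  graft_one ι {_ _ _ _ _ _ _ _ _ _ _ _} hg h hu x := by
    simp only [LinearMap.compl₂_apply, (φ ι).app_one]
    exact Y.graft_one ι hg h hu _

/-- Words are functorial for maps that preserve the units and the action of the symmetric
groups. -/
def wordsMap (φ : ∀ ι, SymmMap (G ι) (G' ι)) {n : ℕ} {c : Fin n → C} {a : C} {p : ℤ} :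
    (words G).X c a p →ₗ[k] (words G').X c a p :=
  ((words G').pullback φ).lift

section wordsMap

variable (φ : ∀ ι, SymmMap (G ι) (G' ι))

@[simp]
theorem wordsMap_one {n : ℕ} {c : Fin n → C} {a : C} {p : ℤ} (hu : IsUnitPlace c a p) :
    wordsMap φ ((words G).one hu) = (words G').one hu := rfl

@[simp]
theorem wordsMap_perm {n : ℕ} {c f : Fin n → C} {a : C} {p : ℤ} (σ : Equiv.Perm (Fin n))
    (h : f = c ∘ σ) (x : (words G).X c a p) :
    wordsMap φ ((words G).perm σ h x) = (words G').perm σ h (wordsMap φ x) :=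
  ((words G').pullback φ).lift_perm σ h x

@[simp]
theorem wordsMap_graft (ι : I) {m n r : ℕ} {i : Fin m} {a b : C} {c : Fin m → C} {e : Fin n → C}
    {f : Fin r → C} {p q t : ℤ} (hg : IsGraft i b c e f) (h : p + q = t)
    (x : (words G).X c a p) (y : (G ι).X e b q) :
    wordsMap φ ((words G).graft ι hg h x y) =
      (words G').graft ι hg h (wordsMap φ x) ((φ ι).app y) :=
  ((words G').pullback φ).lift_graft ι hg h x y

end wordsMap

/-- Pairs of a word and its image under a derivation. -/
def derivModule {r : ℤ} (δ : ∀ ι, SymmDeriv (G ι) r) : WordModule G where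
  -- The Leibniz rule involves the word itself, so a word must be carried along with its derivative.
  -- The degrees `q` range over a one-point type, which avoids transport along `p + r = q`.
  X c a p := (words G).X c a p × (∀ q : {q : ℤ // p + r = q}, (words G).X c a q)
  one hu := ((words G).one hu, 0)
  perm σ h := ((words G).perm σ h).prodMap (LinearMap.pi fun q =>
    (words G).perm σ h ∘ₗ LinearMap.proj q)
  graft ι {m n r' i a b c e f p q t} hg h := LinearMap.mk₂ k
    -- The Leibniz rule, with the sign for moving a derivation of degree `r` past `x`.
    (fun x y => ((words G).graft ι hg h x.1 y, fun s =>
      (words G).graft ι hg (show p + r + q = s by have := s.2; omega) (x.2 ⟨p + r, rfl⟩) y +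
        (-1 : k) ^ (r * p) • (words G).graft ι hg (show p + (q + r) = s by have := s.2; omega)
          x.1 ((δ ι).app rfl y)))
    (fun x x' y => Prod.ext (by simp) (by
      funext s
      simp only [Prod.fst_add, Prod.snd_add, Pi.add_apply, map_add, LinearMap.add_apply, smul_add]
      abel))
    (fun s x y => Prod.ext (by simp) (by
      funext s
      simp only [Prod.smul_fst, Prod.smul_snd, Pi.smul_apply, map_smul, LinearMap.smul_apply,
        smul_add]
      rw [smul_comm]))
    (fun x y y' => Prod.ext (by simp) (by
      funext s
      simp only [Prod.snd_add, Pi.add_apply, map_add, smul_add]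
      abel))
    (fun s x y => Prod.ext (by simp) (by
      funext s
      simp only [Prod.smul_snd, Pi.smul_apply, map_smul, smul_add]
      rw [smul_comm]))
  perm_one h x := Prod.ext ((words G).perm_one h _) (funext fun q => (words G).perm_one h _)
  perm_perm σ τ h h' h'' x := Prod.ext ((words G).perm_perm σ τ h h' h'' _)
    (funext fun q => (words G).perm_perm σ τ h h' h'' _)
  graft_perm ι {_ _ _ _ _ _ _ _ _ _ _ _ _ _} σ τ ρ hg hc hf hg' hρ h x y := by
    refine Prod.ext ((words G).graft_perm ι σ τ ρ hg hc hf hg' hρ h _ _) (funext fun q => ?_)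
    simp only [LinearMap.mk₂_apply, LinearMap.prodMap_apply, LinearMap.pi_apply,
      LinearMap.comp_apply, LinearMap.proj_apply, (δ ι).app_act, map_add, map_smul]
    rw [(words G).graft_perm ι σ τ ρ hg hc hf hg' hρ, (words G).graft_perm ι σ τ ρ hg hc hf hg' hρ]
  graft_comm ι κ {_ _ _ _ _ _ _ _ _ _ _ _ _ _ _ _ _ _ _ p q t pq pt pqt} h₁ h₂ h₃ h₄ hs hs' d₁ d₂ d₃ d₄ x y z := by
    refine Prod.ext ((words G).graft_comm ι κ h₁ h₂ h₃ h₄ hs hs' d₁ d₂ d₃ d₄ _ _ _)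
      (funext fun s => ?_)
    simp only [LinearMap.mk₂_apply, Prod.smul_snd, Pi.smul_apply, map_add, map_smul,
      LinearMap.add_apply, LinearMap.smul_apply, smul_add]
    have hs := s.2
    rw [(words G).graft_comm ι κ h₁ h₂ h₃ h₄ ‹_› hs' _ _ (show p + r + t = pt + r by omega)
        (by omega),
      (words G).graft_comm ι κ h₁ h₂ h₃ h₄ ‹_› hs' _ _ d₃ (by omega),
      (words G).graft_comm ι κ h₁ h₂ h₃ h₄ ‹_› hs' _ _ (show p + (t + r) = pt + r by omega)
        (by omega)]
    -- The Koszul signs of differentiating and exchanging agree: `e₁` treats the term in which `y`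
    -- is differentiated, `e₂` the one in which `z` is.
    have e₁ : r * p + (q + r) * t = q * t + r * pt := by subst d₃; ring
    have e₂ : (-1 : k) ^ (r * pq + q * (t + r)) = (-1) ^ (q * t + r * p) :=
      neg_one_zpow_eq ⟨r * q, by subst d₁; ring⟩
    simp only [neg_one_zpow_smul_smul, e₁, e₂]
    abel
  graft_graft ι {_ _ _ _ _ _ _ _ _ _ _ _ _ _ _ _ _ _ _ _ _} h₁ h₂ hs d₁ d₂ x y z := by
    refine Prod.ext ((words G).graft_graft ι h₁ h₂ hs d₁ d₂ _ _ _) (funext fun s => ?_)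
    simp only [LinearMap.mk₂_apply, map_add, map_smul, LinearMap.add_apply, LinearMap.smul_apply]
    rw [(words G).graft_graft ι h₁ h₂ hs, (words G).graft_graft ι h₁ h₂ hs,
      (words G).graft_graft ι h₁ h₂ hs]
    simp
  graft_one ι {_ _ _ _ _ _ _ _ _ _ _ _} hg h hu x := by
    refine Prod.ext ((words G).graft_one ι hg h hu _) (funext fun s => ?_)
    simp only [LinearMap.mk₂_apply, (δ ι).app_one, map_zero, (words G).graft_one]
    simp

section derivation

variable {r : ℤ} (δ : ∀ ι, SymmDeriv (G ι) r)

/-- The first projection is compatible with all operations, and initiality leaves only the identity.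
This turns the Leibniz rule of the module into one for words. -/
theorem derivModule_lift_fst {n : ℕ} {c : Fin n → C} {a : C} {p : ℤ} (x : (words G).X c a p) :
    ((derivModule δ).lift x).1 = x := by
  induction x using words_induction with
  | zero => simp; rfl
  | add x y hx hy => rw [map_add]; exact congrArg₂ (· + ·) hx hy
  | smul s x hx => rw [map_smul]; exact congrArg (s • ·) hx
  | one hu => rfl
  | perm σ h x hx => rw [WordModule.lift_perm]; exact congrArg _ hx
  | graft ι hg h x y hx =>
    rw [WordModule.lift_graft]
    exact congrArg (fun z => (words G).graft ι hg h z y) hx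

/-- The derivation of words that extends `δ`. -/
def wordsDeriv {n : ℕ} {c : Fin n → C} {a : C} {p q : ℤ} (h : p + r = q) :
    (words G).X c a p →ₗ[k] (words G).X c a q :=
  LinearMap.proj (R := k) (φ := fun q : {q : ℤ // p + r = q} => (words G).X c a q) ⟨q, h⟩ ∘ₗ
    LinearMap.snd k _ _ ∘ₗ (derivModule δ).lift

@[simp]
theorem wordsDeriv_perm {n : ℕ} {c f : Fin n → C} {a : C} {p q : ℤ} (hq : p + r = q)
    (σ : Equiv.Perm (Fin n)) (h : f = c ∘ σ) (x : (words G).X c a p) :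
    wordsDeriv δ hq ((words G).perm σ h x) = (words G).perm σ h (wordsDeriv δ hq x) :=
  congrArg (fun z => z.2 ⟨q, hq⟩) ((derivModule δ).lift_perm σ h x)

theorem wordsDeriv_graft (ι : I) {m n r' : ℕ} {i : Fin m} {a b : C} {c : Fin m → C}
    {e : Fin n → C} {f : Fin r' → C} {p q t p' q' t' : ℤ} (hg : IsGraft i b c e f) (h : p + q = t)
    (ht : t + r = t') (hp : p + r = p') (hq : q + r = q') (h₁ : p' + q = t') (h₂ : p + q' = t')
    (x : (words G).X c a p) (y : (G ι).X e b q) :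
    wordsDeriv δ ht ((words G).graft ι hg h x y) =
      (words G).graft ι hg h₁ (wordsDeriv δ hp x) y +
        (-1 : k) ^ (r * p) • (words G).graft ι hg h₂ x ((δ ι).app hq y) := by
  subst hp hq
  have h1 := congrArg (fun z => z.2 ⟨t', ht⟩) ((derivModule δ).lift_graft ι hg h x y)
  have h2 := derivModule_lift_fst δ x
  refine h1.trans ?_
  -- The module differentiates the pair belonging to `x`; the undifferentiated `x` has to be read as
  -- the first entry of that pair.
  nth_rw 3 [← h2]
  rfl

end derivation

/-- The differential of a dg operad, as a derivation. -/
def dDeriv (P : DgOperad k C) : SymmDeriv P (-1) where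
  app h := P.d (by omega)
  app_act h σ x := P.d_act _ σ x
  app_one h hu := P.d_one _ hu

/-- The differential of words. -/
def wordsD (G : I → DgOperad k C) {n : ℕ} {c : Fin n → C} {a : C} {p q : ℤ} (h : q + 1 = p) :
    (words G).X c a p →ₗ[k] (words G).X c a q :=
  wordsDeriv (fun ι => dDeriv (G ι)) (by omega)

section wordsD

@[simp]
theorem wordsD_one {n : ℕ} {c : Fin n → C} {a : C} {p q : ℤ} (h : q + 1 = p)
    (hu : IsUnitPlace c a p) : wordsD G h ((words G).one hu) = 0 := rfl

@[simp]
theorem wordsD_perm {n : ℕ} {c f : Fin n → C} {a : C} {p q : ℤ} (hq : q + 1 = p)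
    (σ : Equiv.Perm (Fin n)) (h : f = c ∘ σ) (x : (words G).X c a p) :
    wordsD G hq ((words G).perm σ h x) = (words G).perm σ h (wordsD G hq x) :=
  wordsDeriv_perm _ _ σ h x

theorem wordsD_graft (ι : I) {m n r : ℕ} {i : Fin m} {a b : C} {c : Fin m → C}
    {e : Fin n → C} {f : Fin r → C} {p q t p' q' t' : ℤ} (hg : IsGraft i b c e f) (h : p + q = t)
    (ht : t' + 1 = t) (hp : p' + 1 = p) (hq : q' + 1 = q) (h₁ : p' + q = t') (h₂ : p + q' = t')
    (x : (words G).X c a p) (y : (G ι).X e b q) :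
    wordsD G ht ((words G).graft ι hg h x y) =
      (words G).graft ι hg h₁ (wordsD G hp x) y +
        (-1 : k) ^ p • (words G).graft ι hg h₂ x ((G ι).d hq y) := by
  refine (wordsDeriv_graft _ ι hg h _ (show p + -1 = p' by omega) (show q + -1 = q' by omega)
    h₁ h₂ x y).trans ?_
  congr 1
  exact neg_one_zpow_smul_congr ⟨-p, by ring⟩ rfl

theorem wordsD_wordsD {n : ℕ} {c : Fin n → C} {a : C} {p q t : ℤ} (h : q + 1 = p)
    (h' : t + 1 = q) (x : (words G).X c a p) : wordsD G h' (wordsD G h x) = 0 := by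
  induction x using words_induction generalizing q t with
  | zero => simp
  | add x y hx hy => rw [map_add, map_add, hx, hy, add_zero]
  | smul s x hx => rw [map_smul, map_smul, hx, smul_zero]
  | one hu => simp
  | perm σ hσ x hx => rw [wordsD_perm, wordsD_perm, hx, map_zero]
  | @graft ι m n r i a b c e f p₁ p₂ t₁ hg hp x y hx =>
    rw [wordsD_graft ι hg hp h (sub_add_cancel _ 1) (sub_add_cancel _ 1) (by omega) (by omega),
      map_add, map_smul, wordsD_graft ι hg _ h' (sub_add_cancel _ 1) (sub_add_cancel _ 1)
        (by omega) (by omega),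
      wordsD_graft ι hg _ h' (sub_add_cancel _ 1) (sub_add_cancel _ 1) (by omega) (by omega),
      hx, (G ι).d_d]
    simp only [map_zero, LinearMap.zero_apply, smul_zero, add_zero, zero_add]
    -- The two mixed terms have signs of opposite parity, because the first differentiation has
    -- lowered the degree of `x` by one.
    rw [neg_one_zpow_succ (sub_add_cancel p₁ 1), neg_smul, add_neg_cancel]

end wordsD

end DgOperad

namespace DgOperad

variable {k : Type u} [Field k] {C : Type u} {I : Type}

/-! ### Augmentations -/

/-- An augmentation of `P`. -/
structure Augmentation (P : DgOperad k C) where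
  hom : P ⟶ unit k C
  unitHom_comp : unitHom P ≫ hom = 𝟙 (unit k C)

namespace Augmentation

variable {P : DgOperad k C} (A : Augmentation P)

/-- The value of the augmentation. -/
def eps {n : ℕ} {c : Fin n → C} {a : C} {p : ℤ} : P.X c a p →ₗ[k] unitX k c a p :=
  Hom.app A.hom

theorem eps_smulOne {n : ℕ} {c : Fin n → C} {a : C} {p : ℤ} (x : unitX k c a p) :
    A.eps (P.smulOne c a p x) = x :=
  congrArg (fun F : unit k C ⟶ unit k C => Hom.app F (c := c) (a := a) (p := p) x) A.unitHom_comp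

theorem eps_one {n : ℕ} {c : Fin n → C} {a : C} {p : ℤ} (hu : IsUnitPlace c a p) :
    A.eps (P.one hu) = ⟨1, fun h => absurd hu h⟩ := Hom.app_one A.hom hu

theorem eps_d {n : ℕ} {c : Fin n → C} {a : C} {p q : ℤ} (h : q + 1 = p) (x : P.X c a p) :
    A.eps (P.d h x) = 0 := Hom.app_d A.hom h x

theorem eps_act {n : ℕ} {c : Fin n → C} {a : C} {p : ℤ} (σ : Equiv.Perm (Fin n)) (x : P.X c a p) :
    A.eps (P.act σ x) = unitAct σ (A.eps x) := Hom.app_act A.hom σ x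

theorem eps_comp {m n r : ℕ} {i : Fin m} {a b : C} {c : Fin m → C} {e : Fin n → C}
    {f : Fin r → C} {p q t : ℤ} (hg : IsGraft i b c e f) (h : p + q = t) (x : P.X c a p)
    (y : P.X e b q) : A.eps (P.comp hg h x y) = unitComp hg h (A.eps x) (A.eps y) :=
  Hom.app_comp A.hom hg h x y

/-- The projection to the kernel of the augmentation. -/
noncomputable def bar {n : ℕ} {c : Fin n → C} {a : C} {p : ℤ} : P.X c a p →ₗ[k] P.X c a p :=
  LinearMap.id - P.smulOne c a p ∘ₗ A.eps

theorem bar_apply {n : ℕ} {c : Fin n → C} {a : C} {p : ℤ} (x : P.X c a p) :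
    A.bar x = x - P.smulOne c a p (A.eps x) := rfl

theorem bar_add {n : ℕ} {c : Fin n → C} {a : C} {p : ℤ} (x : P.X c a p) :
    A.bar x + P.smulOne c a p (A.eps x) = x := sub_add_cancel _ _

theorem eps_bar {n : ℕ} {c : Fin n → C} {a : C} {p : ℤ} (x : P.X c a p) : A.eps (A.bar x) = 0 := by
  rw [bar_apply, map_sub, eps_smulOne, sub_self]

theorem bar_of_eps {n : ℕ} {c : Fin n → C} {a : C} {p : ℤ} {x : P.X c a p} (h : A.eps x = 0) :
    A.bar x = x := by
  rw [bar_apply, h, map_zero, sub_zero]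

@[simp]
theorem bar_bar {n : ℕ} {c : Fin n → C} {a : C} {p : ℤ} (x : P.X c a p) :
    A.bar (A.bar x) = A.bar x := A.bar_of_eps (A.eps_bar x)

@[simp]
theorem bar_one {n : ℕ} {c : Fin n → C} {a : C} {p : ℤ} (hu : IsUnitPlace c a p) :
    A.bar (P.one hu) = 0 := by
  rw [bar_apply, eps_one, smulOne_apply P hu, one_smul, sub_self]

theorem bar_d {n : ℕ} {c : Fin n → C} {a : C} {p q : ℤ} (h : q + 1 = p) (x : P.X c a p) :
    A.bar (P.d h x) = P.d h x := A.bar_of_eps (A.eps_d h x)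

theorem d_bar {n : ℕ} {c : Fin n → C} {a : C} {p q : ℤ} (h : q + 1 = p) (x : P.X c a p) :
    P.d h (A.bar x) = P.d h x := by
  rw [bar_apply, map_sub, d_smulOne, sub_zero]

theorem bar_act {n : ℕ} {c : Fin n → C} {a : C} {p : ℤ} (σ : Equiv.Perm (Fin n)) (x : P.X c a p) :
    A.bar (P.act σ x) = P.act σ (A.bar x) := by
  rw [bar_apply, bar_apply, eps_act, smulOne_act, map_sub]

-- The augmentation is multiplicative, so its kernel is closed under composition.
@[simp]
theorem bar_comp_bar {m n r : ℕ} {i : Fin m} {a b : C} {c : Fin m → C} {e : Fin n → C}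
    {f : Fin r → C} {p q t : ℤ} (hg : IsGraft i b c e f) (h : p + q = t) (x : P.X c a p)
    (y : P.X e b q) : A.bar (P.comp hg h (A.bar x) (A.bar y)) = P.comp hg h (A.bar x) (A.bar y) :=
  A.bar_of_eps (by rw [eps_comp, eps_bar, map_zero, LinearMap.zero_apply])

/-- The splitting into multiples of units and the augmentation ideal, as an induction principle: a
linear statement is checked on units and on the ideal. -/
theorem induction {n : ℕ} {c : Fin n → C} {a : C} {p : ℤ} {motive : P.X c a p → Prop}
    (x : P.X c a p) (add : ∀ x y, motive x → motive y → motive (x + y))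
    (smul : ∀ (s : k) x, motive x → motive (s • x))
    (one : ∀ hu : IsUnitPlace c a p, motive (P.one hu))
    (bar : ∀ x, A.eps x = 0 → motive x) : motive x := by
  rw [← A.bar_add x]
  refine add _ _ (bar _ (A.eps_bar x)) ?_
  by_cases hu : IsUnitPlace c a p
  · rw [smulOne_apply P hu]
    exact smul _ _ (one hu)
  · rw [unitX_eq_zero hu (A.eps x), map_zero]
    exact bar 0 (map_zero _)

end Augmentation

/-! ### Multiplication of the element that carries an input -/

/-- The data for grafting something of input colors `e`, output color `b` and degree `q` on an
input of something of input colors `c` and degree `p`. -/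
structure Slot {m : ℕ} (c : Fin m → C) (p : ℤ) where
  {n r : ℕ}
  {i : Fin m}
  {b : C}
  {e : Fin n → C}
  {f : Fin r → C}
  {q t : ℤ}
  hg : IsGraft i b c e f
  h : p + q = t

variable {G : I → DgOperad k C} (A : ∀ ι, Augmentation (G ι)) (κ : I)

/-- Multiplying the last element of a word. -/
noncomputable def multInner {m n l r' v : ℕ} {i : Fin m} {j : Fin n} {a b b' : C}
    {c : Fin m → C} {e : Fin n → C} {g : Fin l → C} {f' : Fin r' → C}
    {w : Fin v → C} {p q t qt pqt : ℤ}
    (h₃ : IsGraft j b' e g f') (h₄ : IsGraft i b c f' w) (d₃ : q + t = qt) (d₄ : p + qt = pqt)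
    (x : (words G).X c a p) (y : (G κ).X e b q) : (G κ).X g b' t →ₗ[k] (words G).X w a pqt :=
  -- Both factors are projected to the augmentation ideal. A letter counts only modulo units,
  -- whereas the product of a unit with `z` is not zero; the projection makes the product well
  -- defined on letters.
  (words G).graft κ h₄ d₄ x ∘ₗ (G κ).comp h₃ d₃ ((A κ).bar y) ∘ₗ (A κ).bar

theorem multInner_apply {m n l r' v : ℕ} {i : Fin m} {j : Fin n} {a b b' : C}
    {c : Fin m → C} {e : Fin n → C} {g : Fin l → C} {f' : Fin r' → C}
    {w : Fin v → C} {p q t qt pqt : ℤ}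
    (h₃ : IsGraft j b' e g f') (h₄ : IsGraft i b c f' w) (d₃ : q + t = qt) (d₄ : p + qt = pqt)
    (x : (words G).X c a p) (y : (G κ).X e b q) (z : (G κ).X g b' t) :
    multInner A κ h₃ h₄ d₃ d₄ x y z = (words G).graft κ h₄ d₄ x
      ((G κ).comp h₃ d₃ ((A κ).bar y) ((A κ).bar z)) := rfl

/-- The arity, colors and degree of the product are determined by those of the factors, so the data
picked by choice in `multGraft` do not matter. -/
theorem multInner_congr {m n l r' r'' v : ℕ} {i : Fin m} {j : Fin n} {a b b' : C}
    {c : Fin m → C} {e : Fin n → C} {g : Fin l → C} {f' : Fin r' → C} {f'' : Fin r'' → C}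
    {w : Fin v → C} {p q t qt qt' pqt : ℤ}
    (h₃ : IsGraft j b' e g f') (h₄ : IsGraft i b c f' w) (d₃ : q + t = qt) (d₄ : p + qt = pqt)
    (h₃' : IsGraft j b' e g f'') (h₄' : IsGraft i b c f'' w) (d₃' : q + t = qt')
    (d₄' : p + qt' = pqt) (x : (words G).X c a p) (y : (G κ).X e b q) :
    multInner A κ h₃ h₄ d₃ d₄ x y = multInner A κ h₃' h₄' d₃' d₄' x y := by
  obtain rfl : r' = r'' := by have := h₃.arity; have := h₃'.arity; omega
  obtain rfl := h₃.eq h₃'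
  subst d₃ d₃'
  rfl

/-- Words together with operators that graft elements of `G κ`. -/
abbrev MultX (G : I → DgOperad k C) (κ : I) {m : ℕ} (c : Fin m → C) (a : C) (p : ℤ) : Type u :=
  (words G).X c a p × (∀ s : Slot c p, (G κ).X s.e s.b s.q →ₗ[k] (words G).X s.f a s.t)

/-- The graft of an element on another input commutes with the operators. -/
noncomputable def multOuter (ι : I) {m n l r' v : ℕ} {j : Fin m} {s' : Fin r'} {a b b' : C}
    {c : Fin m → C} {e : Fin n → C} {g : Fin l → C} {f' : Fin r' → C}
    {w : Fin v → C} {p q t pt pqt : ℤ}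
    (h₃ : IsGraft j b' c g f') (h₄ : IsGraft s' b f' e w) (d₃ : p + t = pt) (d₄ : pt + q = pqt)
    (x : MultX G κ c a p) (y : (G ι).X e b q) : (G κ).X g b' t →ₗ[k] (words G).X w a pqt :=
  (-1 : k) ^ (q * t) • ((words G).graft ι h₄ d₄).flip y ∘ₗ x.2 ⟨h₃, d₃⟩

theorem multOuter_apply (ι : I) {m n l r' v : ℕ} {j : Fin m} {s' : Fin r'} {a b b' : C}
    {c : Fin m → C} {e : Fin n → C} {g : Fin l → C} {f' : Fin r' → C}
    {w : Fin v → C} {p q t pt pqt : ℤ}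
    (h₃ : IsGraft j b' c g f') (h₄ : IsGraft s' b f' e w) (d₃ : p + t = pt) (d₄ : pt + q = pqt)
    (x : MultX G κ c a p) (y : (G ι).X e b q) (z : (G κ).X g b' t) :
    multOuter κ ι h₃ h₄ d₃ d₄ x y z =
      (-1 : k) ^ (q * t) • (words G).graft ι h₄ d₄ (x.2 ⟨h₃, d₃⟩ z) y := rfl

theorem multOuter_congr (ι : I) {m n l r' r'' v : ℕ} {i j : Fin m} {s' : Fin r'} {s'' : Fin r''}
    {a b b' : C}
    {c : Fin m → C} {e : Fin n → C} {g : Fin l → C} {f' : Fin r' → C} {f'' : Fin r'' → C}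
    {w : Fin v → C} {p q t pt pt' pqt : ℤ}
    (h₃ : IsGraft j b' c g f') (h₄ : IsGraft s' b f' e w) (d₃ : p + t = pt) (d₄ : pt + q = pqt)
    (h₃' : IsGraft j b' c g f'') (h₄' : IsGraft s'' b f'' e w) (d₃' : p + t = pt')
    (d₄' : pt' + q = pqt) (hs : OuterPos j l i s') (hs' : OuterPos j l i s'')
    (x : MultX G κ c a p) (y : (G ι).X e b q) :
    multOuter κ ι h₃ h₄ d₃ d₄ x y = multOuter κ ι h₃' h₄' d₃' d₄' x y := by
  obtain rfl : r' = r'' := by have := h₃.arity; have := h₃'.arity; omega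
  obtain rfl := h₃.eq h₃'
  obtain rfl := hs.eq_right hs'
  subst d₃ d₃'
  rfl

open Classical in
/-- The operators on a word with a grafted element. -/
noncomputable def multGraft (ι : I) {m n r : ℕ} {i : Fin m} {a b : C} {c : Fin m → C}
    {e : Fin n → C} {f : Fin r → C} {p q t : ℤ} (hg : IsGraft i b c e f) (h : p + q = t)
    (x : MultX G κ c a p) (y : (G ι).X e b q) (s : Slot f t) :
    (G κ).X s.e s.b s.q →ₗ[k] (words G).X s.f a s.t :=
  -- If the input belongs to the letter `y`, that letter is multiplied; otherwise the operator
  -- passes `y` with a sign and acts on `x`.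
  if hs : ∃ j : Fin n, InnerPos i j s.i then
    if hι : κ = ι then
      multInner A κ (hg.assoc s.hg hs.choose_spec).choose_spec.1
        (hg.assoc s.hg hs.choose_spec).choose_spec.2 rfl
        (show p + (q + s.q) = s.t by have := s.h; omega) x.1 (hι ▸ y)
    -- Letters of different operads cannot be multiplied; there the new element survives as a
    -- letter, through the graft term of `op`.
    else 0
  else
    have hs' := (pos_cases hg.arity i s.i).resolve_left hs
    multOuter κ ι (hg.comm s.hg hs'.choose_spec).choose_spec.choose_spec.2.1
      (hg.comm s.hg hs'.choose_spec).choose_spec.choose_spec.2.2 rfl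
      (show p + s.q + q = s.t by have := s.h; omega) x y

section multGraft

variable {m n l r r' v : ℕ} {i : Fin m} {s : Fin r} {a b b' : C}
    {c : Fin m → C} {e : Fin n → C} {g : Fin l → C} {f : Fin r → C} {f' : Fin r' → C}
    {w : Fin v → C} {p q t pq qt pt pqt : ℤ}

theorem multGraft_inner {j : Fin n} (h₁ : IsGraft i b c e f) (h₂ : IsGraft s b' f g w)
    (h₃ : IsGraft j b' e g f') (h₄ : IsGraft i b c f' w) (hs : InnerPos i j s)
    (d₁ : p + q = pq) (d₂ : pq + t = pqt) (d₃ : q + t = qt) (d₄ : p + qt = pqt)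
    (x : MultX G κ c a p) (y : (G κ).X e b q) (z : (G κ).X g b' t) :
    multGraft A κ κ h₁ d₁ x y ⟨h₂, d₂⟩ z =
      (words G).graft κ h₄ d₄ x.1 ((G κ).comp h₃ d₃ ((A κ).bar y) ((A κ).bar z)) := by
  have hex : ∃ j : Fin n, InnerPos i j s := ⟨j, hs⟩
  rw [multGraft, dif_pos hex, dif_pos rfl, ← multInner_apply]
  obtain rfl := hs.eq_left hex.choose_spec
  exact LinearMap.congr_fun (multInner_congr A κ _ _ _ _ _ _ _ _ _ _) z

theorem multGraft_inner_ne {ι : I} (hι : κ ≠ ι) {j : Fin n} (h₁ : IsGraft i b c e f)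
    (h₂ : IsGraft s b' f g w) (hs : InnerPos i j s)
    (d₁ : p + q = pq) (d₂ : pq + t = pqt)
    (x : MultX G κ c a p) (y : (G ι).X e b q) (z : (G κ).X g b' t) :
    multGraft A κ ι h₁ d₁ x y ⟨h₂, d₂⟩ z = 0 := by
  have hex : ∃ j : Fin n, InnerPos i j s := ⟨j, hs⟩
  rw [multGraft, dif_pos hex, dif_neg hι]
  rfl

theorem multGraft_outer (ι : I) {j : Fin m} {s' : Fin r'} (h₁ : IsGraft i b c e f)
    (h₂ : IsGraft s b' f g w)
    (h₃ : IsGraft j b' c g f') (h₄ : IsGraft s' b f' e w) (hs : OuterPos i n j s)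
    (hs' : OuterPos j l i s')
    (d₁ : p + q = pq) (d₂ : pq + t = pqt) (d₃ : p + t = pt) (d₄ : pt + q = pqt)
    (x : MultX G κ c a p) (y : (G ι).X e b q) (z : (G κ).X g b' t) :
    multGraft A κ ι h₁ d₁ x y ⟨h₂, d₂⟩ z =
      (-1 : k) ^ (q * t) • (words G).graft ι h₄ d₄ (x.2 ⟨h₃, d₃⟩ z) y := by
  have hex : ¬ ∃ j : Fin n, InnerPos i j s := fun ⟨j, hj⟩ => hs.not_inner hj
  have hs₂ := (pos_cases h₁.arity i s).resolve_left hex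
  rw [multGraft, dif_neg hex, ← multOuter_apply]
  obtain rfl := hs.eq_left hs₂.choose_spec
  exact LinearMap.congr_fun (multOuter_congr κ ι _ _ _ _ _ _ _ _
    (h₁.comm h₂ hs₂.choose_spec).choose_spec.choose_spec.1 hs' _ _) z

end multGraft

/-- The witnesses are independent of `x` and `y`, so linearity in both variables can be read off the
three formulas. -/
theorem multGraft_cases (ι : I) {m n r : ℕ} {i : Fin m} {a b : C} {c : Fin m → C}
    {e : Fin n → C} {f : Fin r → C} {p q t : ℤ} (hg : IsGraft i b c e f) (h : p + q = t)
    (s : Slot f t) (z : (G κ).X s.e s.b s.q) :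
    (∃ (j : Fin n) (f' : Fin (n + s.n - 1) → C) (hι : κ = ι) (h₃ : IsGraft j s.b e s.e f')
      (h₄ : IsGraft i b c f' s.f) (d : p + (q + s.q) = s.t), InnerPos i j s.i ∧
      ∀ (x : MultX G κ c a p) (y : (G ι).X e b q), multGraft A κ ι hg h x y s z =
        (words G).graft ι h₄ d x.1
          ((G ι).comp h₃ rfl ((A ι).bar y) ((A ι).bar (hι ▸ z)))) ∨
    (κ ≠ ι ∧ (∃ j : Fin n, InnerPos i j s.i) ∧
      ∀ (x : MultX G κ c a p) (y : (G ι).X e b q), multGraft A κ ι hg h x y s z = 0) ∨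
    ∃ (j : Fin m) (s' : Fin (m + s.n - 1)) (f' : Fin (m + s.n - 1) → C)
      (h₃ : IsGraft j s.b c s.e f') (h₄ : IsGraft s' b f' e s.f) (d : p + s.q + q = s.t),
      OuterPos i n j s.i ∧ OuterPos j s.n i s' ∧
      ∀ (x : MultX G κ c a p) (y : (G ι).X e b q), multGraft A κ ι hg h x y s z =
        (-1 : k) ^ (q * s.q) • (words G).graft ι h₄ d (x.2 ⟨h₃, rfl⟩ z) y := by
  have hd := s.h
  obtain ⟨j, hj⟩ | ⟨j, hj⟩ := pos_cases hg.arity i s.i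
  · by_cases hι : κ = ι
    · subst hι
      obtain ⟨f', h₃, h₄⟩ := hg.assoc s.hg hj
      exact Or.inl ⟨j, f', rfl, h₃, h₄, by omega, hj, fun x y =>
        multGraft_inner A κ hg s.hg h₃ h₄ hj h s.h rfl (by omega) x y z⟩
    · exact Or.inr (Or.inl ⟨hι, ⟨j, hj⟩, fun x y =>
        multGraft_inner_ne A κ hι hg s.hg hj h s.h x y z⟩)
  · obtain ⟨s', f', hs', h₃, h₄⟩ := hg.comm s.hg hj
    exact Or.inr (Or.inr ⟨j, s', f', h₃, h₄, by omega, hj, hs', fun x y =>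
      multGraft_outer A κ ι hg s.hg h₃ h₄ hj hs' h s.h rfl (by omega) x y z⟩)

end DgOperad

namespace DgOperad

variable {k : Type u} [Field k] {C : Type u} {I : Type}
variable {G : I → DgOperad k C} (A : ∀ ι, Augmentation (G ι)) (κ : I)

/-- Grafting at `i` after a permutation `σ` is grafting at `σ i` followed by the block permutation;
the colors before the permutation are recovered from those after it. -/
theorem exists_perm_graft {m n r : ℕ} {i : Fin m} {b : C} {c c' : Fin m → C} {e : Fin n → C}
    {f' : Fin r → C} (σ : Equiv.Perm (Fin m)) (hc : c' = c ∘ σ) (hg' : IsGraft i b c' e f') :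
    ∃ (ρ : Equiv.Perm (Fin r)) (f : Fin r → C),
      BlockPerm i σ (1 : Equiv.Perm (Fin n)) ρ ∧ IsGraft (σ i) b c e f ∧ f' = f ∘ ρ := by
  obtain ⟨ρ, hρ⟩ := exists_blockPerm hg'.arity i σ (1 : Equiv.Perm (Fin n))
  obtain ⟨f, hf, hf'⟩ := hg'.perm_right hc (e := e) rfl hρ
  exact ⟨ρ, f, hρ, hf, hf'⟩

/-- The action of the symmetric groups on words with operators. -/
noncomputable def multPerm {n : ℕ} {c c' : Fin n → C} {a : C} {p : ℤ} (σ : Equiv.Perm (Fin n))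
    (hc : c' = c ∘ σ) : MultX G κ c a p →ₗ[k] MultX G κ c' a p :=
  ((words G).perm σ hc).prodMap (LinearMap.pi fun s =>
    have h := exists_perm_graft σ hc s.hg
    ((words G).perm h.choose h.choose_spec.choose_spec.2.2).compRight k ∘ₗ
      LinearMap.proj (R := k)
        (φ := fun s : Slot c p => (G κ).X s.e s.b s.q →ₗ[k] (words G).X s.f a s.t)
        ⟨h.choose_spec.choose_spec.2.1, s.h⟩)

/-- Block permutations and colors of grafts are unique, so the definition by choice may be evaluated
with any such data. -/
theorem multPerm_snd {m n r : ℕ} {i : Fin m} {a b : C} {c c' : Fin m → C} {e : Fin n → C}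
    {f f' : Fin r → C} {p q t : ℤ} (σ : Equiv.Perm (Fin m)) (ρ : Equiv.Perm (Fin r))
    (hc : c' = c ∘ σ) (hf : f' = f ∘ ρ)
    (hg : IsGraft (σ i) b c e f) (hg' : IsGraft i b c' e f')
    (hρ : BlockPerm i σ (1 : Equiv.Perm (Fin n)) ρ) (h : p + q = t)
    (x : MultX G κ c a p) (z : (G κ).X e b q) :
    (multPerm κ σ hc x).2 ⟨hg', h⟩ z = (words G).perm ρ hf (x.2 ⟨hg, h⟩ z) := by
  have hex := exists_perm_graft σ hc hg'
  have key : ∀ (ρ' : Equiv.Perm (Fin r)) (f'' : Fin r → C)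
      (hρ' : BlockPerm i σ (1 : Equiv.Perm (Fin n)) ρ') (hg'' : IsGraft (σ i) b c e f'')
      (hf'' : f' = f'' ∘ ρ'),
      (words G).perm ρ' hf'' (x.2 ⟨hg'', h⟩ z) = (words G).perm ρ hf (x.2 ⟨hg, h⟩ z) := by
    intro ρ' f'' hρ' hg'' hf''
    obtain rfl := hρ.unique hg.arity hρ'
    obtain rfl := hg.eq hg''
    rfl
  exact key _ _ hex.choose_spec.choose_spec.1 _ _

theorem multGraft_add_left (ι : I) {m n r : ℕ} {i : Fin m} {a b : C} {c : Fin m → C}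
    {e : Fin n → C} {f : Fin r → C} {p q t : ℤ} (hg : IsGraft i b c e f) (h : p + q = t)
    (x x' : MultX G κ c a p) (y : (G ι).X e b q) :
    multGraft A κ ι hg h (x + x') y = multGraft A κ ι hg h x y + multGraft A κ ι hg h x' y := by
  funext s
  ext z
  obtain ⟨_, _, _, _, _, _, _, H⟩ | ⟨_, _, H⟩ | ⟨_, _, _, _, _, _, _, _, H⟩ :=
    multGraft_cases (a := a) A κ ι hg h s z <;>
    simp only [H, Pi.add_apply, LinearMap.add_apply, Prod.fst_add, Prod.snd_add, map_add,
      smul_add, add_zero]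

theorem multGraft_smul_left (ι : I) {m n r : ℕ} {i : Fin m} {a b : C} {c : Fin m → C}
    {e : Fin n → C} {f : Fin r → C} {p q t : ℤ} (hg : IsGraft i b c e f) (h : p + q = t)
    (l : k) (x : MultX G κ c a p) (y : (G ι).X e b q) :
    multGraft A κ ι hg h (l • x) y = l • multGraft A κ ι hg h x y := by
  funext s
  ext z
  obtain ⟨_, _, _, _, _, _, _, H⟩ | ⟨_, _, H⟩ | ⟨_, _, _, _, _, _, _, _, H⟩ :=
    multGraft_cases (a := a) A κ ι hg h s z <;>
    simp only [H, Pi.smul_apply, LinearMap.smul_apply, Prod.smul_fst, Prod.smul_snd, map_smul,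
      smul_zero]
  rw [smul_comm]

theorem multGraft_add_right (ι : I) {m n r : ℕ} {i : Fin m} {a b : C} {c : Fin m → C}
    {e : Fin n → C} {f : Fin r → C} {p q t : ℤ} (hg : IsGraft i b c e f) (h : p + q = t)
    (x : MultX G κ c a p) (y y' : (G ι).X e b q) :
    multGraft A κ ι hg h x (y + y') = multGraft A κ ι hg h x y + multGraft A κ ι hg h x y' := by
  funext s
  ext z
  obtain ⟨_, _, _, _, _, _, _, H⟩ | ⟨_, _, H⟩ | ⟨_, _, _, _, _, _, _, _, H⟩ :=
    multGraft_cases (a := a) A κ ι hg h s z <;>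
    simp only [H, Pi.add_apply, LinearMap.add_apply, map_add, smul_add, add_zero]

theorem multGraft_smul_right (ι : I) {m n r : ℕ} {i : Fin m} {a b : C} {c : Fin m → C}
    {e : Fin n → C} {f : Fin r → C} {p q t : ℤ} (hg : IsGraft i b c e f) (h : p + q = t)
    (l : k) (x : MultX G κ c a p) (y : (G ι).X e b q) :
    multGraft A κ ι hg h x (l • y) = l • multGraft A κ ι hg h x y := by
  funext s
  ext z
  obtain ⟨_, _, _, _, _, _, _, H⟩ | ⟨_, _, H⟩ | ⟨_, _, _, _, _, _, _, _, H⟩ :=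
    multGraft_cases (a := a) A κ ι hg h s z <;>
    simp only [H, Pi.smul_apply, LinearMap.smul_apply, map_smul, smul_zero]
  rw [smul_comm]

/-- Grafting on words with operators. -/
noncomputable def multComp (ι : I) {m n r : ℕ} {i : Fin m} {a b : C} {c : Fin m → C}
    {e : Fin n → C} {f : Fin r → C} {p q t : ℤ} (hg : IsGraft i b c e f) (h : p + q = t) :
    MultX G κ c a p →ₗ[k] (G ι).X e b q →ₗ[k] MultX G κ f a t :=
  LinearMap.mk₂ k (fun x y => ((words G).graft ι hg h x.1 y, multGraft A κ ι hg h x y))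
    (fun x x' y => Prod.ext (by simp) (multGraft_add_left A κ ι hg h x x' y))
    (fun l x y => Prod.ext (by simp) (multGraft_smul_left A κ ι hg h l x y))
    (fun x y y' => Prod.ext (by simp) (multGraft_add_right A κ ι hg h x y y'))
    (fun l x y => Prod.ext (by simp) (multGraft_smul_right A κ ι hg h l x y))

/-- If the input lies on the new letter, this is equivariance of the composition in `G κ` with
`BlockPerm.assoc`; if it lies on the old word, `BlockPerm.comm` exchanges the two block
permutations. -/
theorem multGraft_perm (ι : I) {m n r : ℕ} {i : Fin m} {a b : C} {c c' : Fin m → C}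
    {e : Fin n → C}
    {f f' : Fin r → C} {p q t : ℤ} (σ : Equiv.Perm (Fin m)) (τ : Equiv.Perm (Fin n))
    (ρ : Equiv.Perm (Fin r)) (hg : IsGraft (σ i) b c e f) (hc : c' = c ∘ σ) (hf : f' = f ∘ ρ)
    (hg' : IsGraft i b c' (e ∘ τ) f') (hρ : BlockPerm i σ τ ρ) (h : p + q = t)
    (x : MultX G κ c a p) (y : (G ι).X e b q) :
    multGraft A κ ι hg' h (multPerm κ σ hc x) ((G ι).act τ y) =
      (multPerm κ ρ hf (multComp A κ ι hg h x y)).2 := by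
  funext s'
  obtain ⟨h₂', d⟩ := s'
  rename_i l v s b' g w t' pqt
  obtain ⟨ρ₃, f₃, hρ₃, h₂, hf₃⟩ := exists_perm_graft ρ hf h₂'
  subst hc hf hf₃
  have a1 := hg.arity
  have a2 := h₂.arity
  have := i.2
  have := s.2
  ext z
  rw [multPerm_snd κ ρ ρ₃ rfl rfl h₂ h₂' hρ₃]
  change _ = (words G).perm ρ₃ rfl (multGraft A κ ι hg h x y ⟨h₂, d⟩ z)
  obtain ⟨j, hj⟩ | ⟨j, hj⟩ := pos_cases hg.arity i s
  · have := j.2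
    have hj' := hρ.inner _ _ hj
    by_cases hι : κ = ι
    · subst hι
      obtain ⟨f₀, h₃, h₄⟩ := hg.assoc h₂ hj'
      obtain ⟨ρ₁, hρ₁⟩ := exists_blockPerm h₃.arity j τ (1 : Equiv.Perm (Fin l))
      have hb := hρ.assoc a1 a2 (by omega) hj hρ₁ hρ₃
      rw [multGraft_inner A κ hg h₂ h₃ h₄ hj' h d rfl (by omega),
        multGraft_inner A κ hg' h₂' (h₃.perm hρ₁) (h₄.perm hb) hj h d rfl (by omega),
        ← (words G).graft_perm κ σ ρ₁ ρ₃ h₄ rfl rfl (h₄.perm hb) hb,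
        ← (G κ).comp_act τ 1 ρ₁ h₃ (h₃.perm hρ₁) hρ₁.outer hρ₁.inner, (A κ).bar_act,
        (G κ).act_one]
      rfl
    · rw [multGraft_inner_ne A κ hι hg h₂ hj' h d, multGraft_inner_ne A κ hι hg' h₂' hj h d,
        map_zero]
  · have hj' := hρ.outer _ _ hj
    obtain ⟨s₁, f₀, hs₁, h₃, h₄⟩ := hg.comm h₂ hj'
    obtain ⟨ρ₁, hρ₁⟩ := exists_blockPerm h₃.arity j σ (1 : Equiv.Perm (Fin l))
    obtain ⟨s₀, hs₀⟩ := exists_outerPos h₃.arity hj.ne.symm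
    obtain rfl := (hρ₁.outer _ _ hs₀).eq_right hs₁
    have hb := hρ.comm a1 a2 (by omega) hj hs₀ hρ₁ hρ₃
    rw [multGraft_outer A κ ι hg h₂ h₃ h₄ hj' hs₁ h d rfl (by omega),
      multGraft_outer A κ ι hg' h₂' (h₃.perm hρ₁) (h₄.perm hb) hj hs₀ h d rfl (by omega),
      multPerm_snd κ σ ρ₁ rfl rfl h₃ (h₃.perm hρ₁) hρ₁, map_smul,
      ← (words G).graft_perm ι ρ₁ τ ρ₃ h₄ rfl rfl (h₄.perm hb) hb]

section comm

variable (ι η : I) {m n l r r' v : ℕ} {i j : Fin m} {s : Fin r} {s' : Fin r'} {a b b' : C}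
    {c : Fin m → C} {e : Fin n → C} {g : Fin l → C} {f : Fin r → C} {f' : Fin r' → C}
    {w : Fin v → C} {p q t pq pt pqt : ℤ}

/-- When the input lies on the letter `z`, multiplying `z` and then exchanging it with `y` is one
exchange of `y` with the product; the signs add up since degrees do. -/
theorem multComp_comm_inner
    (h₁ : IsGraft i b c e f) (h₂ : IsGraft s b' f g w)
    (h₃ : IsGraft j b' c g f') (h₄ : IsGraft s' b f' e w)
    (hs : OuterPos i n j s) (hs' : OuterPos j l i s')
    (d₁ : p + q = pq) (d₂ : pq + t = pqt) (d₃ : p + t = pt) (d₄ : pt + q = pqt)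
    (x : MultX G κ c a p) (y : (G ι).X e b q) (z : (G η).X g b' t)
    (o : Slot w pqt) (j₁ : Fin l) (hj₁ : InnerPos s j₁ o.i) :
    (multComp A κ η h₂ d₂ (multComp A κ ι h₁ d₁ x y) z).2 o =
      (((-1 : k) ^ (q * t)) • multComp A κ ι h₄ d₄ (multComp A κ η h₃ d₃ x z) y).2 o := by
  obtain ⟨ho, dₒ⟩ := o
  rename_i N V u b'' g' w' T pqtT
  dsimp only at hj₁
  ext y'
  change multGraft A κ η h₂ d₂ (multComp A κ ι h₁ d₁ x y) z ⟨ho, dₒ⟩ y' =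
    (-1 : k) ^ (q * t) • multGraft A κ ι h₄ d₄ (multComp A κ η h₃ d₃ x z) y ⟨ho, dₒ⟩ y'
  obtain ⟨u', hu'⟩ := exists_innerPos h₃.arity j j₁
  have hu'' : OuterPos s' n u' u := by
    have := j₁.2
    simp only [OuterPos, InnerPos, Fin.lt_def] at *; omega
  obtain ⟨t', F, ht', h₅, h₆⟩ := h₄.comm ho hu''
  rw [multGraft_outer A κ ι h₄ ho h₅ h₆ hu'' ht' d₄ dₒ rfl (by omega)]
  change _ = (-1 : k) ^ (q * t) • (-1 : k) ^ (q * T) • (words G).graft ι h₆ _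
    (multGraft A κ η h₃ d₃ x z ⟨h₅, rfl⟩ y') y
  by_cases hη : κ = η
  · subst hη
    obtain ⟨F₂, h₇, h₈⟩ := h₃.assoc h₅ hu'
    obtain ⟨F₂', h₇', h₉⟩ := h₂.assoc ho hj₁
    obtain rfl := h₇.eq h₇'
    rw [multGraft_inner A κ h₂ ho h₇ h₉ hj₁ d₂ dₒ rfl (by omega),
      multGraft_inner A κ h₃ h₅ h₇ h₈ hu' d₃ rfl rfl (by omega)]
    have hp : OuterPos j (l + N - 1) i t' := by
      have := j₁.2
      simp only [OuterPos, InnerPos, Fin.lt_def] at *; omega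
    refine ((words G).graft_comm ι κ h₁ h₉ h₈ h₆ hs hp d₁ _
      (show p + (t + T) = pt + T by omega) (show pt + T + q = pqtT by omega) x.1 y _).trans ?_
    rw [neg_one_zpow_smul_smul, ← mul_add]
  · rw [multGraft_inner_ne A κ hη h₂ ho hj₁, multGraft_inner_ne A κ hη h₃ h₅ hu']
    simp

/-- The input on which the operator acts lies on `z`, on `y` or on the old word. The first two cases
are the same up to exchanging the letters; in the third the operator passes both letters. -/
theorem multComp_comm
    (h₁ : IsGraft i b c e f) (h₂ : IsGraft s b' f g w)
    (h₃ : IsGraft j b' c g f') (h₄ : IsGraft s' b f' e w)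
    (hs : OuterPos i n j s) (hs' : OuterPos j l i s')
    (d₁ : p + q = pq) (d₂ : pq + t = pqt) (d₃ : p + t = pt) (d₄ : pt + q = pqt)
    (x : MultX G κ c a p) (y : (G ι).X e b q) (z : (G η).X g b' t) :
    multComp A κ η h₂ d₂ (multComp A κ ι h₁ d₁ x y) z =
      ((-1 : k) ^ (q * t)) • multComp A κ ι h₄ d₄ (multComp A κ η h₃ d₃ x z) y := by
  refine Prod.ext ((words G).graft_comm ι η h₁ h₂ h₃ h₄ hs hs' d₁ d₂ d₃ d₄ _ _ _)
    (funext fun o => ?_)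
  obtain ⟨j₁, hj₁⟩ | ⟨u₁, hu₁⟩ := pos_cases h₂.arity s o.i
  · exact multComp_comm_inner A κ ι η h₁ h₂ h₃ h₄ hs hs' d₁ d₂ d₃ d₄ x y z o j₁ hj₁
  obtain ⟨j₁, hj₁⟩ | ⟨u₀, hu₀⟩ := pos_cases h₁.arity i u₁
  · have hj₂ : InnerPos s' j₁ o.i := by
      have := j₁.2
      simp only [OuterPos, InnerPos, Fin.lt_def] at *; omega
    -- The case of the letter `y` is the previous one read from right to left; the sign is its own
    -- inverse.
    have := multComp_comm_inner A κ η ι h₃ h₄ h₁ h₂ hs' hs d₃ d₄ d₁ d₂ x z y o j₁ hj₂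
    rw [Prod.smul_snd, Pi.smul_apply, this, Prod.smul_snd, Pi.smul_apply, mul_comm,
      neg_one_zpow_smul_self]
  obtain ⟨ho, dₒ⟩ := o
  rename_i N V u b'' g' w' T pqtT
  dsimp only at hu₁
  ext y'
  change multGraft A κ η h₂ d₂ (multComp A κ ι h₁ d₁ x y) z ⟨ho, dₒ⟩ y' =
    (-1 : k) ^ (q * t) • multGraft A κ ι h₄ d₄ (multComp A κ η h₃ d₃ x z) y ⟨ho, dₒ⟩ y'
  have hj : u₀ ≠ j := by
    rintro rfl
    exact hu₁.ne (hu₀.eq_right hs)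
  obtain ⟨u₂, hu₂⟩ := exists_outerPos h₃.arity hj
  have hu₃ : OuterPos s' n u₂ u := hs'.comm hs hu₂ hu₀ hu₁
  obtain ⟨s₂, f₂, hs₂, h₅, h₆⟩ := h₂.comm ho hu₁
  obtain ⟨s₁, f₁, hs₁, h₇, h₈⟩ := h₁.comm h₅ hu₀
  obtain ⟨t₂, F₂, ht₂, h₅', h₆'⟩ := h₄.comm ho hu₃
  obtain ⟨t₁, F₁, ht₁, h₇', h₈'⟩ := h₃.comm h₅' hu₂
  obtain rfl := h₇.eq h₇'
  rw [multGraft_outer A κ η h₂ ho h₅ h₆ hu₁ hs₂ d₂ dₒ rfl (by omega),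
    multGraft_outer A κ ι h₄ ho h₅' h₆' hu₃ ht₂ d₄ dₒ rfl (by omega)]
  change (-1 : k) ^ (t * T) • (words G).graft η h₆ _
      (multGraft A κ ι h₁ d₁ x y ⟨h₅, rfl⟩ y') z =
    (-1 : k) ^ (q * t) • (-1 : k) ^ (q * T) • (words G).graft ι h₆' _
      (multGraft A κ η h₃ d₃ x z ⟨h₅', rfl⟩ y') y
  rw [multGraft_outer A κ ι h₁ h₅ h₇ h₈ hu₀ hs₁ d₁ rfl rfl (by omega),
    multGraft_outer A κ η h₃ h₅' h₇ h₈' hu₂ ht₁ d₃ rfl rfl (by omega)]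
  simp only [map_smul, LinearMap.smul_apply]
  rw [(words G).graft_comm ι η h₈ h₆ h₈' h₆' (hs₁.comm hu₀ ht₁ hs hs₂)
    (ht₁.comm hu₂ hs₁ hs' ht₂) _ _ (show p + T + t = pt + T by omega)
    (show pt + T + q = pqtT by omega)]
  simp only [neg_one_zpow_smul_smul]
  exact neg_one_zpow_smul_congr ⟨0, by ring⟩ rfl

end comm

/-- Multiplying one of two adjacent letters of the same operad gives a letter of that operad, still
adjacent to the other, so the result remains zero. -/
theorem multComp_multComp (ι : I) {m n l r v : ℕ} {i : Fin m} {j : Fin n} {s : Fin r}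
    {a b b' : C}
    {c : Fin m → C} {e : Fin n → C} {g : Fin l → C} {f : Fin r → C}
    {w : Fin v → C} {p q t pq pqt : ℤ}
    (h₁ : IsGraft i b c e f) (h₂ : IsGraft s b' f g w) (hs : InnerPos i j s)
    (d₁ : p + q = pq) (d₂ : pq + t = pqt)
    (x : MultX G κ c a p) (y : (G ι).X e b q) (z : (G ι).X g b' t) :
    multComp A κ ι h₂ d₂ (multComp A κ ι h₁ d₁ x y) z = 0 := by
  refine Prod.ext ((words G).graft_graft ι h₁ h₂ hs d₁ d₂ _ _ _) (funext fun o => ?_)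
  obtain ⟨ho, dₒ⟩ := o
  rename_i N V u b'' g' w' T pqtT
  ext y'
  change multGraft A κ ι h₂ d₂ (multComp A κ ι h₁ d₁ x y) z ⟨ho, dₒ⟩ y' = 0
  obtain ⟨j₁, hj₁⟩ | ⟨u₁, hu₁⟩ := pos_cases h₂.arity s u
  · by_cases hι : κ = ι
    · subst hι
      obtain ⟨F₂, h₃, h₄⟩ := h₂.assoc ho hj₁
      rw [multGraft_inner A κ h₂ ho h₃ h₄ hj₁ d₂ dₒ rfl (by omega)]
      exact (words G).graft_graft κ h₁ h₄ hs _ _ _ _ _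
    · rw [multGraft_inner_ne A κ hι h₂ ho hj₁]
  obtain ⟨s₂, f₂, hs₂, h₅, h₆⟩ := h₂.comm ho hu₁
  rw [multGraft_outer A κ ι h₂ ho h₅ h₆ hu₁ hs₂ d₂ dₒ rfl (by omega)]
  change (-1 : k) ^ (t * T) • (words G).graft ι h₆ _
      (multGraft A κ ι h₁ d₁ x y ⟨h₅, rfl⟩ y') z = 0
  obtain ⟨j₁, hj₁⟩ | ⟨u₀, hu₀⟩ := pos_cases h₁.arity i u₁
  · by_cases hι : κ = ι
    · subst hι
      obtain ⟨F₂, h₃, h₄⟩ := h₁.assoc h₅ hj₁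
      have hne : j ≠ j₁ := by
        rintro rfl
        exact hu₁.ne (hj₁.eq_right hs)
      obtain ⟨j₂, hj₂⟩ := exists_outerPos h₃.arity hne
      have hp : InnerPos i j₂ s₂ := by
        simp only [OuterPos, InnerPos, Fin.lt_def] at *; omega
      rw [multGraft_inner A κ h₁ h₅ h₃ h₄ hj₁ d₁ rfl rfl (by omega),
        (words G).graft_graft κ h₄ h₆ hp, smul_zero]
    · rw [multGraft_inner_ne A κ hι h₁ h₅ hj₁]
      simp
  · obtain ⟨s₁, f₁, hs₁, h₇, h₈⟩ := h₁.comm h₅ hu₀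
    have hp : InnerPos s₁ j s₂ := by
      have := j.2
      simp only [OuterPos, InnerPos, Fin.lt_def] at *; omega
    rw [multGraft_outer A κ ι h₁ h₅ h₇ h₈ hu₀ hs₁ d₁ rfl rfl (by omega), map_smul,
      LinearMap.smul_apply, (words G).graft_graft ι h₈ h₆ hp, smul_zero, smul_zero]

/-- Words together with operators that graft elements of `G κ`, as a module. -/
noncomputable def multModule : WordModule G where
  X c a p := MultX G κ c a p
  one hu := ((words G).one hu, 0)
  perm σ h := multPerm κ σ h
  graft ι {_ _ _ _ _ _ _ _ _ _ _ _} hg h := multComp A κ ι hg h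
  perm_one h x := by
    refine Prod.ext ((words G).perm_one h _) (funext fun s => ?_)
    ext z
    exact (multPerm_snd κ 1 1 h rfl s.hg s.hg (BlockPerm.one _) s.h x z).trans
      ((words G).perm_one _ _)
  perm_perm σ τ h h' h'' x := by
    refine Prod.ext ((words G).perm_perm σ τ h h' h'' _) (funext fun s => ?_)
    ext z
    obtain ⟨ρ, f, hρ, h₁, hf⟩ := exists_perm_graft τ h' s.hg
    obtain ⟨ρ', f', hρ', h₁', hf'⟩ := exists_perm_graft σ h h₁
    refine (multPerm_snd κ τ ρ h' hf h₁ s.hg hρ s.h _ z).trans ?_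
    rw [multPerm_snd κ σ ρ' h hf' h₁' h₁ hρ' s.h _ z]
    have h₂ : s.f = f' ∘ (ρ' * ρ : Equiv.Perm _) := by rw [hf, hf']; rfl
    refine ((words G).perm_perm _ _ _ _ h₂ _).trans
      (multPerm_snd κ (σ * τ) (ρ' * ρ) h'' h₂ h₁' s.hg ?_ s.h x z).symm
    exact BlockPerm.mul (τ := 1) (τ' := 1) hρ' hρ
  graft_perm ι {_ _ _ _ _ _ _ _ _ _ _ _ _ _} σ τ ρ hg hc hf hg' hρ h x y :=
    Prod.ext ((words G).graft_perm ι σ τ ρ hg hc hf hg' hρ h _ _)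
      (multGraft_perm A κ ι σ τ ρ hg hc hf hg' hρ h x y)
  graft_comm ι η {_ _ _ _ _ _ _ _ _ _ _ _ _ _ _ _ _ _ _ _ _ _ _ _ _} h₁ h₂ h₃ h₄ hs hs' d₁ d₂ d₃
      d₄ x y z :=
    multComp_comm A κ ι η h₁ h₂ h₃ h₄ hs hs' d₁ d₂ d₃ d₄ x y z
  graft_graft ι {_ _ _ _ _ _ _ _ _ _ _ _ _ _ _ _ _ _ _ _ _} h₁ h₂ hs d₁ d₂ x y z :=
    multComp_multComp A κ ι h₁ h₂ hs d₁ d₂ x y z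
  graft_one ι {_ _ _ _ a _ _ _ _ _ _ _} hg h hu x := by
    refine Prod.ext ((words G).graft_one ι hg h hu _) (funext fun s => ?_)
    ext z
    change multGraft A κ ι hg h x ((G ι).one hu) s z = 0
    obtain ⟨_, _, _, _, _, _, _, H⟩ | ⟨_, _, H⟩ | ⟨_, _, _, _, _, _, _, _, H⟩ :=
      multGraft_cases (a := a) A κ ι hg h s z <;>
      simp [H, (words G).graft_one]

theorem multModule_lift_fst {n : ℕ} {c : Fin n → C} {a : C} {p : ℤ} (x : (words G).X c a p) :
    ((multModule A κ).lift x).1 = x := by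
  induction x using words_induction with
  | zero => simp; rfl
  | add x y hx hy => rw [map_add]; exact congrArg₂ (· + ·) hx hy
  | smul s x hx => rw [map_smul]; exact congrArg (s • ·) hx
  | one hu => rfl
  | perm σ h x hx => rw [WordModule.lift_perm]; exact congrArg ((words G).perm σ h) hx
  | graft ι hg h x y hx =>
    rw [WordModule.lift_graft]
    exact congrArg (fun z => (words G).graft ι hg h z y) hx

end DgOperad

/-! ### Grafts with prescribed intermediate composites, and grafts of units -/

namespace ColoredOperad

variable {C : Type u} {m n l r r' v : ℕ} {i : Fin m} {a b b' : C} {c : Fin m → C} {e : Fin n → C}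
  {f : Fin r → C} {f' : Fin r' → C} {g : Fin l → C} {w : Fin v → C}

theorem IsGraft.assoc_right {j : Fin n} {s : Fin r} (h₁ : IsGraft i b c e f)
    (h₂ : IsGraft s b' f g w) (hs : InnerPos i j s) (h₃ : IsGraft j b' e g f') :
    IsGraft i b c f' w := by
  obtain ⟨f'', h₃', h₄⟩ := h₁.assoc h₂ hs
  obtain rfl : r' = n + l - 1 := by have := h₃.arity; omega
  rwa [h₃.eq h₃']

theorem IsGraft.comm_right {j : Fin m} {s : Fin r} {s' : Fin r'} (h₁ : IsGraft i b c e f)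
    (h₂ : IsGraft s b' f g w) (hs : OuterPos i n j s) (hs' : OuterPos j l i s')
    (h₃ : IsGraft j b' c g f') : IsGraft s' b f' e w := by
  obtain ⟨s'', f'', hs'', h₃', h₄⟩ := h₁.comm h₂ hs
  obtain rfl : r' = m + l - 1 := by have := h₃.arity; omega
  rwa [hs'.eq_right hs'', h₃.eq h₃']

theorem IsUnitPlace.eq_of_isGraft {q : ℤ} {f : Fin m → C} (hu : IsUnitPlace e b q)
    (hg : IsGraft i b c e f) : f = c := by
  obtain rfl := hu.1
  have key : ∀ s : Fin m, f s = c s := by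
    intro s
    by_cases hs : s = i
    · subst hs
      rw [hg.inner 0 s (by simp [InnerPos]), hu.2.1, hg.color]
    · have : (s : ℕ) ≠ i := fun h => hs (Fin.ext h)
      obtain h | h := lt_or_gt_of_ne this
      · exact hg.outer s s (Or.inl ⟨h, rfl⟩)
      · exact hg.outer s s (Or.inr ⟨h, rfl⟩)
  exact funext key

theorem IsGraft.perm_inner {τ : Equiv.Perm (Fin n)} {ρ : Equiv.Perm (Fin r)}
    (h : IsGraft i b c e f) (hρ : BlockPerm i 1 τ ρ) : IsGraft i b c (e ∘ τ) (f ∘ ρ) :=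
  IsGraft.perm (σ := 1) h hρ

end ColoredOperad

/-! ### Properties of the multiplication operators -/

namespace DgOperad

variable {k : Type u} [Field k] {C : Type u} {I : Type}

theorem comp_act_inner (P : DgOperad k C) {m n r : ℕ} {i : Fin m} {a b : C} {c : Fin m → C}
    {e : Fin n → C} {f : Fin r → C} {p q t : ℤ} (τ : Equiv.Perm (Fin n)) (ρ : Equiv.Perm (Fin r))
    (hg : IsGraft i b c e f) (hg' : IsGraft i b c (e ∘ τ) (f ∘ ρ)) (hρ : BlockPerm i 1 τ ρ)
    (h : p + q = t) (x : P.X c a p) (y : P.X e b q) :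
    P.comp hg' h x (P.act τ y) = P.act ρ (P.comp hg h x y) := by
  have := P.comp_act 1 τ ρ hg hg' hρ.outer hρ.inner h x y
  rw [P.act_one] at this
  exact this

namespace WordModule

variable {G : I → DgOperad k C} (Y : WordModule G)

theorem perm_congr {n : ℕ} {c f : Fin n → C} {a : C} {p : ℤ} {σ τ : Equiv.Perm (Fin n)}
    (h : f = c ∘ σ) (h' : f = c ∘ τ) (hσ : σ = τ) (x : Y.X c a p) :
    Y.perm σ h x = Y.perm τ h' x := by
  subst hσ
  rfl

theorem graft_congr (ι : I) {m n r : ℕ} {i i' : Fin m} {a b : C} {c : Fin m → C} {e : Fin n → C}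
    {f : Fin r → C} {p q t : ℤ} (hg : IsGraft i b c e f) (hg' : IsGraft i' b c e f)
    (hi : i = i') (h : p + q = t) (x : Y.X c a p) (y : (G ι).X e b q) :
    Y.graft ι hg h x y = Y.graft ι hg' h x y := by
  subst hi
  rfl

theorem graft_act (ι : I) {m n r : ℕ} {i : Fin m} {a b : C} {c : Fin m → C}
    {e : Fin n → C} {f f' : Fin r → C} {p q t : ℤ} (τ : Equiv.Perm (Fin n))
    (ρ : Equiv.Perm (Fin r)) (hg : IsGraft i b c e f) (hf : f' = f ∘ ρ)
    (hg' : IsGraft i b c (e ∘ τ) f') (hρ : BlockPerm i 1 τ ρ)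
    (h : p + q = t) (x : Y.X c a p) (y : (G ι).X e b q) :
    Y.graft ι hg' h x ((G ι).act τ y) = Y.perm ρ hf (Y.graft ι hg h x y) :=
  (congrArg (fun z => Y.graft ι hg' h z ((G ι).act τ y)) (Y.perm_one rfl x)).symm.trans
    (Y.graft_perm ι 1 τ ρ hg rfl hf hg' hρ h x y)

theorem graft_perm_left (ι : I) {m n r : ℕ} {i : Fin m} {a b : C} {c c' : Fin m → C}
    {e : Fin n → C} {f f' : Fin r → C} {p q t : ℤ} (σ : Equiv.Perm (Fin m))
    (ρ : Equiv.Perm (Fin r)) (hg : IsGraft (σ i) b c e f) (hc : c' = c ∘ σ) (hf : f' = f ∘ ρ)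
    (hg' : IsGraft i b c' e f') (hρ : BlockPerm i σ (1 : Equiv.Perm (Fin n)) ρ)
    (h : p + q = t) (x : Y.X c a p) (y : (G ι).X e b q) :
    Y.graft ι hg' h (Y.perm σ hc x) y = Y.perm ρ hf (Y.graft ι hg h x y) := by
  have := Y.graft_perm ι σ 1 ρ hg hc hf hg' hρ h x y
  rw [(G ι).act_one] at this
  exact this

end WordModule
variable {G : I → DgOperad k C} (A : ∀ ι, Augmentation (G ι)) (κ : I)

/-- The operators that multiply the element carrying an input by an element of `G κ`. -/
noncomputable def mult {m n r : ℕ} {i : Fin m} {a b : C} {c : Fin m → C}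
    {e : Fin n → C} {f : Fin r → C} {p q t : ℤ} (hg : IsGraft i b c e f) (h : p + q = t) :
    (words G).X c a p →ₗ[k] (G κ).X e b q →ₗ[k] (words G).X f a t :=
  LinearMap.proj (R := k)
    (φ := fun s : Slot c p => (G κ).X s.e s.b s.q →ₗ[k] (words G).X s.f a s.t) ⟨hg, h⟩ ∘ₗ
    LinearMap.snd k _ _ ∘ₗ (multModule A κ).lift

section mult

variable {m n l r r' v : ℕ} {i : Fin m} {s : Fin r} {a b b' : C}
    {c : Fin m → C} {e : Fin n → C} {g : Fin l → C} {f : Fin r → C} {f' : Fin r' → C}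
    {w : Fin v → C} {p q t pq qt pt pqt : ℤ}

-- A unit has no letter that could carry the input.
@[simp]
theorem mult_one (hg : IsGraft i b c e f) (h : p + q = t) (hu : IsUnitPlace c a p)
    (y : (G κ).X e b q) : mult A κ hg h ((words G).one hu) y = 0 := rfl

theorem mult_perm {c' : Fin m → C} {f' : Fin r → C} (σ : Equiv.Perm (Fin m))
    (ρ : Equiv.Perm (Fin r)) (hg : IsGraft (σ i) b c e f)
    (hc : c' = c ∘ σ) (hf : f' = f ∘ ρ) (hg' : IsGraft i b c' e f')
    (hρ : BlockPerm i σ (1 : Equiv.Perm (Fin n)) ρ) (h : p + q = t)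
    (x : (words G).X c a p) (y : (G κ).X e b q) :
    mult A κ hg' h ((words G).perm σ hc x) y = (words G).perm ρ hf (mult A κ hg h x y) :=
  (congrArg (fun z => z.2 ⟨hg', h⟩ y) ((multModule A κ).lift_perm σ hc x)).trans
    (multPerm_snd κ σ ρ hc hf hg hg' hρ h _ y)

theorem mult_graft_inner {j : Fin n} (h₁ : IsGraft i b c e f) (h₂ : IsGraft s b' f g w)
    (h₃ : IsGraft j b' e g f') (h₄ : IsGraft i b c f' w) (hs : InnerPos i j s)
    (d₁ : p + q = pq) (d₂ : pq + t = pqt) (d₃ : q + t = qt) (d₄ : p + qt = pqt)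
    (x : (words G).X c a p) (y : (G κ).X e b q) (z : (G κ).X g b' t) :
    mult A κ h₂ d₂ ((words G).graft κ h₁ d₁ x y) z =
      (words G).graft κ h₄ d₄ x ((G κ).comp h₃ d₃ ((A κ).bar y) ((A κ).bar z)) := by
  refine (congrArg (fun w => w.2 ⟨h₂, d₂⟩ z) ((multModule A κ).lift_graft κ h₁ d₁ x y)).trans ?_
  nth_rw 2 [← multModule_lift_fst A κ x]
  exact multGraft_inner A κ h₁ h₂ h₃ h₄ hs d₁ d₂ d₃ d₄ _ y z

theorem mult_graft_inner_ne {ι : I} (hι : κ ≠ ι) {j : Fin n} (h₁ : IsGraft i b c e f)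
    (h₂ : IsGraft s b' f g w) (hs : InnerPos i j s) (d₁ : p + q = pq) (d₂ : pq + t = pqt)
    (x : (words G).X c a p) (y : (G ι).X e b q) (z : (G κ).X g b' t) :
    mult A κ h₂ d₂ ((words G).graft ι h₁ d₁ x y) z = 0 :=
  (congrArg (fun w => w.2 ⟨h₂, d₂⟩ z) ((multModule A κ).lift_graft ι h₁ d₁ x y)).trans
    (multGraft_inner_ne A κ hι h₁ h₂ hs d₁ d₂ _ y z)

theorem mult_graft_outer (ι : I) {j : Fin m} {s' : Fin r'} (h₁ : IsGraft i b c e f)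
    (h₂ : IsGraft s b' f g w)
    (h₃ : IsGraft j b' c g f') (h₄ : IsGraft s' b f' e w) (hs : OuterPos i n j s)
    (hs' : OuterPos j l i s')
    (d₁ : p + q = pq) (d₂ : pq + t = pqt) (d₃ : p + t = pt) (d₄ : pt + q = pqt)
    (x : (words G).X c a p) (y : (G ι).X e b q) (z : (G κ).X g b' t) :
    mult A κ h₂ d₂ ((words G).graft ι h₁ d₁ x y) z =
      (-1 : k) ^ (q * t) • (words G).graft ι h₄ d₄ (mult A κ h₃ d₃ x z) y :=
  (congrArg (fun w => w.2 ⟨h₂, d₂⟩ z) ((multModule A κ).lift_graft ι h₁ d₁ x y)).trans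
    (multGraft_outer A κ ι h₁ h₂ h₃ h₄ hs hs' d₁ d₂ d₃ d₄ _ y z)

/-- Both sides act on the single letter that carries the input, where the claim is sequential
associativity in `G κ`. Letters passed on the way contribute signs with exponents that add up. -/
theorem mult_assoc {j : Fin n} (h₁ : IsGraft i b c e f) (h₂ : IsGraft s b' f g w)
    (h₃ : IsGraft j b' e g f') (h₄ : IsGraft i b c f' w) (hs : InnerPos i j s)
    (d₁ : p + q = pq) (d₂ : pq + t = pqt) (d₃ : q + t = qt) (d₄ : p + qt = pqt)
    (x : (words G).X c a p) (y : (G κ).X e b q) (z : (G κ).X g b' t) :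
    mult A κ h₂ d₂ (mult A κ h₁ d₁ x y) z =
      mult A κ h₄ d₄ x ((G κ).comp h₃ d₃ ((A κ).bar y) ((A κ).bar z)) := by
  induction x using words_induction generalizing r v s f w pq pqt with
  | zero => simp
  | add x x' hx hx' =>
    simp only [map_add, LinearMap.add_apply]
    rw [hx h₁ h₂ h₄ hs, hx' h₁ h₂ h₄ hs]
  | smul l x hx =>
    simp only [map_smul, LinearMap.smul_apply]
    rw [hx h₁ h₂ h₄ hs]
  | one hu => simp
  | perm σ hc x hx =>
    obtain ⟨ρ, f₀, hρ, h₁', hf⟩ := exists_perm_graft σ hc h₁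
    obtain ⟨ρ', w₀, hρ', h₂', hw⟩ := exists_perm_graft ρ hf h₂
    have h₄' := h₁'.assoc_right h₂' (hρ.inner _ _ hs) h₃
    rw [mult_perm A κ σ ρ h₁' hc hf h₁ hρ, mult_perm A κ ρ ρ' h₂' hf hw h₂ hρ',
      mult_perm A κ σ ρ' h₄' hc hw h₄
        (hρ.assoc h₁.arity h₂.arity h₃.arity hs (BlockPerm.one j) hρ'),
      hx h₁' h₂' h₄' (hρ.inner _ _ hs) d₁ d₂ d₄]
  | @graft ι m n₀ r₀ i₀ a b₀ c e₀ f₀ p₁ p₂ p hg h x u hx =>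
    obtain ⟨j₀, hj₀⟩ | ⟨i₁, hi₁⟩ := pos_cases hg.arity i₀ i
    · have := j₀.2
      have := hg.arity
      by_cases hι : κ = ι
      · subst hι
        obtain ⟨f₁, g₁, g₂⟩ := hg.assoc h₁ hj₀
        obtain ⟨j', hj'⟩ := exists_innerPos g₁.arity j₀ j
        have hs' : InnerPos i₀ j' s := by simp only [InnerPos] at *; omega
        obtain ⟨f₂, g₃, g₄⟩ := g₂.assoc h₂ hs'
        have g₅ := g₁.assoc_right g₃ hj' h₃
        rw [mult_graft_inner A κ hg h₁ g₁ g₂ hj₀ h d₁ rfl (by omega),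
          mult_graft_inner A κ g₂ h₂ g₃ g₄ hs' (by omega) d₂ rfl (by omega),
          mult_graft_inner A κ hg h₄ g₅ g₄ hj₀ h d₄ (show p₂ + qt = p₂ + q + t by omega) (by omega),
          (A κ).bar_comp_bar, (A κ).bar_comp_bar]
        congr 1
        exact (G κ).assoc g₁ g₃ h₃ g₅ hj' _ _ _ _ _ _ _
      · rw [mult_graft_inner_ne A κ hι hg h₁ hj₀, mult_graft_inner_ne A κ hι hg h₄ hj₀]
        simp
    · obtain ⟨s₁, f₁, hs₁, g₁, g₂⟩ := hg.comm h₁ hi₁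
      obtain ⟨s₂, hs₂⟩ := exists_innerPos g₁.arity i₁ j
      have hs₃ : OuterPos s₁ n₀ s₂ s := by
        have := j.2
        simp only [InnerPos, OuterPos, Fin.lt_def] at *; omega
      obtain ⟨s₄, f₂, hs₄, g₃, g₄⟩ := g₂.comm h₂ hs₃
      have g₅ := g₁.assoc_right g₃ hs₂ h₃
      have hs₅ : OuterPos i₁ r' i₀ s₄ := by
        have := j.2
        have := h₃.arity
        simp only [InnerPos, OuterPos, Fin.lt_def] at *; omega
      rw [mult_graft_outer A κ ι hg h₁ g₁ g₂ hi₁ hs₁ h d₁ rfl (by omega), map_smul,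
        LinearMap.smul_apply,
        mult_graft_outer A κ ι g₂ h₂ g₃ g₄ hs₃ hs₄ (by omega) d₂
          (show p₁ + q + t = p₁ + qt by omega) (by omega),
        mult_graft_outer A κ ι hg h₄ g₅ g₄ hi₁ hs₅ h d₄ rfl (by omega),
        hx g₁ g₃ g₅ hs₂ _ _ rfl, neg_one_zpow_smul_smul, ← mul_add, d₃]

theorem mult_act {f' : Fin r → C} (τ : Equiv.Perm (Fin n)) (ρ : Equiv.Perm (Fin r))
    (hg : IsGraft i b c e f)
    (hf : f' = f ∘ ρ) (hg' : IsGraft i b c (e ∘ τ) f')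
    (hρ : BlockPerm i 1 τ ρ) (h : p + q = t)
    (x : (words G).X c a p) (y : (G κ).X e b q) :
    mult A κ hg' h x ((G κ).act τ y) = (words G).perm ρ hf (mult A κ hg h x y) := by
  induction x using words_induction generalizing r f t with
  | zero => simp
  | add x x' hx hx' =>
    simp only [map_add, LinearMap.add_apply]
    rw [hx ρ hg hf hg' hρ, hx' ρ hg hf hg' hρ]
  | smul l x hx =>
    simp only [map_smul, LinearMap.smul_apply]
    rw [hx ρ hg hf hg' hρ]
  | one hu => simp
  | perm σ hc x hx =>
    obtain ⟨ρ₁, f₁, hρ₁, h₁, hf₁⟩ := exists_perm_graft σ hc hg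
    obtain ⟨ρ₂, f₂, hρ₂, h₂, hf₂⟩ := exists_perm_graft σ hc hg'
    obtain ⟨ρ₃, hρ₃⟩ := exists_blockPerm hg.arity (σ i) 1 τ
    -- Both products are the block permutation of the pair `(σ, τ)`, factored in two orders.
    have e₁ : ρ₃ * ρ₂ = ρ₁ * ρ :=
      (BlockPerm.mul (σ := 1) (τ' := 1) hρ₃ hρ₂).unique hg.arity (BlockPerm.mul (σ' := 1) (τ := 1) hρ₁ hρ)
    have e₂ : f' = f₁ ∘ (ρ₃ * ρ₂ : Equiv.Perm _) := by rw [e₁, hf, hf₁]; rfl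
    have e₃ : f₂ = f₁ ∘ ρ₃ := by
      have : f₂ ∘ ρ₂ = (f₁ ∘ ρ₃) ∘ ρ₂ := by rw [← hf₂, e₂]; rfl
      exact ρ₂.surjective.injective_comp_right this
    rw [mult_perm A κ σ ρ₂ h₂ hc hf₂ hg' hρ₂, mult_perm A κ σ ρ₁ h₁ hc hf₁ hg hρ₁,
      hx ρ₃ h₁ e₃ h₂ hρ₃, (words G).perm_perm _ _ _ _ e₂,
      (words G).perm_perm _ _ _ _ (e₂.trans (by rw [e₁]))]
    exact (words G).perm_congr _ _ e₁ _
  | @graft ι m n₀ r₀ i₀ a b₀ c e₀ f₀ p₁ p₂ p h₀ d₀ x u hx =>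
    obtain ⟨j₀, hj₀⟩ | ⟨i₁, hi₁⟩ := pos_cases h₀.arity i₀ i
    · by_cases hι : κ = ι
      · subst hι
        obtain ⟨f₁, g₁, g₂⟩ := h₀.assoc hg hj₀
        obtain ⟨ρ₁, hρ₁⟩ := exists_blockPerm g₁.arity j₀ 1 τ
        have hb : BlockPerm i₀ 1 ρ₁ ρ :=
          (BlockPerm.one i₀).assoc h₀.arity hg.arity g₁.arity hj₀ hρ₁ hρ
        subst hf
        rw [mult_graft_inner A κ h₀ hg g₁ g₂ hj₀ d₀ h rfl (by omega),
          mult_graft_inner A κ h₀ hg' (g₁.perm_inner hρ₁) (g₂.perm_inner hb) hj₀ d₀ h rfl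
            (by omega), (A κ).bar_act, (G κ).comp_act_inner τ ρ₁ g₁ (g₁.perm_inner hρ₁) hρ₁]
        exact (words G).graft_act κ ρ₁ ρ g₂ rfl _ hb _ _ _
      · rw [mult_graft_inner_ne A κ hι h₀ hg hj₀, mult_graft_inner_ne A κ hι h₀ hg' hj₀, map_zero]
    · obtain ⟨s₁, f₁, hs₁, g₁, g₂⟩ := h₀.comm hg hi₁
      obtain ⟨ρ₁, hρ₁⟩ := exists_blockPerm g₁.arity i₁ 1 τ
      have hb := (BlockPerm.one i₀).comm h₀.arity hg.arity g₁.arity hi₁ hs₁ hρ₁ hρ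
      have e₁ : ρ₁ s₁ = s₁ := (hρ₁.outer _ _ hs₁).eq_right hs₁
      have g₃ : IsGraft (ρ₁ s₁) b₀ f₁ e₀ f := by rwa [e₁]
      subst hf
      rw [mult_graft_outer A κ ι h₀ hg g₁ g₂ hi₁ hs₁ d₀ h rfl (by omega),
        mult_graft_outer A κ ι h₀ hg' (g₁.perm_inner hρ₁) (g₃.perm hb) hi₁ hs₁ d₀ h rfl
          (by omega), hx ρ₁ g₁ rfl (g₁.perm_inner hρ₁) hρ₁, map_smul,
        (words G).graft_congr ι g₂ g₃ e₁.symm]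
      congr 1
      exact (words G).graft_perm_left ι ρ₁ ρ g₃ rfl rfl _ hb _ _ _

/-- After a nonzero multiplication the input belongs to a letter of `G κ`, and another letter of `G
κ` grafted there gives zero. -/
theorem graft_mult {j : Fin n} (h₁ : IsGraft i b c e f) (h₂ : IsGraft s b' f g w)
    (hs : InnerPos i j s)
    (d₁ : p + q = pq) (d₂ : pq + t = pqt)
    (x : (words G).X c a p) (y : (G κ).X e b q) (z : (G κ).X g b' t) :
    (words G).graft κ h₂ d₂ (mult A κ h₁ d₁ x y) z = 0 := by
  induction x using words_induction generalizing r v s f w pq pqt with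
  | zero => simp
  | add x x' hx hx' =>
    simp only [map_add, LinearMap.add_apply]
    rw [hx h₁ h₂ hs, hx' h₁ h₂ hs, add_zero]
  | smul l x hx =>
    simp only [map_smul, LinearMap.smul_apply]
    rw [hx h₁ h₂ hs, smul_zero]
  | one hu => simp
  | perm σ hc x hx =>
    obtain ⟨ρ, f₀, hρ, h₁', hf⟩ := exists_perm_graft σ hc h₁
    obtain ⟨ρ', w₀, hρ', h₂', hw⟩ := exists_perm_graft ρ hf h₂
    rw [mult_perm A κ σ ρ h₁' hc hf h₁ hρ, (words G).graft_perm_left κ ρ ρ' h₂' hf hw h₂ hρ',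
      hx h₁' h₂' (hρ.inner _ _ hs) d₁ d₂, map_zero]
  | @graft ι m n₀ r₀ i₀ a b₀ c e₀ f₀ p₁ p₂ p hg h x u hx =>
    obtain ⟨j₀, hj₀⟩ | ⟨i₁, hi₁⟩ := pos_cases hg.arity i₀ i
    · have := j₀.2
      have := hg.arity
      by_cases hι : κ = ι
      · subst hι
        obtain ⟨f₁, g₁, g₂⟩ := hg.assoc h₁ hj₀
        obtain ⟨j', hj'⟩ := exists_innerPos g₁.arity j₀ j
        have hs' : InnerPos i₀ j' s := by simp only [InnerPos] at *; omega
        rw [mult_graft_inner A κ hg h₁ g₁ g₂ hj₀ h d₁ rfl (by omega),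
          (words G).graft_graft κ g₂ h₂ hs']
      · rw [mult_graft_inner_ne A κ hι hg h₁ hj₀]
        simp
    · obtain ⟨s₁, f₁, hs₁, g₁, g₂⟩ := hg.comm h₁ hi₁
      obtain ⟨s₂, hs₂⟩ := exists_innerPos g₁.arity i₁ j
      have hs₃ : OuterPos s₁ n₀ s₂ s := by
        have := j.2
        simp only [InnerPos, OuterPos, Fin.lt_def] at *; omega
      obtain ⟨s₄, f₂, hs₄, g₃, g₄⟩ := g₂.comm h₂ hs₃
      rw [mult_graft_outer A κ ι hg h₁ g₁ g₂ hi₁ hs₁ h d₁ rfl (by omega), map_smul,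
        LinearMap.smul_apply, (words G).graft_comm ι κ g₂ h₂ g₃ g₄ hs₃ hs₄ (by omega) d₂
          (show p₁ + q + t = p₁ + q + t by omega) (by omega), hx g₁ g₃ hs₂]
      simp

/-- At the letter that carries the input, this is the Leibniz rule of `G κ`. The projections to the
augmentation ideal do not interfere, as the differential kills units and takes values in the ideal.
-/
theorem wordsD_mult {p' q' t' : ℤ} (hg : IsGraft i b c e f) (h : p + q = t)
    (ht : t' + 1 = t) (hp : p' + 1 = p) (hq : q' + 1 = q) (h₁ : p' + q = t') (h₂ : p + q' = t')
    (x : (words G).X c a p) (y : (G κ).X e b q) :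
    wordsD G ht (mult A κ hg h x y) =
      mult A κ hg h₁ (wordsD G hp x) y +
        (-1 : k) ^ p • mult A κ hg h₂ x ((G κ).d hq y) := by
  induction x using words_induction generalizing r f t p' t' with
  | zero => simp
  | add x x' hx hx' =>
    simp only [map_add, LinearMap.add_apply, smul_add]
    rw [hx hg h ht hp h₁ h₂, hx' hg h ht hp h₁ h₂]
    abel
  | smul l x hx =>
    simp only [map_smul, LinearMap.smul_apply]
    rw [hx hg h ht hp h₁ h₂, smul_add, smul_comm l]
  | one hu => simp
  | perm σ hc x hx =>
    obtain ⟨ρ, f₀, hρ, hg', hf⟩ := exists_perm_graft σ hc hg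
    rw [mult_perm A κ σ ρ hg' hc hf hg hρ, wordsD_perm, hx hg' h ht hp h₁ h₂, wordsD_perm,
      mult_perm A κ σ ρ hg' hc hf hg hρ, mult_perm A κ σ ρ hg' hc hf hg hρ, map_add, map_smul]
  | @graft ι m n₀ r₀ i₀ a b₀ c e₀ f₀ p₁ p₂ p h₀ d₀ x u hx =>
    have k₁ := wordsD_graft ι h₀ d₀ hp (sub_add_cancel p₁ 1) (sub_add_cancel p₂ 1)
      (by omega) (by omega) x u
    obtain ⟨j₀, hj₀⟩ | ⟨i₁, hi₁⟩ := pos_cases h₀.arity i₀ i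
    · by_cases hι : κ = ι
      · subst hι
        obtain ⟨f₁, g₁, g₂⟩ := h₀.assoc hg hj₀
        rw [k₁, map_add, LinearMap.add_apply, map_smul, LinearMap.smul_apply,
          mult_graft_inner A κ h₀ hg g₁ g₂ hj₀ d₀ h rfl (by omega),
          mult_graft_inner A κ h₀ hg g₁ g₂ hj₀ (by omega) h₁ rfl (by omega),
          mult_graft_inner A κ h₀ hg g₁ g₂ hj₀ (by omega) h₁
            (show p₂ - 1 + q = p₂ + q - 1 by omega) (by omega),
          mult_graft_inner A κ h₀ hg g₁ g₂ hj₀ d₀ h₂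
            (show p₂ + q' = p₂ + q - 1 by omega) (by omega),
          wordsD_graft κ g₂ _ ht (sub_add_cancel p₁ 1) (sub_add_cancel (p₂ + q) 1)
            (by omega) (by omega), (G κ).d_comp g₁ rfl (sub_add_cancel p₂ 1) hq
              (sub_add_cancel _ 1) (by omega) (by omega), (A κ).d_bar, (A κ).d_bar, (A κ).bar_d,
            (A κ).bar_d, map_add, map_smul, smul_add, neg_one_zpow_smul_smul, add_assoc]
        congr 3
        rw [d₀]
      · rw [k₁, map_add, LinearMap.add_apply, map_smul, LinearMap.smul_apply,
          mult_graft_inner_ne A κ hι h₀ hg hj₀, mult_graft_inner_ne A κ hι h₀ hg hj₀,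
          mult_graft_inner_ne A κ hι h₀ hg hj₀, mult_graft_inner_ne A κ hι h₀ hg hj₀]
        simp
    · obtain ⟨s₁, f₁, hs₁, g₁, g₂⟩ := h₀.comm hg hi₁
      rw [k₁, map_add, LinearMap.add_apply, map_smul, LinearMap.smul_apply,
        mult_graft_outer A κ ι h₀ hg g₁ g₂ hi₁ hs₁ d₀ h rfl (by omega),
        mult_graft_outer A κ ι h₀ hg g₁ g₂ hi₁ hs₁ (by omega) h₁
          (show p₁ - 1 + q = p₁ + q - 1 by omega) (by omega),
        mult_graft_outer A κ ι h₀ hg g₁ g₂ hi₁ hs₁ (by omega) h₁ rfl (by omega),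
        mult_graft_outer A κ ι h₀ hg g₁ g₂ hi₁ hs₁ d₀ h₂
          (show p₁ + q' = p₁ + q - 1 by omega) (by omega), map_smul,
        wordsD_graft ι g₂ _ ht (sub_add_cancel (p₁ + q) 1) (sub_add_cancel p₂ 1)
          (by omega) (by omega),
        hx g₁ rfl (sub_add_cancel _ 1) (sub_add_cancel p₁ 1) (by omega) (by omega)]
      simp only [map_add, LinearMap.add_apply, map_smul, LinearMap.smul_apply, smul_add,
        neg_one_zpow_smul_smul]
      have e₁ : (-1 : k) ^ (p + p₂ * q') = (-1) ^ (p₂ * q + p₁) :=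
        neg_one_zpow_eq ⟨0, by subst hq d₀; ring⟩
      have e₂ : (-1 : k) ^ (p₁ + (p₂ - 1) * q) = (-1) ^ (p₂ * q + (p₁ + q)) :=
        neg_one_zpow_eq ⟨-q, by ring⟩
      rw [e₁, e₂]
      abel

end mult

end DgOperad

/-! ### Grafts of units and on units -/

namespace ColoredOperad

variable {C : Type u} {m n r : ℕ} {i : Fin m} {a b : C} {c : Fin m → C} {e : Fin n → C}
  {f : Fin r → C}

theorem IsUnitPlace.arity_right {q : ℤ} (hu : IsUnitPlace e b q) (hg : IsGraft i b c e f) :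
    m = r := by
  have := hu.1
  have := hg.arity
  omega

theorem IsUnitPlace.arity_left {p : ℤ} (hu : IsUnitPlace c a p) (hg : IsGraft i b c e f) :
    n = r := by
  have := hu.1
  have := hg.arity
  omega

theorem IsUnitPlace.heq_of_isGraft {q : ℤ} (hu : IsUnitPlace e b q) (hg : IsGraft i b c e f) :
    HEq c f := by
  obtain rfl := hu.arity_right hg
  rw [hu.eq_of_isGraft hg]

theorem IsUnitPlace.eq_of_isGraft_left {f : Fin n → C} {p : ℤ} (hu : IsUnitPlace c a p)
    (hg : IsGraft i b c e f) : f = e := by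
  obtain rfl := hu.1
  funext s
  exact hg.inner s s (by simp [InnerPos])

end ColoredOperad

/-! ### Commutation of multiplications at different inputs -/

namespace DgOperad

variable {k : Type u} [Field k] {C : Type u} {I : Type}
variable {G : I → DgOperad k C} (A : ∀ ι, Augmentation (G ι)) (κ ι : I)

section mult

variable {m n l r r' v : ℕ} {i j : Fin m} {s : Fin r} {s' : Fin r'} {a b b' : C}
    {c : Fin m → C} {e : Fin n → C} {g : Fin l → C} {f : Fin r → C} {f' : Fin r' → C}
    {w : Fin v → C} {p q t pq pt pqt : ℤ}

/-- The last letter `u` carries the first input. If it also carries the second, either all three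
operads agree and parallel associativity applies, or both sides vanish; if not, the second
multiplication passes `u`. -/
theorem mult_comm_graft_inner (η : I) {m₀ n₀ : ℕ} {i₀ : Fin m₀} {c₀ : Fin m₀ → C}
    {e₀ : Fin n₀ → C} {b₀ : C} {p₁ p₂ : ℤ} (hg : IsGraft i₀ b₀ c₀ e₀ c) (h : p₁ + p₂ = p)
    (h₁ : IsGraft i b c e f) (h₂ : IsGraft s b' f g w)
    (h₃ : IsGraft j b' c g f') (h₄ : IsGraft s' b f' e w)
    (hs : OuterPos i n j s) (hs' : OuterPos j l i s')
    (d₁ : p + q = pq) (d₂ : pq + t = pqt) (d₃ : p + t = pt) (d₄ : pt + q = pqt)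
    (x : (words G).X c₀ a p₁) (u : (G η).X e₀ b₀ p₂) (y : (G ι).X e b q) (z : (G κ).X g b' t)
    (i' : Fin n₀) (hi : InnerPos i₀ i' i) :
    mult A κ h₂ d₂ (mult A ι h₁ d₁ ((words G).graft η hg h x u) y) z =
      (-1 : k) ^ (q * t) • mult A ι h₄ d₄ (mult A κ h₃ d₃ ((words G).graft η hg h x u) z) y := by
  have := i'.2
  have hgr := hg.arity
  obtain ⟨f₁, g₁, g₂⟩ := hg.assoc h₁ hi
  obtain ⟨j', hj⟩ | ⟨j', hj⟩ := pos_cases hg.arity i₀ j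
  · have := j'.2
    have hne : j' ≠ i' := by
      rintro rfl
      exact hs.ne (hj.eq_right hi)
    obtain ⟨F₁, k₁, k₂⟩ := hg.assoc h₃ hj
    obtain ⟨S, hS⟩ := exists_outerPos g₁.arity hne
    obtain ⟨S', hS'⟩ := exists_outerPos k₁.arity hne.symm
    have hs₁ : InnerPos i₀ S s := by simp only [OuterPos, InnerPos, Fin.lt_def] at *; omega
    have hs₂ : InnerPos i₀ S' s' := by simp only [OuterPos, InnerPos, Fin.lt_def] at *; omega
    obtain ⟨F, g₃, g₄⟩ := g₂.assoc h₂ hs₁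
    have k₃ := g₁.comm_right g₃ hS hS' k₁
    by_cases hκ : κ = η
    · subst hκ
      by_cases hι : ι = κ
      · subst hι
        rw [mult_graft_inner A ι hg h₁ g₁ g₂ hi h d₁ rfl (by omega),
          mult_graft_inner A ι hg h₃ k₁ k₂ hj h d₃ rfl (by omega),
          mult_graft_inner A ι g₂ h₂ g₃ g₄ hs₁ _ d₂ rfl (by omega),
          mult_graft_inner A ι k₂ h₄ k₃ g₄ hs₂ _ d₄ (show p₂ + t + q = p₂ + q + t by omega)
            (by omega), (A ι).bar_comp_bar, (A ι).bar_comp_bar, ← map_smul]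
        congr 1
        exact (G ι).comm g₁ g₃ k₁ k₃ hS hS' _ _ _ _ _ _ _
      · rw [mult_graft_inner_ne A ι hι hg h₁ hi,
          mult_graft_inner A κ hg h₃ k₁ k₂ hj h d₃ rfl (by omega),
          mult_graft_inner_ne A ι hι k₂ h₄ hs₂]
        simp
    · rw [mult_graft_inner_ne A κ hκ hg h₃ hj]
      by_cases hι : ι = η
      · subst hι
        rw [mult_graft_inner A ι hg h₁ g₁ g₂ hi h d₁ rfl (by omega),
          mult_graft_inner_ne A κ hκ g₂ h₂ hs₁]
        simp
      · rw [mult_graft_inner_ne A ι hι hg h₁ hi]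
        simp
  · obtain ⟨s₁, f₁', hs₁, q₁, q₂⟩ := hg.comm h₃ hj
    have hs₂ : InnerPos s₁ i' s' := by simp only [OuterPos, InnerPos, Fin.lt_def] at *; omega
    have hs₃ : OuterPos i₀ (n₀ + n - 1) j' s := by
      simp only [OuterPos, InnerPos, Fin.lt_def] at *; omega
    have q₃ := g₂.comm_right h₂ hs₃ hs₁ q₁
    rw [mult_graft_outer A κ η hg h₃ q₁ q₂ hj hs₁ h d₃ rfl (by omega), map_smul,
      LinearMap.smul_apply]
    by_cases hι : ι = η
    · subst hι
      rw [mult_graft_inner A ι hg h₁ g₁ g₂ hi h d₁ rfl (by omega),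
        mult_graft_outer A κ ι g₂ h₂ q₁ q₃ hs₃ hs₁ _ d₂ rfl (by omega),
        mult_graft_inner A ι q₂ h₄ g₁ q₃ hs₂ _ d₄ rfl (by omega), neg_one_zpow_smul_smul]
      exact neg_one_zpow_smul_congr ⟨0, by ring⟩ rfl
    · rw [mult_graft_inner_ne A ι hι hg h₁ hi, mult_graft_inner_ne A ι hι q₂ h₄ hs₂]
      simp

theorem mult_comm
    (h₁ : IsGraft i b c e f) (h₂ : IsGraft s b' f g w)
    (h₃ : IsGraft j b' c g f') (h₄ : IsGraft s' b f' e w)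
    (hs : OuterPos i n j s) (hs' : OuterPos j l i s')
    (d₁ : p + q = pq) (d₂ : pq + t = pqt) (d₃ : p + t = pt) (d₄ : pt + q = pqt)
    (x : (words G).X c a p) (y : (G ι).X e b q) (z : (G κ).X g b' t) :
    mult A κ h₂ d₂ (mult A ι h₁ d₁ x y) z =
      (-1 : k) ^ (q * t) • mult A ι h₄ d₄ (mult A κ h₃ d₃ x z) y := by
  induction x using words_induction generalizing r r' v s s' f f' w pq pt pqt with
  | zero => simp
  | add x x' hx hx' =>
    simp only [map_add, LinearMap.add_apply]
    rw [hx h₁ h₂ h₃ h₄ hs hs' d₁ d₂ d₃ d₄, hx' h₁ h₂ h₃ h₄ hs hs' d₁ d₂ d₃ d₄, smul_add]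
  | smul l x hx =>
    simp only [map_smul, LinearMap.smul_apply]
    rw [hx h₁ h₂ h₃ h₄ hs hs' d₁ d₂ d₃ d₄, smul_comm]
  | one hu => simp
  | perm σ hc x hx =>
    obtain ⟨ρ, f₀, hρ, h₁', hf⟩ := exists_perm_graft σ hc h₁
    obtain ⟨ρ', w₀, hρ', h₂', hw⟩ := exists_perm_graft ρ hf h₂
    obtain ⟨ρ₃, f₃, hρ₃, h₃', hf₃⟩ := exists_perm_graft σ hc h₃
    have hs₁ := hρ.outer _ _ hs
    have hs₁' := hρ₃.outer _ _ hs'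
    have h₄' := h₁'.comm_right h₂' hs₁ hs₁' h₃'
    have hb : BlockPerm s' ρ₃ (1 : Equiv.Perm (Fin n)) ρ' :=
      hρ.comm h₁.arity h₂.arity h₃.arity hs hs' hρ₃ hρ'
    rw [mult_perm A ι σ ρ h₁' hc hf h₁ hρ, mult_perm A κ ρ ρ' h₂' hf hw h₂ hρ',
      mult_perm A κ σ ρ₃ h₃' hc hf₃ h₃ hρ₃, mult_perm A ι ρ₃ ρ' h₄' hf₃ hw h₄ hb,
      hx h₁' h₂' h₃' h₄' hs₁ hs₁' d₁ d₂ d₃ d₄, map_smul]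
  | @graft η m n₀ r₀ i₀ a b₀ c e₀ f₀ p₁ p₂ p hg h x u hx =>
    obtain ⟨i', hi⟩ | ⟨i₁, hi⟩ := pos_cases hg.arity i₀ i
    · exact mult_comm_graft_inner A κ ι η hg h h₁ h₂ h₃ h₄ hs hs' d₁ d₂ d₃ d₄ x u y z i' hi
    obtain ⟨j', hj⟩ | ⟨j₁, hj⟩ := pos_cases hg.arity i₀ j
    -- The roles of the two inputs are exchanged; the resulting sign is its own inverse.
    · rw [mult_comm_graft_inner A ι κ η hg h h₃ h₄ h₁ h₂ hs' hs d₃ d₄ d₁ d₂ x u z y j' hj,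
        mul_comm, neg_one_zpow_smul_self]
    have hne : j₁ ≠ i₁ := by
      rintro rfl
      exact hs.ne (hj.eq_right hi)
    obtain ⟨s₁, f₁, hs₁, g₁, g₂⟩ := hg.comm h₁ hi
    obtain ⟨S, hS⟩ := exists_outerPos g₁.arity hne
    have hs₂ := hs₁.comm hi hS hj hs
    obtain ⟨t₂, f₂, ht₂, g₃, g₄⟩ := g₂.comm h₂ hs₂
    obtain ⟨s₃, f₃, hs₃, k₁, k₂⟩ := hg.comm h₃ hj
    obtain ⟨S', hS'⟩ := exists_outerPos k₁.arity hne.symm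
    have hs₄ := hs₃.comm hj hS' hi hs'
    have k₃ := g₁.comm_right g₃ hS hS' k₁
    have hs₅ := hS'.comm hS hs₃ hs₁ ht₂
    rw [mult_graft_outer A ι η hg h₁ g₁ g₂ hi hs₁ h d₁ rfl (by omega), map_smul,
      LinearMap.smul_apply, mult_graft_outer A κ η g₂ h₂ g₃ g₄ hs₂ ht₂ _ d₂ rfl (by omega),
      mult_graft_outer A κ η hg h₃ k₁ k₂ hj hs₃ h d₃ rfl (by omega), map_smul,
      LinearMap.smul_apply, mult_graft_outer A ι η k₂ h₄ k₃ g₄ hs₄ hs₅ _ d₄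
        (show p₁ + t + q = p₁ + q + t by omega) (by omega),
      hx g₁ g₃ k₁ k₃ hS hS' rfl rfl rfl (show p₁ + t + q = p₁ + q + t by omega), map_smul,
      LinearMap.smul_apply]
    simp only [neg_one_zpow_smul_smul]
    exact neg_one_zpow_smul_congr ⟨0, by ring⟩ rfl

end mult

/-! ### The right action of an augmented operad on words -/

/-- Transport of words along equalities of the input colors and degrees. -/
def wordsCast {m r : ℕ} {a : C} {c : Fin m → C} {f : Fin r → C} {p t : ℤ} (hm : m = r)
    (hc : HEq c f) (hp : p = t) : (words G).X c a p →ₗ[k] (words G).X f a t := by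
  subst hm hp
  obtain rfl := eq_of_heq hc
  exact LinearMap.id

open Classical in
/-- Grafting a multiple of the unit. -/
noncomputable def graftUnit (G : I → DgOperad k C) {m n r : ℕ} {i : Fin m} {a b : C}
    {c : Fin m → C}
    {e : Fin n → C} {f : Fin r → C} {p q t : ℤ} (hg : IsGraft i b c e f) (h : p + q = t) :
    (words G).X c a p →ₗ[k] unitX k e b q →ₗ[k] (words G).X f a t :=
  if hu : IsUnitPlace e b q then
    LinearMap.flip (LinearMap.lsmul k _ ∘ₗ (unitX k e b q).subtype) ∘ₗ
      wordsCast (hu.arity_right hg) (hu.heq_of_isGraft hg) (by have := hu.2.2; omega)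
  else 0

/-- The right action of elements of `G κ` on words. -/
noncomputable def op {m n r : ℕ} {i : Fin m} {a b : C} {c : Fin m → C}
    {e : Fin n → C} {f : Fin r → C} {p q t : ℤ} (hg : IsGraft i b c e f) (h : p + q = t) :
    (words G).X c a p →ₗ[k] (G κ).X e b q →ₗ[k] (words G).X f a t :=
  -- For an element of the augmentation ideal acting on a single word, at most one of the first two
  -- terms survives: the product if the input lies on a letter of `G κ`, and the graft otherwise.
  -- The last term handles the unit part.
  (words G).graft κ hg h + mult A κ hg h + (graftUnit G hg h).compl₂ (A κ).eps

section op

variable {m n l r r' v : ℕ} {i j : Fin m} {s : Fin r} {s' : Fin r'} {a b b' : C}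
    {c : Fin m → C} {e : Fin n → C} {g : Fin l → C} {f : Fin r → C} {f' : Fin r' → C}
    {w : Fin v → C} {p q t pq qt pt pqt : ℤ}

theorem mult_bar (hg : IsGraft i b c e f) (h : p + q = t) (x : (words G).X c a p)
    (y : (G κ).X e b q) : mult A κ hg h x ((A κ).bar y) = mult A κ hg h x y := by
  induction x using words_induction generalizing r f t with
  | zero => simp
  | add x x' hx hx' =>
    simp only [map_add, LinearMap.add_apply]
    rw [hx hg h, hx' hg h]
  | smul l x hx =>
    simp only [map_smul, LinearMap.smul_apply]
    rw [hx hg h]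
  | one hu => simp
  | perm σ hc x hx =>
    obtain ⟨ρ, f₀, hρ, h', hf⟩ := exists_perm_graft σ hc hg
    rw [mult_perm A κ σ ρ h' hc hf hg hρ, mult_perm A κ σ ρ h' hc hf hg hρ, hx h' h]
  | @graft ι m n₀ r₀ i₀ a b₀ c e₀ f₀ p₁ p₂ p h₀ d₀ x u hx =>
    obtain ⟨j₀, hj₀⟩ | ⟨i₁, hi₁⟩ := pos_cases h₀.arity i₀ i
    · by_cases hι : κ = ι
      · subst hι
        obtain ⟨f₁, g₁, g₂⟩ := h₀.assoc hg hj₀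
        rw [mult_graft_inner A κ h₀ hg g₁ g₂ hj₀ d₀ h rfl (by omega),
          mult_graft_inner A κ h₀ hg g₁ g₂ hj₀ d₀ h rfl (by omega), (A κ).bar_bar]
      · rw [mult_graft_inner_ne A κ hι h₀ hg hj₀, mult_graft_inner_ne A κ hι h₀ hg hj₀]
    · obtain ⟨s₁, f₁, hs₁, g₁, g₂⟩ := h₀.comm hg hi₁
      rw [mult_graft_outer A κ ι h₀ hg g₁ g₂ hi₁ hs₁ d₀ h rfl (by omega),
        mult_graft_outer A κ ι h₀ hg g₁ g₂ hi₁ hs₁ d₀ h rfl (by omega), hx]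

/-- Grafting and multiplication both annihilate units, and the augmentation term acts as the
identity. -/
theorem op_one {c : Fin m → C} (hg : IsGraft i b c e c) (h : p + q = p) (hu : IsUnitPlace e b q)
    (x : (words G).X c a p) : op A κ hg h x ((G κ).one hu) = x := by
  simp only [op, LinearMap.add_apply, LinearMap.compl₂_apply, (words G).graft_one]
  rw [← mult_bar, (A κ).bar_one, map_zero, zero_add, zero_add, (A κ).eps_one, graftUnit,
    dif_pos hu]
  exact one_smul k x

theorem op_of_eps (hg : IsGraft i b c e f) (h : p + q = t) (x : (words G).X c a p)
    {y : (G κ).X e b q} (hy : (A κ).eps y = 0) :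
    op A κ hg h x y = (words G).graft κ hg h x y + mult A κ hg h x y := by
  simp [op, hy]

/-- For units it is the unit law. On the augmentation ideal, a graft after a graft or after a
multiplication vanishes, while a multiplication after either one gives the corresponding term for
the product. -/
theorem op_assoc {j : Fin n} (h₁ : IsGraft i b c e f) (h₂ : IsGraft s b' f g w)
    (h₃ : IsGraft j b' e g f') (h₄ : IsGraft i b c f' w) (hs : InnerPos i j s)
    (d₁ : p + q = pq) (d₂ : pq + t = pqt) (d₃ : q + t = qt) (d₄ : p + qt = pqt)
    (x : (words G).X c a p) (y : (G κ).X e b q) (z : (G κ).X g b' t) :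
    op A κ h₂ d₂ (op A κ h₁ d₁ x y) z = op A κ h₄ d₄ x ((G κ).comp h₃ d₃ y z) := by
  induction y using (A κ).induction with
  | add y y' hy hy' => simp only [map_add, LinearMap.add_apply, hy, hy']
  | smul l y hy => simp only [map_smul, LinearMap.smul_apply, hy]
  | one hu =>
    obtain rfl := hu.arity_right h₁
    obtain rfl := hu.eq_of_isGraft h₁
    obtain rfl := hu.arity_left h₃
    obtain rfl := hu.eq_of_isGraft_left h₃
    obtain rfl := hu.1
    have hq := hu.2.2
    obtain rfl : pq = p := by omega
    obtain rfl : qt = t := by omega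
    obtain rfl : s = i := by
      have := j.2
      simp only [InnerPos, Fin.ext_iff] at *; omega
    obtain rfl : b' = b := by rw [← h₃.color, hu.2.1]
    rw [op_one, (G κ).one_comp]
  | bar y hy =>
    induction z using (A κ).induction with
    | add z z' hz hz' => simp only [map_add, hz, hz']
    | smul l z hz => simp only [map_smul, hz]
    | one hu =>
      obtain rfl := hu.arity_right h₂
      obtain rfl := hu.eq_of_isGraft h₂
      obtain rfl := hu.arity_right h₃
      obtain rfl := hu.eq_of_isGraft h₃
      have hq := hu.2.2
      obtain rfl : pqt = pq := by omega
      obtain rfl : qt = q := by omega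
      rw [op_one, (G κ).comp_one]
    | bar z hz =>
      have hyz : (A κ).eps ((G κ).comp h₃ d₃ y z) = 0 := by
        rw [(A κ).eps_comp, hy, map_zero, LinearMap.zero_apply]
      rw [op_of_eps A κ h₁ d₁ x hy, op_of_eps A κ h₂ d₂ _ hz, op_of_eps A κ h₄ d₄ x hyz]
      simp only [map_add, LinearMap.add_apply]
      rw [(words G).graft_graft κ h₁ h₂ hs, graft_mult A κ h₁ h₂ hs,
        mult_assoc A κ h₁ h₂ h₃ h₄ hs d₁ d₂ d₃ d₄,
        mult_graft_inner A κ h₁ h₂ h₃ h₄ hs d₁ d₂ d₃ d₄, (A κ).bar_of_eps hy,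
        (A κ).bar_of_eps hz]
      simp

/-- On the augmentation ideal, grafts commute with grafts by `graft_comm`, multiplications with
multiplications by `mult_comm`, and the mixed terms are exchanged by `mult_graft_outer`. -/
theorem op_comm
    (h₁ : IsGraft i b c e f) (h₂ : IsGraft s b' f g w)
    (h₃ : IsGraft j b' c g f') (h₄ : IsGraft s' b f' e w)
    (hs : OuterPos i n j s) (hs' : OuterPos j l i s')
    (d₁ : p + q = pq) (d₂ : pq + t = pqt) (d₃ : p + t = pt) (d₄ : pt + q = pqt)
    (x : (words G).X c a p) (y : (G ι).X e b q) (z : (G κ).X g b' t) :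
    op A κ h₂ d₂ (op A ι h₁ d₁ x y) z =
      (-1 : k) ^ (q * t) • op A ι h₄ d₄ (op A κ h₃ d₃ x z) y := by
  induction y using (A ι).induction with
  | add y y' hy hy' => simp only [map_add, LinearMap.add_apply, hy, hy', smul_add]
  | smul l y hy =>
    simp only [map_smul, LinearMap.smul_apply, hy]
    rw [smul_comm]
  | one hu =>
    obtain rfl := hu.arity_right h₁
    obtain rfl := hu.eq_of_isGraft h₁
    obtain rfl := hu.arity_right h₄
    obtain rfl := hu.eq_of_isGraft h₄
    obtain rfl := hu.1
    have hq := hu.2.2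
    subst hq
    obtain rfl : pq = p := by omega
    obtain rfl : pqt = pt := by omega
    obtain rfl : s = j := by
      simp only [OuterPos, Fin.lt_def, Fin.ext_iff] at *; omega
    rw [op_one, op_one, zero_mul, zpow_zero, one_smul]
  | bar y hy =>
    induction z using (A κ).induction with
    | add z z' hz hz' => simp only [map_add, LinearMap.add_apply, hz, hz', smul_add]
    | smul l z hz =>
      simp only [map_smul, LinearMap.smul_apply, hz]
      rw [smul_comm]
    | one hu =>
      obtain rfl := hu.arity_right h₂
      obtain rfl := hu.eq_of_isGraft h₂
      obtain rfl := hu.arity_right h₃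
      obtain rfl := hu.eq_of_isGraft h₃
      obtain rfl := hu.1
      have hq := hu.2.2
      subst hq
      obtain rfl : pt = p := by omega
      obtain rfl : pqt = pq := by omega
      obtain rfl : s' = i := by
        simp only [OuterPos, Fin.lt_def, Fin.ext_iff] at *; omega
      rw [op_one, op_one, mul_zero, zpow_zero, one_smul]
    | bar z hz =>
      rw [op_of_eps A ι h₁ d₁ x hy, op_of_eps A κ h₂ d₂ _ hz, op_of_eps A κ h₃ d₃ x hz,
        op_of_eps A ι h₄ d₄ _ hy]
      simp only [map_add, LinearMap.add_apply]
      rw [(words G).graft_comm ι κ h₁ h₂ h₃ h₄ hs hs' d₁ d₂ d₃ d₄,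
        mult_comm A κ ι h₁ h₂ h₃ h₄ hs hs' d₁ d₂ d₃ d₄,
        mult_graft_outer A κ ι h₁ h₂ h₃ h₄ hs hs' d₁ d₂ d₃ d₄,
        mult_graft_outer A ι κ h₃ h₄ h₁ h₂ hs' hs d₃ d₄ d₁ d₂]
      simp only [smul_add]
      rw [mul_comm t q, neg_one_zpow_smul_self]
      abel

theorem op_perm {c' : Fin m → C} {f' : Fin r → C} (σ : Equiv.Perm (Fin m))
    (τ : Equiv.Perm (Fin n)) (ρ : Equiv.Perm (Fin r)) (hg : IsGraft (σ i) b c e f)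
    (hc : c' = c ∘ σ) (hf : f' = f ∘ ρ) (hg' : IsGraft i b c' (e ∘ τ) f')
    (hρ : BlockPerm i σ τ ρ) (h : p + q = t)
    (x : (words G).X c a p) (y : (G κ).X e b q) :
    op A κ hg' h ((words G).perm σ hc x) ((G κ).act τ y) =
      (words G).perm ρ hf (op A κ hg h x y) := by
  induction y using (A κ).induction with
  | add y y' hy hy' => simp only [map_add, hy, hy']
  | smul l y hy => simp only [map_smul, hy]
  | one hu =>
    have hu' := (isUnitPlace_perm τ).2 hu
    obtain rfl := hu.arity_right hg
    obtain rfl := hu.eq_of_isGraft hg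
    obtain rfl := hu'.eq_of_isGraft hg'
    obtain rfl := hu.1
    have hq := hu.2.2
    subst hq
    obtain rfl : t = p := by omega
    rw [act_one' (G κ) τ hu hu', op_one, op_one]
    -- Inserting a unit does not change positions, so the block permutation is `σ` itself.
    refine (words G).perm_congr _ _ (BlockPerm.unique hg.arity ⟨fun j s hs => ?_, fun j s hs => ?_⟩ hρ) _
    · obtain rfl : j = s := by simp only [OuterPos, Fin.lt_def, Fin.ext_iff] at *; omega
      have : (σ j : ℕ) ≠ σ i := fun h => hs.ne (σ.injective (Fin.ext h))
      obtain h | h := lt_or_gt_of_ne this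
      · exact Or.inl ⟨h, rfl⟩
      · exact Or.inr ⟨h, rfl⟩
    · obtain rfl : i = s := by
        have := j.2
        simp only [InnerPos, Fin.ext_iff] at *; omega
      simp [InnerPos]
  | bar y hy =>
    have hy' : (A κ).eps ((G κ).act τ y) = 0 := by rw [(A κ).eps_act, hy, map_zero]
    obtain ⟨ρ₁, f₁, hρ₁, h₁, hf₁⟩ := exists_perm_graft (e := e ∘ τ) σ hc hg'
    obtain ⟨ρ₂, hρ₂⟩ := exists_blockPerm hg.arity (σ i) 1 τ
    -- The block permutation is factored into its parts for `τ` and for `σ`, which `mult_act` and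
    -- `mult_perm` treat separately.
    have e₁ : ρ₂ * ρ₁ = ρ := (BlockPerm.mul (σ := 1) (τ' := 1) hρ₂ hρ₁).unique hg.arity hρ
    have e₂ : f₁ = f ∘ ρ₂ := by
      have : f₁ ∘ ρ₁ = (f ∘ ρ₂) ∘ ρ₁ := by rw [← hf₁, hf, ← e₁]; rfl
      exact ρ₁.surjective.injective_comp_right this
    rw [op_of_eps A κ hg' h _ hy', op_of_eps A κ hg h x hy, map_add,
      (words G).graft_perm κ σ τ ρ hg hc hf hg' hρ, mult_perm A κ σ ρ₁ h₁ hc hf₁ hg' hρ₁,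
      mult_act A κ τ ρ₂ hg e₂ h₁ hρ₂, (words G).perm_perm ρ₂ ρ₁ _ _ (by rw [e₁, hf]),
      (words G).perm_congr _ hf e₁]

theorem wordsD_op {p' q' t' : ℤ} (hg : IsGraft i b c e f) (h : p + q = t)
    (ht : t' + 1 = t) (hp : p' + 1 = p) (hq : q' + 1 = q) (h₁ : p' + q = t') (h₂ : p + q' = t')
    (x : (words G).X c a p) (y : (G κ).X e b q) :
    wordsD G ht (op A κ hg h x y) =
      op A κ hg h₁ (wordsD G hp x) y + (-1 : k) ^ p • op A κ hg h₂ x ((G κ).d hq y) := by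
  induction y using (A κ).induction with
  | add y y' hy hy' =>
    simp only [map_add, hy, hy', smul_add]
    abel
  | smul l y hy =>
    simp only [map_smul, hy, smul_add]
    rw [smul_comm l]
  | one hu =>
    obtain rfl := hu.arity_right hg
    obtain rfl := hu.eq_of_isGraft hg
    have hq := hu.2.2
    subst hq
    obtain rfl : t = p := by omega
    obtain rfl : t' = p' := by omega
    rw [op_one, op_one, (G κ).d_one, map_zero, smul_zero, add_zero]
  | bar y hy =>
    rw [op_of_eps A κ hg h x hy, op_of_eps A κ hg h₁ _ hy,
      op_of_eps A κ hg h₂ x ((A κ).eps_d hq y), map_add,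
      wordsD_graft κ hg h ht hp hq h₁ h₂, wordsD_mult A κ hg h ht hp hq h₁ h₂, smul_add]
    abel

end op

end DgOperad

/-! ### Rebracketing nested grafts -/

namespace ColoredOperad

variable {C : Type u} {m n l r r' v : ℕ} {i : Fin m} {a b b' : C} {c : Fin m → C} {e : Fin n → C}
  {f : Fin r → C} {f' : Fin r' → C} {g : Fin l → C} {w : Fin v → C}

/-- Allows the insertion of a composite to be carried out in two stages, outer part first; this is
how families of operations are composed. -/
theorem IsGraft.exists_of_assoc {j : Fin n} (h₃ : IsGraft j b' e g f')
    (h₄ : IsGraft i b c f' w) :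
    ∃ (s : Fin (m + n - 1)) (f : Fin (m + n - 1) → C), InnerPos i j s ∧ IsGraft i b c e f ∧
      IsGraft s b' f g w := by
  have := j.2
  have := i.2
  have a₃ := h₃.arity
  have a₄ := h₄.arity
  have hr : m + n = m + n - 1 + 1 := by omega
  obtain ⟨s, hs⟩ := exists_innerPos hr i j
  obtain ⟨f, hf⟩ := IsGraft.exists_of_color hr h₄.color e
  obtain ⟨w', hw'⟩ := IsGraft.exists_of_color (i := s) (c := f) (r := v) (by omega)
    ((hf.inner j s hs).trans h₃.color) g
  obtain rfl := (hf.assoc_right hw' hs h₃).eq h₄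
  exact ⟨s, f, hs, hf, hw'⟩

theorem IsGraft.exists_perm_inner {f' : Fin r → C} (τ : Equiv.Perm (Fin n))
    (h : IsGraft i b c (e ∘ τ) f') :
    ∃ (ρ : Equiv.Perm (Fin r)) (f : Fin r → C), BlockPerm i 1 τ ρ ∧ IsGraft i b c e f ∧
      f' = f ∘ ρ := by
  obtain ⟨ρ, hρ⟩ := exists_blockPerm h.arity i 1 τ
  obtain ⟨f, hf, hf'⟩ := h.perm_right (σ := 1) (c := c) rfl rfl hρ
  exact ⟨ρ, f, hρ, hf, hf'⟩

end ColoredOperad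

namespace DgOperad

variable {k : Type u} [Field k] {C : Type u} {I : Type}

/-! ### Operations on words -/

/-- The data for inserting something of input colors `e`, output color `b` and degree `q` into an
input of something else. -/
structure Insertion {n : ℕ} (e : Fin n → C) (b : C) (q : ℤ) where
  {m r : ℕ}
  {i : Fin m}
  {a : C}
  {c : Fin m → C}
  {f : Fin r → C}
  {p t : ℤ}
  hg : IsGraft i b c e f
  h : p + q = t

/-- Families of linear maps on words that have the shape of the insertion of an element of input
colors `e`, output color `b` and degree `q`. -/
def OpX (G : I → DgOperad k C) {n : ℕ} (e : Fin n → C) (b : C) (q : ℤ) : Type u :=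
  ∀ s : Insertion e b q, (words G).X s.c s.a s.p →ₗ[k] (words G).X s.f s.a s.t

variable {G : I → DgOperad k C}

instance {n : ℕ} (e : Fin n → C) (b : C) (q : ℤ) : AddCommGroup (OpX G e b q) :=
  inferInstanceAs (AddCommGroup (∀ s : Insertion e b q, _))

instance {n : ℕ} (e : Fin n → C) (b : C) (q : ℤ) : Module k (OpX G e b q) :=
  inferInstanceAs (Module k (∀ s : Insertion e b q, _))

namespace OpX

variable {m n l r r' v : ℕ} {i j : Fin m} {s : Fin r} {s' : Fin r'} {a b b' : C}
    {c : Fin m → C} {e : Fin n → C} {g : Fin l → C} {f : Fin r → C} {f' : Fin r' → C}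
    {w : Fin v → C} {p q t pq qt pt pqt : ℤ}

/-- The map of a family at an input. -/
def ap (φ : OpX G e b q) (hg : IsGraft i b c e f) (h : p + q = t) :
    (words G).X c a p →ₗ[k] (words G).X f a t :=
  φ { a := a, hg := hg, h := h }

@[simp]
theorem ap_zero (hg : IsGraft i b c e f) (h : p + q = t) (x : (words G).X c a p) :
    (0 : OpX G e b q).ap hg h x = 0 := rfl

@[simp]
theorem ap_add (φ ψ : OpX G e b q) (hg : IsGraft i b c e f) (h : p + q = t)
    (x : (words G).X c a p) : (φ + ψ).ap hg h x = φ.ap hg h x + ψ.ap hg h x := rfl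

@[simp]
theorem ap_smul (l : k) (φ : OpX G e b q) (hg : IsGraft i b c e f) (h : p + q = t)
    (x : (words G).X c a p) : (l • φ).ap hg h x = l • φ.ap hg h x := rfl

theorem ext {φ ψ : OpX G e b q}
    (H : ∀ {m r : ℕ} {i : Fin m} {a : C} {c : Fin m → C} {f : Fin r → C} {p t : ℤ}
      (hg : IsGraft i b c e f) (h : p + q = t) (x : (words G).X c a p),
      φ.ap hg h x = ψ.ap hg h x) : φ = ψ :=
  funext fun s => LinearMap.ext fun x => H s.hg s.h x

/-- The identity family. -/
def one (hu : IsUnitPlace e b q) : OpX G e b q := fun s =>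
  wordsCast (hu.arity_right s.hg) (hu.heq_of_isGraft s.hg) (by have := hu.2.2; have := s.h; omega)

theorem ap_one {c : Fin m → C} (hu : IsUnitPlace e b q) (hg : IsGraft i b c e c) (h : p + q = p)
    (x : (words G).X c a p) : (one hu).ap hg h x = x := rfl

/-- Inserting into the `j`th input of what is inserted. -/
noncomputable def comp {j : Fin n} (h₃ : IsGraft j b' e g f') (d₃ : q + t = qt) :
    OpX G e b q →ₗ[k] OpX G g b' t →ₗ[k] OpX G f' b qt :=
  LinearMap.mk₂ k
    (fun φ ψ s =>
      ψ.ap (h₃.exists_of_assoc s.hg).choose_spec.choose_spec.2.2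
        (by have := s.h; omega) ∘ₗ φ.ap (h₃.exists_of_assoc s.hg).choose_spec.choose_spec.2.1 rfl)
    (fun φ φ' ψ => funext fun s => LinearMap.ext fun x =>
      LinearMap.map_add (ψ.ap _ _) (φ.ap _ _ x) (φ'.ap _ _ x))
    (fun l φ ψ => funext fun s => LinearMap.ext fun x =>
      LinearMap.map_smul (ψ.ap _ _) l (φ.ap _ _ x))
    (fun φ ψ ψ' => rfl)
    (fun l φ ψ => rfl)

/-- The intermediate position and colors are unique, so the definition by choice agrees with any
two-stage insertion. -/
theorem ap_comp {j : Fin n} (h₁ : IsGraft i b c e f) (h₂ : IsGraft s b' f g w)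
    (h₃ : IsGraft j b' e g f') (h₄ : IsGraft i b c f' w) (hs : InnerPos i j s)
    (d₁ : p + q = pq) (d₂ : pq + t = pqt) (d₃ : q + t = qt) (d₄ : p + qt = pqt)
    (φ : OpX G e b q) (ψ : OpX G g b' t) (x : (words G).X c a p) :
    (comp h₃ d₃ φ ψ).ap h₄ d₄ x = ψ.ap h₂ d₂ (φ.ap h₁ d₁ x) := by
  obtain rfl : r = m + n - 1 := by have := h₁.arity; omega
  have H := (h₃.exists_of_assoc h₄).choose_spec.choose_spec
  obtain rfl := hs.eq_right H.1
  obtain rfl := h₁.eq H.2.1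
  subst d₁
  rfl

/-- The action of a permutation of the inputs of what is inserted. -/
noncomputable def act (τ : Equiv.Perm (Fin n)) : OpX G e b q →ₗ[k] OpX G (e ∘ τ) b q where
  toFun φ s := (words G).perm _ (s.hg.exists_perm_inner τ).choose_spec.choose_spec.2.2 ∘ₗ
    φ.ap (s.hg.exists_perm_inner τ).choose_spec.choose_spec.2.1 s.h
  map_add' φ ψ := funext fun s => LinearMap.ext fun x =>
    LinearMap.map_add ((words G).perm _ _) (φ.ap _ _ x) (ψ.ap _ _ x)
  map_smul' l φ := funext fun s => LinearMap.ext fun x =>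
    LinearMap.map_smul ((words G).perm _ _) l (φ.ap _ _ x)

theorem ap_act {f' : Fin r → C} {τ : Equiv.Perm (Fin n)} {ρ : Equiv.Perm (Fin r)}
    (hg : IsGraft i b c e f) (hf : f' = f ∘ ρ) (hg' : IsGraft i b c (e ∘ τ) f')
    (hρ : BlockPerm i 1 τ ρ) (h : p + q = t) (φ : OpX G e b q) (x : (words G).X c a p) :
    (act τ φ).ap hg' h x = (words G).perm ρ hf (φ.ap hg h x) := by
  have H := (hg'.exists_perm_inner τ).choose_spec.choose_spec
  obtain rfl := hρ.unique hg.arity H.1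
  obtain rfl := hg.eq H.2.1
  rfl

/-- The differential. -/
noncomputable def d {q' : ℤ} (hq : q' + 1 = q) : OpX G e b q →ₗ[k] OpX G e b q' where
  -- The Leibniz rule for `x ↦ x ∘ y`, solved for `x ∘ dy`.
  toFun φ s := (-1 : k) ^ s.p • (wordsD G rfl ∘ₗ φ.ap s.hg (by have := s.h; omega) -
    φ.ap s.hg (by have := s.h; omega) ∘ₗ wordsD G (sub_add_cancel s.p 1))
  map_add' φ ψ := funext fun s => LinearMap.ext fun x => by
    change (-1 : k) ^ s.p • (wordsD G (rfl : s.t + 1 = s.t + 1) (φ.ap _ _ x + ψ.ap _ _ x) - (φ.ap _ _ _ + ψ.ap _ _ _)) =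
      (-1 : k) ^ s.p • (wordsD G (rfl : s.t + 1 = s.t + 1) (φ.ap _ _ x) - φ.ap _ _ _) +
        (-1 : k) ^ s.p • (wordsD G (rfl : s.t + 1 = s.t + 1) (ψ.ap _ _ x) - ψ.ap _ _ _)
    rw [map_add, ← smul_add]
    congr 1
    abel
  map_smul' l φ := funext fun s => LinearMap.ext fun x => by
    change (-1 : k) ^ s.p • (wordsD G (rfl : s.t + 1 = s.t + 1) (l • φ.ap _ _ x) - l • φ.ap _ _ _) =
      l • (-1 : k) ^ s.p • (wordsD G (rfl : s.t + 1 = s.t + 1) (φ.ap _ _ x) - φ.ap _ _ _)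
    rw [map_smul, ← smul_sub, smul_comm]

theorem ap_d {p' q' t' : ℤ} (hg : IsGraft i b c e f) (h : p + q = t) (ht : t' + 1 = t)
    (hp : p' + 1 = p) (hq : q' + 1 = q) (h₁ : p' + q = t') (h₂ : p + q' = t')
    (φ : OpX G e b q) (x : (words G).X c a p) :
    (d hq φ).ap hg h₂ x =
      (-1 : k) ^ p • (wordsD G ht (φ.ap hg h x) - φ.ap hg h₁ (wordsD G hp x)) := by
  subst ht
  obtain rfl : p' = p - 1 := by omega
  rfl

theorem d_d {q' q'' : ℤ} (hq : q' + 1 = q) (hq' : q'' + 1 = q') (φ : OpX G e b q) :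
    d hq' (d hq φ) = 0 := by
  refine ext fun {m r i a c f p t} hg h x => ?_
  rw [ap_d hg (t := t + 1) (by omega) rfl (sub_add_cancel p 1) hq' (by omega),
    ap_d hg (t := t + 1 + 1) (by omega) rfl (sub_add_cancel p 1) hq (by omega),
    ap_d hg (t := t + 1) (by omega) rfl (sub_add_cancel (p - 1) 1) hq (by omega),
    wordsD_wordsD, neg_one_zpow_succ (sub_add_cancel p 1)]
  simp [wordsD_wordsD]

theorem d_act {q' : ℤ} (hq : q' + 1 = q) (τ : Equiv.Perm (Fin n)) (φ : OpX G e b q) :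
    d hq (act τ φ) = act τ (d hq φ) := by
  refine ext fun {m r i a c f p t} hg h x => ?_
  obtain ⟨ρ, f₀, hρ, hg', hf⟩ := hg.exists_perm_inner τ
  rw [ap_d hg (t := t + 1) (by omega) rfl (sub_add_cancel p 1) hq (by omega),
    ap_act hg' hf hg hρ, ap_act hg' hf hg hρ, ap_act hg' hf hg hρ, wordsD_perm,
    ap_d hg' (t := t + 1) (by omega) rfl (sub_add_cancel p 1) hq (by omega), map_smul, map_sub]

theorem d_one {q' : ℤ} (hq : q' + 1 = q) (hu : IsUnitPlace e b q) :
    d hq (one hu : OpX G e b q) = 0 := by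
  refine ext fun {m r i a c f p t} hg h x => ?_
  obtain rfl := hu.arity_right hg
  obtain rfl := hu.eq_of_isGraft hg
  have hq := hu.2.2
  obtain rfl : t = p - 1 := by omega
  rw [ap_d hg (t := p) (by omega) (sub_add_cancel p 1) (sub_add_cancel p 1) _ (by omega),
    ap_one, ap_one, sub_self, smul_zero]
  rfl

/-- In the commutator with the composite, the terms with the differential between the two maps
cancel. The sign appears because the second map acts on a word whose degree has grown by `q`. -/
theorem d_comp {j : Fin n} {q' t' qt' : ℤ} (h₃ : IsGraft j b' e g f') (d₃ : q + t = qt)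
    (hq : q' + 1 = q) (ht : t' + 1 = t) (hqt : qt' + 1 = qt) (h₁ : q' + t = qt')
    (h₂ : q + t' = qt') (φ : OpX G e b q) (ψ : OpX G g b' t) :
    d hqt (comp h₃ d₃ φ ψ) = comp h₃ h₁ (d hq φ) ψ + (-1 : k) ^ q • comp h₃ h₂ φ (d ht ψ) := by
  refine ext fun {m r i a c f p u} hg h x => ?_
  obtain ⟨s, f₀, hs, g₁, g₂⟩ := h₃.exists_of_assoc hg
  rw [ap_d hg (t := u + 1) (by omega) rfl (sub_add_cancel p 1) hqt (by omega), ap_add, ap_smul,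
    ap_comp g₁ g₂ h₃ hg hs rfl (by omega) d₃, ap_comp g₁ g₂ h₃ hg hs (show p - 1 + q = p + q' by omega) (by omega) d₃,
    ap_comp g₁ g₂ h₃ hg hs rfl (by omega) h₁, ap_comp g₁ g₂ h₃ hg hs rfl (by omega) h₂,
    ap_d g₁ (t := p + q) (by omega) (by omega) (sub_add_cancel p 1) hq (by omega),
    ap_d g₂ (t := u + 1) (by omega) rfl (t' := u) (show p + q' + 1 = p + q by omega) ht
      (by omega) , map_smul, map_sub]
  rw [neg_one_zpow_smul_smul, neg_one_zpow_smul_congr (a := q + (p + q)) (b := p)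
    ⟨q, by ring⟩ rfl, ← smul_add]
  congr 1
  abel

theorem act_one (φ : OpX G e b q) : act 1 φ = φ := by
  refine ext fun {m r i a c f p t} hg h x => ?_
  exact (ap_act (ρ := 1) hg rfl hg (BlockPerm.one i) h φ x).trans ((words G).perm_one _ _)

theorem act_mul (σ τ : Equiv.Perm (Fin n)) (φ : OpX G e b q) :
    act (σ * τ) φ = act τ (act σ φ) := by
  refine ext fun {m r i a c f p t} hg h x => ?_
  obtain ⟨ρ, f₁, hρ, g₁, hf₁⟩ := IsGraft.exists_perm_inner (e := e ∘ σ) τ hg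
  obtain ⟨ρ', f₂, hρ', g₂, hf₂⟩ := g₁.exists_perm_inner σ
  have hf : f = f₂ ∘ (ρ' * ρ : Equiv.Perm (Fin r)) := by rw [hf₁, hf₂]; rfl
  refine (ap_act g₂ hf hg (BlockPerm.mul (σ := 1) (σ' := 1) hρ' hρ) h φ x).trans ?_
  refine Eq.trans ?_ (ap_act g₁ hf₁ hg hρ h (act σ φ) x).symm
  rw [ap_act g₂ hf₂ g₁ hρ', (words G).perm_perm _ _ _ _ hf]

theorem one_comp {j : Fin n} {g : Fin l → C} (h₃ : IsGraft j b' e g g) (h : q + t = t)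
    (hu : IsUnitPlace e b' q) (φ : OpX G g b' t) : comp h₃ h (one hu) φ = φ := by
  refine ext fun {m r i a c f p u} hg hh x => ?_
  obtain ⟨s, f₀, hs, g₁, g₂⟩ := h₃.exists_of_assoc hg
  rw [ap_comp g₁ g₂ h₃ hg hs rfl (by have := hu.2.2; omega) h]
  obtain rfl := hu.1
  obtain rfl := hu.eq_of_isGraft g₁
  have hq := hu.2.2
  subst hq
  obtain rfl : i = s := by
    have := j.2
    simp only [InnerPos, Fin.ext_iff] at *; omega
  -- The intermediate degree `p + 0` is replaced by a variable, so that it can be identified with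
  -- `p` by substitution.
  have key : ∀ {y : ℤ} (hy : p + 0 = y) (hy' : y + t = u),
      φ.ap g₂ hy' ((one hu).ap g₁ hy x) = φ.ap hg hh x := by
    rintro y hy hy'
    obtain rfl : y = p := by omega
    rfl
  exact key _ _

theorem comp_one {j : Fin n} {g : Fin l → C} (h₃ : IsGraft j b' e g e) (h : q + t = q)
    (hu : IsUnitPlace g b' t) (φ : OpX G e b q) : comp h₃ h φ (one hu) = φ := by
  refine ext fun {m r i a c f p u} hg hh x => ?_
  obtain ⟨s, f₀, hs, g₁, g₂⟩ := h₃.exists_of_assoc hg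
  rw [ap_comp g₁ g₂ h₃ hg hs rfl (by omega) h]
  obtain rfl := hu.arity_right g₂
  obtain rfl := hu.eq_of_isGraft g₂
  obtain rfl : t = 0 := by omega
  subst hh
  rfl

theorem assoc {n₁ n₂ n₃ n₄ n₅ n₆ : ℕ} {i : Fin n₁} {j : Fin n₂} {s : Fin n₄} {a b b' : C}
    {c : Fin n₁ → C} {e : Fin n₂ → C} {g : Fin n₃ → C} {f : Fin n₄ → C} {f' : Fin n₅ → C}
    {w : Fin n₆ → C} {p q t pq qt pqt : ℤ}
    (h₁ : IsGraft i b c e f) (h₂ : IsGraft s b' f g w)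
    (h₃ : IsGraft j b' e g f') (h₄ : IsGraft i b c f' w) (hs : InnerPos i j s)
    (d₁ : p + q = pq) (d₂ : pq + t = pqt) (d₃ : q + t = qt) (d₄ : p + qt = pqt)
    (φ : OpX G c a p) (ψ : OpX G e b q) (χ : OpX G g b' t) :
    comp h₂ d₂ (comp h₁ d₁ φ ψ) χ = comp h₄ d₄ φ (comp h₃ d₃ ψ χ) := by
  refine ext fun {m r i₀ a₀ c₀ f₀ p₀ u} hg hh x => ?_
  obtain ⟨s₁, f₁, hs₁, g₁, g₂⟩ := h₂.exists_of_assoc hg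
  obtain ⟨s₂, f₂, hs₂, g₃, g₄⟩ := h₁.exists_of_assoc g₁
  obtain ⟨s₃, f₃, hs₃, g₅, g₆⟩ := h₄.exists_of_assoc hg
  obtain rfl := g₃.eq g₅
  obtain rfl := hs₂.eq_right hs₃
  rw [ap_comp g₁ g₂ h₂ hg hs₁ rfl (by omega) d₂, ap_comp g₃ g₄ h₁ g₁ hs₂ rfl (by omega) d₁,
    ap_comp g₃ g₆ h₄ hg hs₂ rfl (by omega) d₄, ap_comp g₄ g₂ h₃ g₆
      (by simp only [InnerPos] at *; omega)
      (show p₀ + p + q = p₀ + pq by omega) (by omega) d₃]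

end OpX

end DgOperad

/-! ### Grafts on the unit -/

namespace ColoredOperad

variable {C : Type u} {n : ℕ}

theorem isGraft_unit (e : Fin n → C) (b : C) : IsGraft (0 : Fin 1) b (fun _ => b) e e :=
  ⟨add_comm 1 n, rfl, fun j s hs => (hs.ne (Subsingleton.elim _ _)).elim, fun j s hs => by
    rw [show s = j from Fin.ext (by simpa [InnerPos] using hs)]⟩

theorem isUnitPlace_const (b : C) : IsUnitPlace (fun _ : Fin 1 => b) b 0 :=
  ⟨rfl, fun _ => rfl, rfl⟩

theorem blockPerm_unit (τ : Equiv.Perm (Fin n)) : BlockPerm (0 : Fin 1) 1 τ τ :=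
  ⟨fun j s hs => (hs.ne (Subsingleton.elim _ _)).elim, fun j s hs => by
    rw [show s = j from Fin.ext (by simpa [InnerPos] using hs)]
    simp [InnerPos]⟩

end ColoredOperad

/-! ### Equivariant and commuting families of operations -/

namespace DgOperad

variable {k : Type u} [Field k] {C : Type u} {I : Type} {G : I → DgOperad k C}

namespace OpX

variable {m n l r r' v : ℕ} {i j : Fin m} {s : Fin r} {s' : Fin r'} {a b b' : C}
    {c : Fin m → C} {e : Fin n → C} {g : Fin l → C} {f : Fin r → C} {f' : Fin r' → C}
    {w : Fin v → C} {p q t pq qt pt pqt : ℤ}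

/-- The family commutes with the permutations of the inputs of the word. -/
def Equi (φ : OpX G e b q) : Prop :=
  ∀ {m r : ℕ} {i : Fin m} {a : C} {c c' : Fin m → C} {f f' : Fin r → C} {p t : ℤ}
    (σ : Equiv.Perm (Fin m)) (ρ : Equiv.Perm (Fin r)) (hg : IsGraft (σ i) b c e f)
    (hc : c' = c ∘ σ) (hf : f' = f ∘ ρ) (hg' : IsGraft i b c' e f')
    (_ : BlockPerm i σ (1 : Equiv.Perm (Fin n)) ρ) (h : p + q = t) (x : (words G).X c a p),
    φ.ap hg' h ((words G).perm σ hc x) = (words G).perm ρ hf (φ.ap hg h x)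

/-- The two families commute when applied at different inputs. -/
def Comm (φ : OpX G e b q) (ψ : OpX G g b' t) : Prop :=
  ∀ {m r r' v : ℕ} {i j : Fin m} {s : Fin r} {s' : Fin r'} {a : C} {c : Fin m → C}
    {f : Fin r → C} {f' : Fin r' → C} {w : Fin v → C} {p pq pt pqt : ℤ}
    (h₁ : IsGraft i b c e f) (h₂ : IsGraft s b' f g w)
    (h₃ : IsGraft j b' c g f') (h₄ : IsGraft s' b f' e w)
    (_ : OuterPos i n j s) (_ : OuterPos j l i s')
    (d₁ : p + q = pq) (d₂ : pq + t = pqt) (d₃ : p + t = pt) (d₄ : pt + q = pqt)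
    (x : (words G).X c a p),
    ψ.ap h₂ d₂ (φ.ap h₁ d₁ x) = (-1 : k) ^ (q * t) • φ.ap h₄ d₄ (ψ.ap h₃ d₃ x)

theorem Comm.symm {φ : OpX G e b q} {ψ : OpX G g b' t} (h : Comm φ ψ) : Comm ψ φ := by
  intro m r r' v i j s s' a c f f' w p pq pt pqt h₁ h₂ h₃ h₄ hs hs' d₁ d₂ d₃ d₄ x
  rw [h h₃ h₄ h₁ h₂ hs' hs d₃ d₄ d₁ d₂, mul_comm t q, neg_one_zpow_smul_self]

theorem Equi.one (hu : IsUnitPlace e b q) : Equi (one hu : OpX G e b q) := by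
  intro m r i a c c' f f' p t σ ρ hg hc hf hg' hρ h x
  obtain rfl := hu.arity_right hg
  obtain rfl := hu.eq_of_isGraft hg
  obtain rfl := hu.eq_of_isGraft hg'
  obtain rfl := hu.1
  have hq := hu.2.2
  subst hq
  obtain rfl : t = p := by omega
  rw [ap_one, ap_one]
  refine (words G).perm_congr _ _
    (BlockPerm.unique hg.arity ⟨fun j s hs => ?_, fun j s hs => ?_⟩ hρ) _
  · obtain rfl : j = s := by simp only [OuterPos, Fin.lt_def, Fin.ext_iff] at *; omega
    have : (σ j : ℕ) ≠ σ i := fun h => hs.ne (σ.injective (Fin.ext h))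
    obtain h | h := lt_or_gt_of_ne this
    · exact Or.inl ⟨h, rfl⟩
    · exact Or.inr ⟨h, rfl⟩
  · obtain rfl : i = s := by
      have := j.2
      simp only [InnerPos, Fin.ext_iff] at *; omega
    simp [InnerPos]

theorem Equi.act {φ : OpX G e b q} (H : Equi φ) (τ : Equiv.Perm (Fin n)) : Equi (act τ φ) := by
  intro m r i a c c' f f' p t σ ρ hg hc hf hg' hρ h x
  obtain ⟨ρ₁, f₁, hρ₁, g₁, hf₁⟩ := hg.exists_perm_inner τ
  obtain ⟨ρ₂, f₂, hρ₂, g₂, hf₂⟩ := hg'.exists_perm_inner τ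
  obtain ⟨ρ₃, f₃, hρ₃, g₃, hf₃⟩ := exists_perm_graft σ hc g₂
  obtain rfl := g₁.eq g₃
  have e₁ : ρ₁ * ρ = ρ₃ * ρ₂ :=
    BlockPerm.unique hg.arity (BlockPerm.mul (σ := 1) (τ' := 1) hρ₁ hρ)
      (BlockPerm.mul (σ' := 1) (τ := 1) hρ₃ hρ₂)
  rw [ap_act g₂ hf₂ hg' hρ₂, H σ ρ₃ g₃ hc hf₃ g₂ hρ₃, ap_act g₁ hf₁ hg hρ₁,
    (words G).perm_perm ρ₃ ρ₂ _ _ (by rw [hf₂, hf₃]; rfl),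
    (words G).perm_perm ρ₁ ρ _ _ (by rw [hf, hf₁]; rfl)]
  exact (words G).perm_congr _ _ e₁.symm _

theorem Equi.comp {j : Fin n} {φ : OpX G e b q} {ψ : OpX G g b' t} (H : Equi φ) (H' : Equi ψ)
    (h₃ : IsGraft j b' e g f') (d₃ : q + t = qt) : Equi (comp h₃ d₃ φ ψ) := by
  intro m r i a c c' f f' p u σ ρ hg hc hf hg' hρ h x
  obtain ⟨s, f₁, hs, g₁, g₂⟩ := h₃.exists_of_assoc hg'
  obtain ⟨ρ₁, f₂, hρ₁, g₃, hf₂⟩ := exists_perm_graft σ hc g₁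
  obtain ⟨ρ₂, f₃, hρ₂, g₄, hf₃⟩ := exists_perm_graft ρ₁ hf₂ g₂
  have hs' := hρ₁.inner _ _ hs
  have hb := BlockPerm.assoc g₃.arity g₄.arity h₃.arity hs hρ₁ (BlockPerm.one j) hρ₂
  obtain rfl := hb.unique hg.arity hρ
  obtain rfl := (g₃.assoc_right g₄ hs' h₃).eq hg
  rw [ap_comp g₁ g₂ h₃ hg' hs rfl (by omega) d₃, H σ ρ₁ g₃ hc hf₂ g₁ hρ₁,
    H' ρ₁ ρ₂ g₄ hf₂ hf g₂ hρ₂, ap_comp g₃ g₄ h₃ hg hs' rfl (by omega) d₃]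

theorem Comm.one (hu : IsUnitPlace e b q) (ψ : OpX G g b' t) :
    Comm (one hu : OpX G e b q) ψ := by
  intro m r r' v i j s s' a c f f' w p pq pt pqt h₁ h₂ h₃ h₄ hs hs' d₁ d₂ d₃ d₄ x
  obtain rfl := hu.arity_right h₁
  obtain rfl := hu.eq_of_isGraft h₁
  obtain rfl := hu.arity_right h₄
  obtain rfl := hu.eq_of_isGraft h₄
  obtain rfl := hu.1
  have hq := hu.2.2
  subst hq
  obtain rfl : pq = p := by omega
  obtain rfl : pqt = pt := by omega
  obtain rfl : s = j := by
    simp only [OuterPos, Fin.lt_def, Fin.ext_iff] at *; omega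
  rw [ap_one, ap_one, zero_mul, zpow_zero, one_smul]

/-- Equivariance of `ψ` is needed because `ψ` is applied to a word on which the permutation has
already acted. -/
theorem Comm.act {φ : OpX G e b q} {ψ : OpX G g b' t} (H : Comm φ ψ) (H' : Equi ψ)
    (τ : Equiv.Perm (Fin n)) : Comm (act τ φ) ψ := by
  intro m r r' v i j s s' a c f f' w p pq pt pqt h₁ h₂ h₃ h₄ hs hs' d₁ d₂ d₃ d₄ x
  obtain ⟨ρ, f₀, hρ, g₁, hf⟩ := h₁.exists_perm_inner τ
  obtain ⟨ρ', w₀, hρ', g₂, hw⟩ := exists_perm_graft ρ hf h₂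
  have hs₁ : OuterPos i n j (ρ s) := hρ.outer _ _ hs
  have g₄ := g₁.comm_right g₂ hs₁ hs' h₃
  have hb : BlockPerm s' 1 τ ρ' :=
    hρ.comm h₁.arity h₂.arity h₃.arity hs hs' (BlockPerm.one j) hρ'
  rw [ap_act g₁ hf h₁ hρ, H' ρ ρ' g₂ hf hw h₂ hρ', H g₁ g₂ h₃ g₄ hs₁ hs' d₁ d₂ d₃ d₄,
    ap_act g₄ hw h₄ hb, map_smul]

/-- The second family moves past the two constituents in turn, and the exponents of the signs add to
the degree of the composite. -/
theorem Comm.comp {n' r₀ : ℕ} {j₀ : Fin n} {e' : Fin n' → C} {b₀ : C} {f₀ : Fin r₀ → C} {q' qq : ℤ}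
    {φ : OpX G e b q} {φ' : OpX G e' b₀ q'} {ψ : OpX G g b' t} (H : Comm φ ψ) (H' : Comm φ' ψ)
    (hj : IsGraft j₀ b₀ e e' f₀) (dj : q + q' = qq) : Comm (comp hj dj φ φ') ψ := by
  intro m r r' v i j s s' a c f f' w p pq pt pqt h₁ h₂ h₃ h₄ hs hs' d₁ d₂ d₃ d₄ x
  obtain ⟨s₁, f₁, hs₁, g₁, g₂⟩ := hj.exists_of_assoc h₁
  obtain ⟨S, hS⟩ := exists_outerPos g₁.arity hs.ne
  have := hj.arity
  have hs₂ : OuterPos s₁ n' S s := by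
    simp only [OuterPos, InnerPos, Fin.lt_def] at *; omega
  obtain ⟨t₂, f₂, ht₂, g₃, g₄⟩ := g₂.comm h₂ hs₂
  have g₅ := g₁.comm_right g₃ hS hs' h₃
  have ht : InnerPos s' j₀ t₂ := by
    simp only [OuterPos, InnerPos, Fin.lt_def] at *; omega
  rw [ap_comp g₁ g₂ hj h₁ hs₁ rfl (by omega) dj,
    H' g₂ h₂ g₃ g₄ hs₂ ht₂ _ d₂ rfl (by omega),
    H g₁ g₃ h₃ g₅ hS hs' rfl rfl d₃ (show pt + q = p + q + t by omega),
    ap_comp g₅ g₄ hj h₄ ht (show pt + q = p + q + t by omega) (by omega) dj, map_smul,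
    neg_one_zpow_smul_smul]
  exact neg_one_zpow_smul_congr ⟨0, by rw [← dj]; ring⟩ rfl

/-- The permutation coming from `σ` is moved past `ψ`; this is the only place where equivariance
enters, so nothing is asked of `φ`. -/
theorem comp_act {j : Fin n} {f' : Fin r' → C} (σ : Equiv.Perm (Fin n)) (τ : Equiv.Perm (Fin l))
    (ρ : Equiv.Perm (Fin r')) (hg : IsGraft (σ j) b' e g f')
    (hg' : IsGraft j b' (e ∘ σ) (g ∘ τ) (f' ∘ ρ)) (hρ : BlockPerm j σ τ ρ) (d₃ : q + t = qt)
    (φ : OpX G e b q) {ψ : OpX G g b' t} (H : Equi ψ) :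
    comp hg' d₃ (act σ φ) (act τ ψ) = act ρ (comp hg d₃ φ ψ) := by
  refine ext fun {m r i a c w p t} hG h x => ?_
  obtain ⟨s, f, hs, g₁, g₂⟩ := hg'.exists_of_assoc hG
  obtain ⟨ρ₁, f₁, hρ₁, g₃, hf₁⟩ := g₁.exists_perm_inner σ
  obtain ⟨ρ₂, w₂, hρ₂, g₄, hw₂⟩ := g₂.exists_perm_inner τ
  obtain ⟨ρ₃, w₃, hρ₃, g₅, hw₃⟩ := exists_perm_graft ρ₁ hf₁ g₄
  have hb₁ : BlockPerm s ρ₁ τ (ρ₃ * ρ₂) := BlockPerm.mul (σ' := 1) (τ := 1) hρ₃ hρ₂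
  have hb : BlockPerm i 1 ρ (ρ₃ * ρ₂) :=
    BlockPerm.assoc g₃.arity g₅.arity hg.arity hs hρ₁ hρ hb₁
  have hs' : InnerPos i (σ j) (ρ₁ s) := hρ₁.inner _ _ hs
  have g₆ := g₃.assoc_right g₅ hs' hg
  have hw : w = w₃ ∘ (ρ₃ * ρ₂ : Equiv.Perm _) := by rw [hw₂, hw₃]; rfl
  rw [ap_comp g₁ g₂ hg' hG hs rfl (by omega) d₃, ap_act g₃ hf₁ g₁ hρ₁, ap_act g₄ hw₂ g₂ hρ₂,
    H ρ₁ ρ₃ g₅ hf₁ hw₃ g₄ hρ₃, ap_act g₆ hw hG hb, ap_comp g₃ g₅ hg g₆ hs' rfl (by omega) d₃,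
    (words G).perm_perm ρ₃ ρ₂ _ _ hw]

/-- Both sides apply `φ` first, and what follows is the commutation of `ψ` and `χ` at two inputs of
the result. -/
theorem comm_of_comm {j j' : Fin n} {f : Fin r → C} {f' : Fin r' → C} {s : Fin r} {s' : Fin r'}
    {l' : ℕ} {g' : Fin l' → C} {b₂ : C} {t' qt' qtt : ℤ}
    (h₁ : IsGraft j b' e g f) (h₂ : IsGraft s b₂ f g' w)
    (h₃ : IsGraft j' b₂ e g' f') (h₄ : IsGraft s' b' f' g w)
    (hs : OuterPos j l j' s) (hs' : OuterPos j' l' j s')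
    (d₁ : q + t = qt) (d₂ : qt + t' = qtt) (d₃ : q + t' = qt') (d₄ : qt' + t = qtt)
    (φ : OpX G e b q) {ψ : OpX G g b' t} {χ : OpX G g' b₂ t'} (H : Comm ψ χ) :
    comp h₂ d₂ (comp h₁ d₁ φ ψ) χ =
      (-1 : k) ^ (t * t') • comp h₄ d₄ (comp h₃ d₃ φ χ) ψ := by
  refine ext fun {m r i a c w p t} hg h x => ?_
  obtain ⟨s₁, f₁, hs₁, g₁, g₂⟩ := h₂.exists_of_assoc hg
  obtain ⟨s₂, f₂, hs₂, g₃, g₄⟩ := h₁.exists_of_assoc g₁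
  obtain ⟨s₃, f₃, hs₃, g₅, g₆⟩ := h₄.exists_of_assoc hg
  obtain ⟨s₄, f₄, hs₄, g₇, g₈⟩ := h₃.exists_of_assoc g₅
  obtain rfl := g₃.eq g₇
  have := h₁.arity
  have := h₃.arity
  rw [ap_smul, ap_comp g₁ g₂ h₂ hg hs₁ rfl (by omega) d₂,
    ap_comp g₃ g₄ h₁ g₁ hs₂ rfl (by omega) d₁,
    ap_comp g₅ g₆ h₄ hg hs₃ rfl (by omega) d₄, ap_comp g₃ g₈ h₃ g₅ hs₄ rfl (by omega) d₃]
  refine H g₄ g₂ g₈ g₆ ?_ ?_ _ _ _ _ _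
  · simp only [OuterPos, InnerPos, Fin.lt_def] at *; omega
  · simp only [OuterPos, InnerPos, Fin.lt_def] at *; omega

end OpX

/-! ### The operad generated by the actions of the `G ι` on words -/

variable (A : ∀ ι, Augmentation (G ι)) (κ : I)

/-- The insertion of an element of `G κ`. -/
noncomputable def opMap {n : ℕ} {e : Fin n → C} {b : C} {q : ℤ} :
    (G κ).X e b q →ₗ[k] OpX G e b q where
  toFun y s := (op A κ s.hg s.h).flip y
  map_add' y y' := funext fun s => map_add _ _ _
  map_smul' l y := funext fun s => LinearMap.map_smul (op A κ s.hg s.h).flip l y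

section opMap

variable {m n l r : ℕ} {i : Fin m} {a b b' : C} {c : Fin m → C} {e : Fin n → C} {g : Fin l → C}
    {f : Fin r → C} {p q t qt : ℤ}

theorem opMap_ap (hg : IsGraft i b c e f) (h : p + q = t) (x : (words G).X c a p)
    (y : (G κ).X e b q) : (opMap A κ y).ap hg h x = op A κ hg h x y := rfl

theorem equi_opMap (y : (G κ).X e b q) : (opMap A κ y).Equi := by
  intro m r i a c c' f f' p t σ ρ hg hc hf hg' hρ h x
  have := op_perm A κ σ 1 ρ hg hc hf hg' hρ h x y
  rw [(G κ).act_one] at this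
  exact this

theorem comm_opMap (ι : I) (y : (G ι).X e b q) (z : (G κ).X g b' t) :
    (opMap A ι y).Comm (opMap A κ z) := by
  intro m r r' v i j s s' a c f f' w p pq pt pqt h₁ h₂ h₃ h₄ hs hs' d₁ d₂ d₃ d₄ x
  exact op_comm A κ ι h₁ h₂ h₃ h₄ hs hs' d₁ d₂ d₃ d₄ x y z

theorem opMap_d {q' : ℤ} (hq : q' + 1 = q) (y : (G κ).X e b q) :
    opMap A κ ((G κ).d hq y) = OpX.d hq (opMap A κ y) := by
  refine OpX.ext fun {m r i a c f p t} hg h x => ?_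
  rw [OpX.ap_d hg (t := t + 1) (by omega) rfl (sub_add_cancel p 1) hq (by omega), opMap_ap,
    opMap_ap, opMap_ap, wordsD_op A κ hg (t := t + 1) (by omega) rfl (sub_add_cancel p 1) hq
      (by omega) h, add_sub_cancel_left, neg_one_zpow_smul_self]

theorem opMap_act (τ : Equiv.Perm (Fin n)) (y : (G κ).X e b q) :
    opMap A κ ((G κ).act τ y) = OpX.act τ (opMap A κ y) := by
  refine OpX.ext fun {m r i a c f p t} hg h x => ?_
  obtain ⟨ρ, f₀, hρ, g₁, hf⟩ := hg.exists_perm_inner τ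
  rw [OpX.ap_act g₁ hf hg hρ, opMap_ap, opMap_ap]
  exact (congrArg (fun z => op A κ hg h z ((G κ).act τ y)) ((words G).perm_one rfl x)).symm.trans
    (op_perm A κ 1 τ ρ g₁ rfl hf hg hρ h x y)

theorem opMap_one (hu : IsUnitPlace e b q) : opMap A κ ((G κ).one hu) = OpX.one hu := by
  refine OpX.ext fun {m r i a c f p t} hg h x => ?_
  obtain rfl := hu.arity_right hg
  obtain rfl := hu.eq_of_isGraft hg
  have hq := hu.2.2
  obtain rfl : t = p := by omega
  rw [opMap_ap, op_one, OpX.ap_one]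

theorem opMap_comp {j : Fin n} (h₃ : IsGraft j b' e g f) (d₃ : q + t = qt)
    (y : (G κ).X e b q) (z : (G κ).X g b' t) :
    opMap A κ ((G κ).comp h₃ d₃ y z) = OpX.comp h₃ d₃ (opMap A κ y) (opMap A κ z) := by
  refine OpX.ext fun {m r i a c f p t} hg h x => ?_
  obtain ⟨s, f₀, hs, g₁, g₂⟩ := h₃.exists_of_assoc hg
  rw [OpX.ap_comp g₁ g₂ h₃ hg hs rfl (by omega) d₃]
  exact (op_assoc A κ g₁ g₂ h₃ hg hs rfl (by omega) d₃ h x y z).symm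

end opMap

/-- The families generated by the insertions of elements of the `G ι`. -/
inductive Gen : ∀ {n : ℕ} {e : Fin n → C} {b : C} {q : ℤ}, OpX G e b q → Prop
  | of (κ : I) {n : ℕ} {e : Fin n → C} {b : C} {q : ℤ} (y : (G κ).X e b q) : Gen (opMap A κ y)
  | zero {n : ℕ} {e : Fin n → C} {b : C} {q : ℤ} : Gen (0 : OpX G e b q)
  | add {n : ℕ} {e : Fin n → C} {b : C} {q : ℤ} {φ ψ : OpX G e b q} :
      Gen φ → Gen ψ → Gen (φ + ψ)
  | smul {n : ℕ} {e : Fin n → C} {b : C} {q : ℤ} (l : k) {φ : OpX G e b q} :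
      Gen φ → Gen (l • φ)
  | one {n : ℕ} {e : Fin n → C} {b : C} {q : ℤ} (hu : IsUnitPlace e b q) : Gen (OpX.one hu)
  | act {n : ℕ} {e : Fin n → C} {b : C} {q : ℤ} (τ : Equiv.Perm (Fin n)) {φ : OpX G e b q} :
      Gen φ → Gen (OpX.act τ φ)
  | comp {n l r : ℕ} {j : Fin n} {b b' : C} {e : Fin n → C} {g : Fin l → C} {f : Fin r → C}
      {q t qt : ℤ} (hg : IsGraft j b' e g f) (h : q + t = qt) {φ : OpX G e b q}
      {ψ : OpX G g b' t} : Gen φ → Gen ψ → Gen (OpX.comp hg h φ ψ)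

namespace Gen

variable {A} {n l : ℕ} {b b' : C} {e : Fin n → C} {g : Fin l → C} {q t : ℤ}

theorem equi {φ : OpX G e b q} (h : Gen A φ) : φ.Equi := by
  induction h with
  | of κ y => exact equi_opMap A κ y
  | zero =>
    intro m r i a c c' f f' p t σ ρ hg hc hf hg' hρ h x
    simp
  | add _ _ h h' =>
    intro m r i a c c' f f' p t σ ρ hg hc hf hg' hρ hd x
    rw [OpX.ap_add, OpX.ap_add, map_add, h σ ρ hg hc hf hg' hρ, h' σ ρ hg hc hf hg' hρ]
  | smul l _ h =>
    intro m r i a c c' f f' p t σ ρ hg hc hf hg' hρ hd x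
    rw [OpX.ap_smul, OpX.ap_smul, map_smul, h σ ρ hg hc hf hg' hρ]
  | one hu => exact OpX.Equi.one hu
  | act τ _ h => exact h.act τ
  | comp hg hd _ _ h h' => exact h.comp h' hg hd

/-- Commutation with an equivariant family survives every operation that generates the operad, so it
suffices to test the generators. -/
theorem comm_of {φ : OpX G e b q} (h : Gen A φ) {ψ : OpX G g b' t} (hψ : ψ.Equi)
    (H : ∀ (κ : I) {n : ℕ} {e : Fin n → C} {b : C} {q : ℤ} (y : (G κ).X e b q),
      (opMap A κ y).Comm ψ) : φ.Comm ψ := by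
  induction h with
  | of κ y => exact H κ y
  | zero =>
    intro m r r' v i j s s' a c f f' w p pq pt pqt h₁ h₂ h₃ h₄ hs hs' d₁ d₂ d₃ d₄ x
    simp
  | add _ _ h h' =>
    intro m r r' v i j s s' a c f f' w p pq pt pqt h₁ h₂ h₃ h₄ hs hs' d₁ d₂ d₃ d₄ x
    rw [OpX.ap_add, OpX.ap_add, map_add, smul_add, h h₁ h₂ h₃ h₄ hs hs' d₁ d₂ d₃ d₄,
      h' h₁ h₂ h₃ h₄ hs hs' d₁ d₂ d₃ d₄]
  | smul l _ h =>
    intro m r r' v i j s s' a c f f' w p pq pt pqt h₁ h₂ h₃ h₄ hs hs' d₁ d₂ d₃ d₄ x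
    rw [OpX.ap_smul, OpX.ap_smul, map_smul, h h₁ h₂ h₃ h₄ hs hs' d₁ d₂ d₃ d₄, smul_comm]
  | one hu => exact OpX.Comm.one hu ψ
  | act τ _ h => exact h.act hψ τ
  | comp hg hd _ _ h h' => exact h.comp h' hg hd

/-- The reduction to generators is applied in each variable in turn, by symmetry, ending with
`op_comm`. -/
theorem comm {φ : OpX G e b q} (h : Gen A φ) {ψ : OpX G g b' t} (h' : Gen A ψ) : φ.Comm ψ :=
  h.comm_of h'.equi fun κ _ _ _ _ y =>
    OpX.Comm.symm (h'.comm_of (equi_opMap A κ y) fun ι _ _ _ _ z => comm_opMap A κ ι z y)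

/-- The differential of a generator is the generator of the differential, and the differential is a
derivation for the remaining operations. -/
theorem d {φ : OpX G e b q} (h : Gen A φ) {q' : ℤ} (hq : q' + 1 = q) : Gen A (OpX.d hq φ) := by
  induction h generalizing q' with
  | of κ y =>
    rw [← opMap_d]
    exact Gen.of κ _
  | zero =>
    rw [map_zero]
    exact Gen.zero
  | add _ _ h h' =>
    rw [map_add]
    exact (h hq).add (h' hq)
  | smul l _ h =>
    rw [map_smul]
    exact (h hq).smul l
  | one hu =>
    rw [OpX.d_one]
    exact Gen.zero
  | act τ _ h =>
    rw [OpX.d_act]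
    exact (h hq).act τ
  | comp hg hd H H' h h' =>
    rw [OpX.d_comp hg hd (sub_add_cancel _ 1) (sub_add_cancel _ 1) hq (by omega) (by omega)]
    exact ((h _).comp hg _ H').add ((H.comp hg _ (h' _)).smul _)

end Gen

/-- The dg operad of the families of maps on words generated by the insertions of elements of
the `G ι`. -/
noncomputable def genOperad : DgOperad k C where
  X e b q :=
    ({ carrier := {φ | Gen A φ}
       add_mem' := Gen.add
       zero_mem' := Gen.zero
       smul_mem' := fun l _ => Gen.smul l } : Submodule k (OpX G e b q))
  d h := (OpX.d h).restrict fun x hx => Gen.d hx h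
  act σ := (OpX.act σ).restrict fun x hx => Gen.act σ hx
  one hu := ⟨OpX.one hu, Gen.one hu⟩
  comp hg h := LinearMap.mk₂ k
    (fun x y => ⟨OpX.comp hg h x.1 y.1, Gen.comp hg h x.2 y.2⟩)
    (fun _ _ _ => Subtype.ext (LinearMap.map_add₂ _ _ _ _))
    (fun _ _ _ => Subtype.ext (LinearMap.map_smul₂ _ _ _ _))
    (fun _ _ _ => Subtype.ext (map_add _ _ _))
    (fun _ _ _ => Subtype.ext (LinearMap.map_smul _ _ _))
  d_d h h' x := Subtype.ext (OpX.d_d h h' _)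
  d_act h σ x := Subtype.ext (OpX.d_act h σ _)
  d_one h hu := Subtype.ext (OpX.d_one h hu)
  d_comp hg h hp hq ht h₁ h₂ x y := Subtype.ext (OpX.d_comp hg h hp hq ht h₁ h₂ _ _)
  act_one x := Subtype.ext (OpX.act_one _)
  act_mul σ τ x := Subtype.ext (OpX.act_mul σ τ _)
  one_comp hg h hu x := Subtype.ext (OpX.one_comp hg h hu _)
  comp_one hg h hu x := Subtype.ext (OpX.comp_one hg h hu _)
  assoc h₁ h₂ h₃ h₄ hs d₁ d₂ d₃ d₄ x y z :=
    Subtype.ext (OpX.assoc h₁ h₂ h₃ h₄ hs d₁ d₂ d₃ d₄ _ _ _)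
  -- The axioms above hold for arbitrary families of maps; this one and the next use that the
  -- families are generated by insertions.
  comm h₁ h₂ h₃ h₄ hs hs' d₁ d₂ d₃ d₄ x y z :=
    Subtype.ext (OpX.comm_of_comm h₁ h₂ h₃ h₄ hs hs' d₁ d₂ d₃ d₄ _ (Gen.comm y.2 z.2))
  comp_act σ τ ρ hg hg' ho hi h x y :=
    Subtype.ext (OpX.comp_act σ τ ρ hg hg' ⟨ho, hi⟩ h _ (Gen.equi y.2))

/-- The morphism that sends an element of `G κ` to its insertion. -/
noncomputable def genOf : G κ ⟶ genOperad A :=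
  Hom.mk (P := G κ) (R := genOperad A)
    (fun {n e b q} => (opMap A κ).codRestrict _ fun y => Gen.of κ y)
    (fun h x => Subtype.ext (opMap_d A κ h x))
    (fun σ x => Subtype.ext (opMap_act A κ σ x))
    (fun hu => Subtype.ext (opMap_one A κ hu))
    (fun hg h x y => Subtype.ext (opMap_comp A κ hg h x y))

/-- The value of a family at the unit. -/
noncomputable def atOne {n : ℕ} {e : Fin n → C} {b : C} {q : ℤ} :
    (genOperad A).X e b q →ₗ[k] (words G).X e b q where
  toFun φ := φ.1.ap (isGraft_unit e b) (zero_add q) ((words G).one (isUnitPlace_const b))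
  map_add' _ _ := rfl
  map_smul' _ _ := rfl

section atOne

variable {n l r : ℕ} {j : Fin n} {b b' : C} {e : Fin n → C} {g : Fin l → C}
    {f : Fin r → C} {q t qt : ℤ}

theorem atOne_one (hu : IsUnitPlace e b q) :
    atOne A ((genOperad A).one hu) = (words G).one hu := by
  obtain rfl := hu.1
  obtain rfl : e = fun _ => b := funext hu.2.1
  have hq := hu.2.2
  subst hq
  rfl

theorem atOne_act (τ : Equiv.Perm (Fin n)) (φ : (genOperad A).X e b q) :
    atOne A ((genOperad A).act τ φ) = (words G).perm τ rfl (atOne A φ) :=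
  OpX.ap_act (isGraft_unit e b) rfl (isGraft_unit (e ∘ τ) b) (blockPerm_unit τ) (zero_add q) φ.1 _

theorem atOne_d (h : t + 1 = q) (φ : (genOperad A).X e b q) :
    atOne A ((genOperad A).d h φ) = wordsD G h (atOne A φ) := by
  refine (OpX.ap_d (isGraft_unit e b) (zero_add q) h (sub_add_cancel 0 1) h (by omega) _ _ _).trans
    ?_
  rw [wordsD_one, map_zero, sub_zero, zpow_zero, one_smul]
  rfl

/-- Inserting a composite into a unit amounts to inserting `φ` into the unit and then `y` into the
result. Hence normal forms are computed by letting the factors act successively. -/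
theorem atOne_comp_genOf (hg : IsGraft j b' e g f) (h : q + t = qt) (φ : (genOperad A).X e b q)
    (y : (G κ).X g b' t) :
    atOne A ((genOperad A).comp hg h φ (Hom.app (genOf A κ) y)) =
      op A κ hg h (atOne A φ) y :=
  OpX.ap_comp (isGraft_unit e b) hg hg (isGraft_unit f b) (by simp [InnerPos]) (zero_add q) h h
    (zero_add qt) φ.1 (opMap A κ y) _

end atOne

end DgOperad

namespace DgOperad

variable {k : Type u} [Field k] {C : Type u}

/-! ### The length of words -/

section length

variable {I : Type} {G : I → DgOperad k C}

/-- The sums of words of length at most `ℓ`. -/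
inductive LenLE : ℕ → ∀ {n : ℕ} {c : Fin n → C} {a : C} {p : ℤ}, (words G).X c a p → Prop
  | zero {ℓ n : ℕ} {c : Fin n → C} {a : C} {p : ℤ} : LenLE ℓ (0 : (words G).X c a p)
  | add {ℓ n : ℕ} {c : Fin n → C} {a : C} {p : ℤ} {x y : (words G).X c a p} :
      LenLE ℓ x → LenLE ℓ y → LenLE ℓ (x + y)
  | smul {ℓ n : ℕ} {c : Fin n → C} {a : C} {p : ℤ} (s : k) {x : (words G).X c a p} :
      LenLE ℓ x → LenLE ℓ (s • x)
  | one {ℓ n : ℕ} {c : Fin n → C} {a : C} {p : ℤ} (hu : IsUnitPlace c a p) :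
      LenLE ℓ ((words G).one hu)
  | perm {ℓ n : ℕ} {c f : Fin n → C} {a : C} {p : ℤ} (σ : Equiv.Perm (Fin n)) (h : f = c ∘ σ)
      {x : (words G).X c a p} : LenLE ℓ x → LenLE ℓ ((words G).perm σ h x)
  | graft {ℓ : ℕ} (ι : I) {m n r : ℕ} {i : Fin m} {a b : C} {c : Fin m → C} {e : Fin n → C}
      {f : Fin r → C} {p q t : ℤ} (hg : IsGraft i b c e f) (h : p + q = t)
      {x : (words G).X c a p} (y : (G ι).X e b q) : LenLE ℓ x →
      LenLE (ℓ + 1) ((words G).graft ι hg h x y)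

namespace LenLE

variable {m n r : ℕ} {i : Fin m} {a b : C} {c : Fin m → C} {e : Fin n → C} {f : Fin r → C}
  {p q t : ℤ} {ℓ ℓ' : ℕ}

theorem mono {x : (words G).X c a p} (h : LenLE ℓ x) (hℓ : ℓ ≤ ℓ') : LenLE ℓ' x := by
  induction h generalizing ℓ' with
  | zero => exact zero
  | add _ _ h h' => exact (h hℓ).add (h' hℓ)
  | smul s _ h => exact (h hℓ).smul s
  | one hu => exact one hu
  | perm σ hf _ h => exact (h hℓ).perm σ hf
  | graft ι hg hd y _ h =>
    obtain ⟨ℓ', rfl⟩ := Nat.exists_eq_add_of_lt (Nat.lt_of_succ_le hℓ)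
    exact (h (by omega)).graft ι hg hd y

theorem exists_lenLE (x : (words G).X c a p) : ∃ ℓ, LenLE ℓ x := by
  induction x using words_induction with
  | zero => exact ⟨0, zero⟩
  | add x y hx hy =>
    obtain ⟨ℓ, hx⟩ := hx
    obtain ⟨ℓ', hy⟩ := hy
    exact ⟨max ℓ ℓ', (hx.mono (le_max_left _ _)).add (hy.mono (le_max_right _ _))⟩
  | smul s x hx =>
    obtain ⟨ℓ, hx⟩ := hx
    exact ⟨ℓ, hx.smul s⟩
  | one hu => exact ⟨0, one hu⟩
  | perm σ hf x hx =>
    obtain ⟨ℓ, hx⟩ := hx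
    exact ⟨ℓ, hx.perm σ hf⟩
  | graft ι hg h x y hx =>
    obtain ⟨ℓ, hx⟩ := hx
    exact ⟨ℓ + 1, hx.graft ι hg h y⟩

theorem graftUnit {x : (words G).X c a p} (H : LenLE ℓ x) (hg : IsGraft i b c e f)
    (h : p + q = t) (y : unitX k e b q) : LenLE ℓ (graftUnit G hg h x y) := by
  by_cases hu : IsUnitPlace e b q
  · obtain rfl := hu.arity_right hg
    obtain rfl := hu.eq_of_isGraft hg
    have hq := hu.2.2
    obtain rfl : t = p := by omega
    rw [DgOperad.graftUnit, dif_pos hu]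
    exact H.smul _
  · rw [DgOperad.graftUnit, dif_neg hu]
    exact zero

/-- A multiplication modifies a letter and adds none; this makes the action triangular for the
length. -/
theorem mult {x : (words G).X c a p} (H : LenLE ℓ x) (A : ∀ ι, Augmentation (G ι)) (κ : I)
    (hg : IsGraft i b c e f) (h : p + q = t) (y : (G κ).X e b q) :
    LenLE ℓ (mult A κ hg h x y) := by
  induction H generalizing r f t with
  | zero =>
    rw [map_zero, LinearMap.zero_apply]
    exact zero
  | add _ _ hx hx' =>
    rw [map_add, LinearMap.add_apply]
    exact (hx hg h).add (hx' hg h)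
  | smul s _ hx =>
    rw [map_smul, LinearMap.smul_apply]
    exact (hx hg h).smul s
  | one hu =>
    rw [mult_one]
    exact zero
  | perm σ hc _ hx =>
    obtain ⟨ρ, f₀, hρ, h', hf⟩ := exists_perm_graft σ hc hg
    rw [mult_perm A κ σ ρ h' hc hf hg hρ]
    exact (hx h' h).perm ρ hf
  | @graft ℓ ι m n₀ r₀ i₀ a b₀ c e₀ f₀ p₁ p₂ p h₀ d₀ x u H hx =>
    obtain ⟨j₀, hj₀⟩ | ⟨i₁, hi₁⟩ := pos_cases h₀.arity i₀ i
    · by_cases hι : κ = ι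
      · subst hι
        obtain ⟨f₁, g₁, g₂⟩ := h₀.assoc hg hj₀
        rw [mult_graft_inner A κ h₀ hg g₁ g₂ hj₀ d₀ h rfl (by omega)]
        exact H.graft κ _ _ _
      · rw [mult_graft_inner_ne A κ hι h₀ hg hj₀]
        exact zero
    · obtain ⟨s₁, f₁, hs₁, g₁, g₂⟩ := h₀.comm hg hi₁
      rw [mult_graft_outer A κ ι h₀ hg g₁ g₂ hi₁ hs₁ d₀ h rfl (by omega)]
      exact ((hx _ _).graft ι _ _ _).smul _

end LenLE

end length

/-! ### The free product as a space of words -/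

section freeProduct

variable (G : Bool → DgOperad k C)

/-- The inclusion of a factor in the free product. -/
def inc : ∀ κ : Bool, G κ ⟶ freeProduct (G true) (G false)
  | true => freeInl _ _
  | false => freeInr _ _

variable {G}

theorem free_induction
    {motive : ∀ {n : ℕ} {c : Fin n → C} {a : C} {p : ℤ},
      (freeProduct (G true) (G false)).X c a p → Prop}
    (inc : ∀ (κ : Bool) {n : ℕ} {c : Fin n → C} {a : C} {p : ℤ} (x : (G κ).X c a p),
      motive (Hom.app (inc G κ) x))
    (zero : ∀ {n : ℕ} {c : Fin n → C} {a : C} {p : ℤ},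
      motive (0 : (freeProduct (G true) (G false)).X c a p))
    (add : ∀ {n : ℕ} {c : Fin n → C} {a : C} {p : ℤ}
      (x y : (freeProduct (G true) (G false)).X c a p), motive x → motive y → motive (x + y))
    (smul : ∀ {n : ℕ} {c : Fin n → C} {a : C} {p : ℤ} (s : k)
      (x : (freeProduct (G true) (G false)).X c a p), motive x → motive (s • x))
    (d : ∀ {n : ℕ} {c : Fin n → C} {a : C} {p q : ℤ} (h : q + 1 = p)
      (x : (freeProduct (G true) (G false)).X c a p), motive x →
        motive ((freeProduct (G true) (G false)).d h x))
    (act : ∀ {n : ℕ} {c : Fin n → C} {a : C} {p : ℤ} (σ : Equiv.Perm (Fin n))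
      (x : (freeProduct (G true) (G false)).X c a p), motive x →
        motive ((freeProduct (G true) (G false)).act σ x))
    (one : ∀ {n : ℕ} {c : Fin n → C} {a : C} {p : ℤ} (hu : IsUnitPlace c a p),
      motive ((freeProduct (G true) (G false)).one hu))
    (comp : ∀ {m n r : ℕ} {i : Fin m} {a b : C} {c : Fin m → C} {e : Fin n → C} {f : Fin r → C}
      {p q t : ℤ} (hg : IsGraft i b c e f) (h : p + q = t)
      (x : (freeProduct (G true) (G false)).X c a p)
      (y : (freeProduct (G true) (G false)).X e b q), motive x → motive y →
        motive ((freeProduct (G true) (G false)).comp hg h x y))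
    {n : ℕ} {c : Fin n → C} {a : C} {p : ℤ}
    (x : (freeProduct (G true) (G false)).X c a p) : motive x := by
  suffices h : ∀ {n : ℕ} {c : Fin n → C} {a : C} {p : ℤ} (x : Expr (G true) (G false) c a p),
      motive (Quotient.mk (exprSetoid (G true) (G false) c a p) x :
        (freeProduct (G true) (G false)).X c a p) from Quotient.ind h x
  intro n c a p x
  induction x with
  | inl x => exact inc true x
  | inr x => exact inc false x
  | zero => exact zero
  | add x y hx hy => exact add _ _ hx hy
  | smul s x hx => exact smul s _ hx
  | d h x hx => exact d h _ hx
  | act σ x hx => exact act σ _ hx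
  | one hu => exact one hu
  | comp hg h x y hx hy => exact comp hg h _ _ hx hy

/-- The sums of elements of the free product that are obtained from a unit by at most `ℓ`
successive compositions with elements of the factors. -/
inductive IsWord : ℕ → ∀ {n : ℕ} {c : Fin n → C} {a : C} {p : ℤ},
    (freeProduct (G true) (G false)).X c a p → Prop
  | zero {ℓ n : ℕ} {c : Fin n → C} {a : C} {p : ℤ} :
      IsWord ℓ (0 : (freeProduct (G true) (G false)).X c a p)
  | add {ℓ n : ℕ} {c : Fin n → C} {a : C} {p : ℤ}
      {x y : (freeProduct (G true) (G false)).X c a p} :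
      IsWord ℓ x → IsWord ℓ y → IsWord ℓ (x + y)
  | smul {ℓ n : ℕ} {c : Fin n → C} {a : C} {p : ℤ} (s : k)
      {x : (freeProduct (G true) (G false)).X c a p} : IsWord ℓ x → IsWord ℓ (s • x)
  | one {ℓ n : ℕ} {c : Fin n → C} {a : C} {p : ℤ} (hu : IsUnitPlace c a p) :
      IsWord ℓ ((freeProduct (G true) (G false)).one hu)
  | act {ℓ n : ℕ} {c : Fin n → C} {a : C} {p : ℤ} (σ : Equiv.Perm (Fin n))
      {x : (freeProduct (G true) (G false)).X c a p} : IsWord ℓ x →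
      IsWord ℓ ((freeProduct (G true) (G false)).act σ x)
  | comp {ℓ : ℕ} (κ : Bool) {m n r : ℕ} {i : Fin m} {a b : C} {c : Fin m → C} {e : Fin n → C}
      {f : Fin r → C} {p q t : ℤ} (hg : IsGraft i b c e f) (h : p + q = t)
      {x : (freeProduct (G true) (G false)).X c a p} (y : (G κ).X e b q) : IsWord ℓ x →
      IsWord (ℓ + 1) ((freeProduct (G true) (G false)).comp hg h x (Hom.app (inc G κ) y))

namespace IsWord

variable {m n r : ℕ} {i : Fin m} {a b : C} {c : Fin m → C} {e : Fin n → C} {f : Fin r → C}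
  {p q t : ℤ} {ℓ ℓ' : ℕ}

theorem mono {x : (freeProduct (G true) (G false)).X c a p} (h : IsWord ℓ x) (hℓ : ℓ ≤ ℓ') :
    IsWord ℓ' x := by
  induction h generalizing ℓ' with
  | zero => exact zero
  | add _ _ h h' => exact (h hℓ).add (h' hℓ)
  | smul s _ h => exact (h hℓ).smul s
  | one hu => exact one hu
  | act σ _ h => exact (h hℓ).act σ
  | comp κ hg hd y _ h =>
    obtain ⟨ℓ', rfl⟩ := Nat.exists_eq_add_of_lt (Nat.lt_of_succ_le hℓ)
    exact (h (by omega)).comp κ hg hd y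

/-- Sequential associativity turns `x ∘ (y ∘ z)` into `(x ∘ y) ∘ z`, so the letters of the second
word can be appended one at a time. -/
theorem exists_comp {x : (freeProduct (G true) (G false)).X c a p} (hx : IsWord ℓ x)
    {y : (freeProduct (G true) (G false)).X e b q} (hy : IsWord ℓ' y) (hg : IsGraft i b c e f)
    (h : p + q = t) : IsWord (ℓ + ℓ') ((freeProduct (G true) (G false)).comp hg h x y) := by
  induction hy generalizing r f t with
  | zero =>
    rw [map_zero]
    exact zero
  | add _ _ hy hy' =>
    rw [map_add]
    exact (hy hg h).add (hy' hg h)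
  | smul s _ hy =>
    rw [map_smul]
    exact (hy hg h).smul s
  | one hu =>
    obtain rfl := hu.arity_right hg
    obtain rfl := hu.eq_of_isGraft hg
    have hq := hu.2.2
    obtain rfl : t = p := by omega
    rw [DgOperad.comp_one]
    exact hx.mono (Nat.le_add_right _ _)
  | act τ _ hy =>
    obtain ⟨ρ, f₀, hρ, g₁, rfl⟩ := hg.exists_perm_inner τ
    rw [comp_act_inner _ τ ρ g₁ hg hρ]
    exact (hy g₁ h).act ρ
  | comp κ hg' h' z _ hy =>
    obtain ⟨s, f₀, hs, g₁, g₂⟩ := hg'.exists_of_assoc hg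
    rw [← (freeProduct (G true) (G false)).assoc g₁ g₂ hg' hg hs rfl (by omega) h' h]
    exact (hy g₁ _).comp κ g₂ _ z

theorem inc (κ : Bool) (x : (G κ).X c a p) : IsWord 1 (Hom.app (inc G κ) x) := by
  have := (one (G := G) (ℓ := 0) (isUnitPlace_const a)).comp κ (isGraft_unit c a) (zero_add p) x
  rwa [DgOperad.one_comp] at this

theorem d {x : (freeProduct (G true) (G false)).X c a p} (hx : IsWord ℓ x) (h : q + 1 = p) :
    IsWord ℓ ((freeProduct (G true) (G false)).d h x) := by
  induction hx generalizing q with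
  | zero =>
    rw [map_zero]
    exact zero
  | add _ _ hy hy' =>
    rw [map_add]
    exact (hy h).add (hy' h)
  | smul s _ hy =>
    rw [map_smul]
    exact (hy h).smul s
  | one hu =>
    rw [DgOperad.d_one]
    exact zero
  | act τ _ hy =>
    rw [DgOperad.d_act]
    exact (hy h).act τ
  | comp κ hg h' z hx hy =>
    rw [DgOperad.d_comp _ hg h' (sub_add_cancel _ 1) (sub_add_cancel _ 1) h (by omega) (by omega),
      ← Hom.app_d]
    exact ((hy _).comp κ hg _ z).add ((hx.comp κ hg _ _).smul _)

theorem exists_isWord (x : (freeProduct (G true) (G false)).X c a p) : ∃ ℓ, IsWord ℓ x := by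
  induction x using free_induction with
  | inc κ x => exact ⟨1, inc κ x⟩
  | zero => exact ⟨0, zero⟩
  | add x y hx hy =>
    obtain ⟨ℓ, hx⟩ := hx
    obtain ⟨ℓ', hy⟩ := hy
    exact ⟨max ℓ ℓ', (hx.mono (le_max_left _ _)).add (hy.mono (le_max_right _ _))⟩
  | smul s x hx =>
    obtain ⟨ℓ, hx⟩ := hx
    exact ⟨ℓ, hx.smul s⟩
  | d h x hx =>
    obtain ⟨ℓ, hx⟩ := hx
    exact ⟨ℓ, hx.d h⟩
  | act σ x hx =>
    obtain ⟨ℓ, hx⟩ := hx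
    exact ⟨ℓ, hx.act σ⟩
  | one hu => exact ⟨0, one hu⟩
  | comp hg h x y hx hy =>
    obtain ⟨ℓ, hx⟩ := hx
    obtain ⟨ℓ', hy⟩ := hy
    exact ⟨ℓ + ℓ', hx.exists_comp hy hg h⟩

end IsWord

variable (A : ∀ ι, Augmentation (G ι))

/-- The words that represent an element of the free product. -/
noncomputable def toWords {n : ℕ} {c : Fin n → C} {a : C} {p : ℤ} :
    (freeProduct (G true) (G false)).X c a p →ₗ[k] (words G).X c a p :=
  atOne A ∘ₗ Hom.app (freeDesc (genOf A true) (genOf A false))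

section toWords

variable {m n r : ℕ} {i : Fin m} {a b : C} {c : Fin m → C} {e : Fin n → C} {f : Fin r → C}
  {p q t : ℤ} {ℓ : ℕ}

theorem toWords_one (hu : IsUnitPlace c a p) :
    toWords A ((freeProduct (G true) (G false)).one hu) = (words G).one hu :=
  atOne_one A hu

theorem toWords_act (σ : Equiv.Perm (Fin m)) (x : (freeProduct (G true) (G false)).X c a p) :
    toWords A ((freeProduct (G true) (G false)).act σ x) =
      (words G).perm σ rfl (toWords A x) := by
  refine (congrArg (atOne A) (Hom.app_act _ σ x)).trans ?_
  exact atOne_act A σ _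

theorem toWords_d (h : q + 1 = p) (x : (freeProduct (G true) (G false)).X c a p) :
    toWords A ((freeProduct (G true) (G false)).d h x) = wordsD G h (toWords A x) := by
  refine (congrArg (atOne A) (Hom.app_d _ h x)).trans ?_
  exact atOne_d A h _

theorem toWords_comp_inc (κ : Bool) (hg : IsGraft i b c e f) (h : p + q = t)
    (x : (freeProduct (G true) (G false)).X c a p) (y : (G κ).X e b q) :
    toWords A ((freeProduct (G true) (G false)).comp hg h x (Hom.app (inc G κ) y)) =
      op A κ hg h (toWords A x) y := by
  refine (congrArg (atOne A) (Hom.app_comp _ hg h x _)).trans ?_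
  have : Hom.app (freeDesc (genOf A true) (genOf A false)) (Hom.app (inc G κ) y) =
      Hom.app (genOf A κ) y := by
    cases κ <;> rfl
  rw [this]
  exact atOne_comp_genOf A κ hg h _ y

/-- The action of a letter is the graft plus terms of smaller length. These are images by induction,
so subtracting their preimages yields a preimage of the graft. -/
theorem exists_toWords_eq {w : (words G).X c a p} (h : LenLE ℓ w) :
    ∃ x, toWords A x = w := by
  induction ℓ using Nat.strong_induction_on generalizing m a p with
  | _ ℓ ih =>
  induction h with
  | zero => exact ⟨0, map_zero _⟩
  | add _ _ hx hy =>
    obtain ⟨x, rfl⟩ := hx ih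
    obtain ⟨y, rfl⟩ := hy ih
    exact ⟨x + y, map_add _ _ _⟩
  | smul s _ hx =>
    obtain ⟨x, rfl⟩ := hx ih
    exact ⟨s • x, map_smul _ _ _⟩
  | one hu => exact ⟨_, toWords_one A hu⟩
  | perm σ hf _ hx =>
    obtain ⟨x, rfl⟩ := hx ih
    subst hf
    exact ⟨_, toWords_act A σ x⟩
  | @graft ℓ ι m n r i a b c e f p q t hg h w y H hx =>
    obtain ⟨x, rfl⟩ := hx fun ℓ' hℓ => ih ℓ' (by omega)
    obtain ⟨z, hz⟩ := ih ℓ (by omega) (H.mult A ι hg h y)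
    obtain ⟨z', hz'⟩ := ih ℓ (by omega) (H.graftUnit hg h ((A ι).eps y))
    refine ⟨(freeProduct (G true) (G false)).comp hg h x (Hom.app (inc G ι) y) - z - z', ?_⟩
    rw [map_sub, map_sub, toWords_comp_inc, hz, hz', op]
    simp only [LinearMap.add_apply, LinearMap.compl₂_apply]
    abel

theorem toWords_surjective (w : (words G).X c a p) : ∃ x, toWords A x = w := by
  obtain ⟨ℓ, h⟩ := LenLE.exists_lenLE w
  exact exists_toWords_eq A h

end toWords

end freeProduct

end DgOperad

namespace DgOperad

variable {k : Type u} [Field k] {C : Type u} {G : Bool → DgOperad k C}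

/-! ### The graded pieces of the free product -/

/-- The sums of words with at most `ℓ` letters. -/
def wordsLE (G : Bool → DgOperad k C) (ℓ : ℕ) {n : ℕ} (c : Fin n → C) (a : C) (p : ℤ) :
    Submodule k ((freeProduct (G true) (G false)).X c a p) where
  carrier := {x | IsWord ℓ x}
  add_mem' := IsWord.add
  zero_mem' := IsWord.zero
  smul_mem' s _ := IsWord.smul s

/-- The sums of words with fewer than `ℓ` letters. -/
def wordsLT (G : Bool → DgOperad k C) : ∀ (ℓ : ℕ) {n : ℕ} (c : Fin n → C) (a : C) (p : ℤ),
    Submodule k ((freeProduct (G true) (G false)).X c a p)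
  | 0, _, _, _, _ => ⊥
  | ℓ + 1, _, c, a, p => wordsLE G ℓ c a p

/-- The words with `ℓ` letters, modulo those with fewer letters. -/
abbrev Gr (G : Bool → DgOperad k C) (ℓ : ℕ) {n : ℕ} (c : Fin n → C) (a : C) (p : ℤ) : Type u :=
  wordsLE G ℓ c a p ⧸ (wordsLT G ℓ c a p).comap (wordsLE G ℓ c a p).subtype

/-- The class of a word. -/
abbrev grMk {ℓ n : ℕ} {c : Fin n → C} {a : C} {p : ℤ}
    {x : (freeProduct (G true) (G false)).X c a p} (h : IsWord ℓ x) : Gr G ℓ c a p :=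
  Submodule.Quotient.mk ⟨x, h⟩

section Gr

variable {m n r : ℕ} {i : Fin m} {a b : C} {c : Fin m → C} {e : Fin n → C} {f : Fin r → C}
  {p q t : ℤ} {ℓ : ℕ}

theorem Gr.exists_rep (z : Gr G ℓ c a p) :
    ∃ (x : (freeProduct (G true) (G false)).X c a p) (h : IsWord ℓ x), grMk h = z := by
  obtain ⟨⟨x, h⟩, rfl⟩ := Submodule.Quotient.mk_surjective _ z
  exact ⟨x, h, rfl⟩

theorem grMk_congr {x y : (freeProduct (G true) (G false)).X c a p} (h : IsWord ℓ x)
    (h' : IsWord ℓ y) (e : x = y) : grMk h = grMk h' := by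
  subst e
  rfl

theorem grMk_eq_zero_iff {x : (freeProduct (G true) (G false)).X c a p} (h : IsWord ℓ x) :
    grMk h = 0 ↔ x ∈ wordsLT G ℓ c a p :=
  Submodule.Quotient.mk_eq_zero _

theorem act_mem_wordsLT (σ : Equiv.Perm (Fin m)) {x : (freeProduct (G true) (G false)).X c a p}
    (h : x ∈ wordsLT G ℓ c a p) :
    (freeProduct (G true) (G false)).act σ x ∈ wordsLT G ℓ (c ∘ σ) a p := by
  cases ℓ with
  | zero =>
    obtain rfl : x = 0 := h
    rw [map_zero]
    exact Submodule.zero_mem _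
  | succ ℓ => exact IsWord.act σ h

theorem comp_mem_wordsLT (κ : Bool) (hg : IsGraft i b c e f) (h : p + q = t)
    {x : (freeProduct (G true) (G false)).X c a p} (hx : x ∈ wordsLT G ℓ c a p)
    (y : (G κ).X e b q) :
    (freeProduct (G true) (G false)).comp hg h x (Hom.app (inc G κ) y) ∈
      wordsLT G (ℓ + 1) f a t := by
  cases ℓ with
  | zero =>
    obtain rfl : x = 0 := hx
    rw [map_zero, LinearMap.zero_apply]
    exact Submodule.zero_mem _
  | succ ℓ => exact IsWord.comp κ hg h y hx

/-- The action on classes of words. -/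
def grPerm (ℓ : ℕ) {f : Fin m → C} (σ : Equiv.Perm (Fin m)) (h : f = c ∘ σ) :
    Gr G ℓ c a p →ₗ[k] Gr G ℓ f a p :=
  Submodule.mapQ _ _
    (LinearMap.restrict
      (h ▸ (freeProduct (G true) (G false)).act σ :
        (freeProduct (G true) (G false)).X c a p →ₗ[k] (freeProduct (G true) (G false)).X f a p)
      (fun x hx => by
        subst h
        exact IsWord.act σ hx))
    (fun x hx => by
      subst h
      exact act_mem_wordsLT σ hx)

/-- The composition of words with elements of a factor. -/
def wordsLEComp (ℓ : ℕ) (κ : Bool) (hg : IsGraft i b c e f) (h : p + q = t) :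
    wordsLE G ℓ c a p →ₗ[k] (G κ).X e b q →ₗ[k] wordsLE G (ℓ + 1) f a t :=
  LinearMap.mk₂ k (fun x y => ⟨_, x.2.comp κ hg h y⟩)
    (fun x x' y => Subtype.ext (by simp)) (fun s x y => Subtype.ext (by simp))
    (fun x y y' => Subtype.ext (by simp)) (fun s x y => Subtype.ext (by simp))

/-- The composition of classes of words with elements of a factor. -/
def grComp (ℓ : ℕ) (κ : Bool) (hg : IsGraft i b c e f) (h : p + q = t) :
    Gr G ℓ c a p →ₗ[k] (G κ).X e b q →ₗ[k] Gr G (ℓ + 1) f a t :=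
  Submodule.liftQ _ ((wordsLEComp ℓ κ hg h).compr₂ (Submodule.mkQ _))
    (fun x hx => LinearMap.ext fun y =>
      (Submodule.Quotient.mk_eq_zero _).2 (comp_mem_wordsLT κ hg h hx y))

/-- The composition of families of classes of words with elements of a factor. -/
def grGraft (κ : Bool) (hg : IsGraft i b c e f) (h : p + q = t) (z : ∀ ℓ, Gr G ℓ c a p)
    (y : (G κ).X e b q) : ∀ ℓ, Gr G ℓ f a t
  | 0 => 0
  | ℓ + 1 => grComp ℓ κ hg h (z ℓ) y

end Gr

/-- The product of the graded pieces. -/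
def grModule (G : Bool → DgOperad k C) : WordModule G where
  X c a p := ∀ ℓ, Gr G ℓ c a p
  one hu ℓ := grMk (IsWord.one hu)
  perm σ h := LinearMap.pi fun ℓ => grPerm ℓ σ h ∘ₗ LinearMap.proj ℓ
  graft κ {m n r i a b c e f p q t} hg h := LinearMap.mk₂ k (grGraft κ hg h)
    (fun _ _ _ => funext fun ℓ => by cases ℓ <;> simp [grGraft])
    (fun _ _ _ => funext fun ℓ => by cases ℓ <;> simp [grGraft])
    (fun _ _ _ => funext fun ℓ => by cases ℓ <;> simp [grGraft])
    (fun _ _ _ => funext fun ℓ => by cases ℓ <;> simp [grGraft])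
  perm_one h z := funext fun ℓ => by
    change grPerm ℓ 1 h (z ℓ) = z ℓ
    obtain ⟨x, hx, e⟩ := (z ℓ).exists_rep
    rw [← e]
    exact grMk_congr (hx.act 1) hx (DgOperad.act_one _ x)
  perm_perm σ τ h h' h'' z := funext fun ℓ => by
    change grPerm ℓ τ h' (grPerm ℓ σ h (z ℓ)) = grPerm ℓ (σ * τ) h'' (z ℓ)
    obtain ⟨x, hx, e⟩ := (z ℓ).exists_rep
    rw [← e]
    subst h h'
    exact grMk_congr _ (hx.act (σ * τ)) (DgOperad.act_mul _ σ τ x).symm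
  graft_perm κ {m n r i a b c c' e f f' p q t} σ τ ρ hg hc hf hg' hρ h z y := funext fun ℓ => by
    subst hc hf
    cases ℓ with
    | zero => exact (map_zero (grPerm 0 ρ rfl)).symm
    | succ ℓ =>
      change grComp ℓ κ hg' h (grPerm ℓ σ rfl (z ℓ)) _ =
        grPerm (ℓ + 1) ρ rfl (grComp ℓ κ hg h (z ℓ) y)
      obtain ⟨x, hx, e⟩ := (z ℓ).exists_rep
      rw [← e]
      refine grMk_congr ((hx.act σ).comp κ hg' h _) ((hx.comp κ hg h y).act ρ) ?_
      rw [Hom.app_act]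
      exact DgOperad.comp_act _ σ τ ρ hg hg' hρ.outer hρ.inner h x _
  graft_comm ι κ {m n l r r' v i j s s' a b b' c e g f f' w p q t pq pt pqt} h₁ h₂ h₃ h₄ hs hs'
      d₁ d₂ d₃ d₄ z x y := funext fun ℓ => by
    cases ℓ with
    | zero => exact (smul_zero (A := Gr G 0 w a pqt) ((-1 : k) ^ (q * t))).symm
    | succ ℓ =>
      cases ℓ with
      | zero =>
        change grComp 0 κ h₂ d₂ 0 y = (-1 : k) ^ (q * t) • grComp 0 ι h₄ d₄ 0 x
        simp
      | succ ℓ =>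
        change grComp _ κ h₂ d₂ (grComp ℓ ι h₁ d₁ (z ℓ) x) y =
          (-1 : k) ^ (q * t) • grComp _ ι h₄ d₄ (grComp ℓ κ h₃ d₃ (z ℓ) y) x
        obtain ⟨u, hu, e⟩ := (z ℓ).exists_rep
        rw [← e]
        exact grMk_congr ((hu.comp ι h₁ d₁ x).comp κ h₂ d₂ y)
          (((hu.comp κ h₃ d₃ y).comp ι h₄ d₄ x).smul _)
          (DgOperad.comm _ h₁ h₂ h₃ h₄ hs hs' d₁ d₂ d₃ d₄ u _ _)
  graft_graft κ {m n l r v i j s a b b' c e g f w p q t pq pqt} h₁ h₂ hs d₁ d₂ z x y :=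
    funext fun ℓ => by
    cases ℓ with
    | zero => rfl
    | succ ℓ =>
      cases ℓ with
      | zero =>
        change grComp 0 κ h₂ d₂ 0 y = 0
        simp
      | succ ℓ =>
        change grComp _ κ h₂ d₂ (grComp ℓ κ h₁ d₁ (z ℓ) x) y = 0
        obtain ⟨u, hu, e⟩ := (z ℓ).exists_rep
        rw [← e]
        obtain ⟨f', h₃, h₄⟩ := h₁.assoc h₂ hs
        refine (grMk_eq_zero_iff ((hu.comp κ h₁ d₁ x).comp κ h₂ d₂ y)).2 ?_
        -- Two adjacent letters of one factor compose to a single letter, so the word has fewer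
        -- letters than its place in the grading indicates.
        rw [DgOperad.assoc _ h₁ h₂ h₃ h₄ hs d₁ d₂ rfl (by omega), ← Hom.app_comp]
        exact hu.comp κ h₄ _ _
  graft_one κ {m n r i a b c e f p q t} hg h hu z := funext fun ℓ => by
    cases ℓ with
    | zero => rfl
    | succ ℓ =>
      change grComp ℓ κ hg h (z ℓ) _ = 0
      obtain ⟨x, hx, e⟩ := (z ℓ).exists_rep
      rw [← e]
      refine (grMk_eq_zero_iff (hx.comp κ hg h _)).2 ?_
      obtain rfl := hu.arity_right hg
      obtain rfl := hu.eq_of_isGraft hg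
      have hq := hu.2.2
      obtain rfl : t = p := by omega
      -- Composing with a unit adds no letter, so the class vanishes in the next graded piece.
      rw [Hom.app_one, DgOperad.comp_one]
      exact hx

section toWords

variable {m n r : ℕ} {i : Fin m} {a b : C} {c : Fin m → C} {e : Fin n → C} {f : Fin r → C}
  {p q t : ℤ} {ℓ ℓ' : ℕ}

/-- Words of length at most `ℓ` become elements with at most `ℓ` letters, which vanish in all higher
graded pieces. -/
theorem LenLE.lift_eq_zero {w : (words G).X c a p} (h : LenLE ℓ w) (hℓ : ℓ < ℓ') :
    (grModule G).lift w ℓ' = 0 := by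
  induction h generalizing ℓ' with
  | zero => rw [map_zero]; rfl
  | add _ _ h h' =>
    rw [map_add]
    exact (congrArg₂ (· + ·) (h hℓ) (h' hℓ)).trans (add_zero _)
  | smul s _ h =>
    rw [map_smul]
    exact (congrArg (s • ·) (h hℓ)).trans (smul_zero _)
  | one hu =>
    obtain ⟨ℓ', rfl⟩ := Nat.exists_eq_succ_of_ne_zero (Nat.ne_zero_of_lt hℓ)
    exact (grMk_eq_zero_iff (IsWord.one hu)).2 (IsWord.one hu)
  | perm σ hf _ h =>
    rw [WordModule.lift_perm]
    exact (congrArg (grPerm ℓ' σ hf) (h hℓ)).trans (map_zero _)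
  | graft κ hg hd y _ h =>
    obtain ⟨ℓ', rfl⟩ := Nat.exists_eq_succ_of_ne_zero (Nat.ne_zero_of_lt hℓ)
    rw [WordModule.lift_graft]
    refine (congrArg (fun z => grComp ℓ' κ hg hd z y) (h (by omega))).trans ?_
    simp

variable (A : ∀ ι, Augmentation (G ι))

/-- The normal form of a composite is the graft of normal forms plus terms of smaller length, which
the top graded piece does not see. Reading the normal form back in the graded object therefore
returns the leading part. -/
theorem IsWord.lift_toWords {x : (freeProduct (G true) (G false)).X c a p} (h : IsWord ℓ x) :
    LenLE ℓ (toWords A x) ∧ (grModule G).lift (toWords A x) ℓ = grMk h := by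
  induction h with
  | zero =>
    rw [map_zero]
    refine ⟨.zero, ?_⟩
    rw [map_zero]
    rfl
  | add _ _ h h' =>
    rw [map_add]
    refine ⟨h.1.add h'.1, ?_⟩
    rw [map_add]
    exact congrArg₂ (· + ·) h.2 h'.2
  | smul s _ h =>
    rw [map_smul]
    refine ⟨h.1.smul s, ?_⟩
    rw [map_smul]
    exact congrArg (s • ·) h.2
  | one hu =>
    rw [toWords_one]
    exact ⟨.one hu, rfl⟩
  | act σ _ h =>
    rw [toWords_act]
    refine ⟨h.1.perm σ rfl, ?_⟩
    rw [WordModule.lift_perm]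
    exact congrArg (grPerm _ σ rfl) h.2
  | @comp ℓ κ m n r i a b c e f p q t hg hd x y hx h =>
    have h₁ := h.1.mult A κ hg hd y
    have h₂ := h.1.graftUnit hg hd ((A κ).eps y)
    rw [toWords_comp_inc, op]
    simp only [LinearMap.add_apply, LinearMap.compl₂_apply, map_add, WordModule.lift_graft]
    refine ⟨((h.1.graft κ hg hd y).add (h₁.mono (Nat.le_succ _))).add
      (h₂.mono (Nat.le_succ _)), ?_⟩
    refine (congrArg₂ (· + ·) (congrArg₂ (· + ·)
      (congrArg (fun z => grComp ℓ κ hg hd z y) h.2) (h₁.lift_eq_zero (Nat.lt_succ_self ℓ)))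
      (h₂.lift_eq_zero (Nat.lt_succ_self ℓ))).trans ?_
    rw [add_zero, add_zero]
    rfl

/-- If the normal form vanishes, so does the leading part, and the element has fewer letters than
assumed; this descends to zero. -/
theorem toWords_injective {x : (freeProduct (G true) (G false)).X c a p}
    (h : toWords A x = 0) : x = 0 := by
  obtain ⟨ℓ, hx⟩ := IsWord.exists_isWord x
  induction ℓ with
  | zero =>
    have := (hx.lift_toWords A).2
    rw [h, map_zero] at this
    exact (grMk_eq_zero_iff hx).1 this.symm
  | succ ℓ ih =>
    have := (hx.lift_toWords A).2
    rw [h, map_zero] at this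
    exact ih ((grMk_eq_zero_iff hx).1 this.symm)

end toWords

end DgOperad

namespace DgOperad

variable {k : Type u} [Field k] {C : Type u}

/-! ### Averaging over the symmetric groups -/

/-- Vector spaces indexed by the sequences of `n` colors, with an action of the symmetric group. -/
structure SymmModule (k : Type u) [Field k] (C : Type u) (n : ℕ) where
  X : (Fin n → C) → Type u
  [addCommGroup : ∀ c, AddCommGroup (X c)]
  [module : ∀ c, Module k (X c)]
  perm : ∀ {c f : Fin n → C} (σ : Equiv.Perm (Fin n)), f = c ∘ σ → X c →ₗ[k] X f
  perm_one : ∀ {c : Fin n → C} (h : c = c ∘ (1 : Equiv.Perm (Fin n))) (x : X c), perm 1 h x = x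
  perm_perm : ∀ {c f g : Fin n → C} (σ τ : Equiv.Perm (Fin n)) (h : f = c ∘ σ) (h' : g = f ∘ τ)
    (h'' : g = c ∘ (σ * τ : Equiv.Perm (Fin n))) (x : X c), perm τ h' (perm σ h x) =
      perm (σ * τ) h'' x

attribute [instance] SymmModule.addCommGroup SymmModule.module

namespace SymmModule

variable {n : ℕ} {M N : SymmModule k C n}

theorem comp_inv (c : Fin n → C) (σ : Equiv.Perm (Fin n)) :
    c = (c ∘ σ) ∘ (σ⁻¹ : Equiv.Perm (Fin n)) := by
  funext i
  simp

/-- The average of a family of linear maps. -/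
noncomputable def avg (s : ∀ c, M.X c →ₗ[k] N.X c) (c : Fin n → C) : M.X c →ₗ[k] N.X c :=
  (n.factorial : k)⁻¹ • ∑ σ : Equiv.Perm (Fin n),
    N.perm σ⁻¹ (comp_inv c σ) ∘ₗ s (c ∘ σ) ∘ₗ M.perm σ rfl

theorem avg_apply (s : ∀ c, M.X c →ₗ[k] N.X c) (c : Fin n → C) (x : M.X c) :
    avg s c x = (n.factorial : k)⁻¹ • ∑ σ : Equiv.Perm (Fin n),
      N.perm σ⁻¹ (comp_inv c σ) (s (c ∘ σ) (M.perm σ rfl x)) := by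
  simp [avg]

theorem avg_perm (s : ∀ c, M.X c →ₗ[k] N.X c) {c f : Fin n → C} (τ : Equiv.Perm (Fin n))
    (h : f = c ∘ τ) (x : M.X c) : avg s f (M.perm τ h x) = N.perm τ h (avg s c x) := by
  subst h
  rw [avg_apply, avg_apply, map_smul, map_sum]
  congr 1
  -- The substitution `σ ↦ τ * σ` in the sum over the group.
  refine Fintype.sum_equiv (Equiv.mulLeft τ) _ _ fun σ => ?_
  have e₁ : (c ∘ τ : Fin n → C) = (c ∘ (τ * σ : Equiv.Perm (Fin n))) ∘ (σ⁻¹ : Equiv.Perm (Fin n)) :=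
    comp_inv _ σ
  rw [M.perm_perm τ σ rfl rfl rfl]
  refine Eq.trans ?_ (N.perm_perm (τ * σ)⁻¹ τ _ rfl ?_ _).symm
  · have : (τ * σ)⁻¹ * τ = σ⁻¹ := by group
    have key : ∀ (ρ : Equiv.Perm (Fin n)) (hρ : (c ∘ τ : Fin n → C) =
        (c ∘ (τ * σ : Equiv.Perm (Fin n))) ∘ ρ), σ⁻¹ = ρ →
        N.perm σ⁻¹ e₁ (s (c ∘ (τ * σ : Equiv.Perm (Fin n))) (M.perm (τ * σ) rfl x)) =
          N.perm ρ hρ (s (c ∘ (τ * σ : Equiv.Perm (Fin n))) (M.perm (τ * σ) rfl x)) := by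
      rintro ρ hρ rfl
      rfl
    exact key _ _ this.symm
  · rw [show (τ * σ)⁻¹ * τ = σ⁻¹ by group]
    exact e₁

/-- All `n!` summands are equal to `y`; characteristic zero allows division by their number. -/
theorem avg_eq_of_forall [CharZero k] (s : ∀ c, M.X c →ₗ[k] N.X c) {c : Fin n → C} {x : M.X c}
    {y : N.X c} (h : ∀ σ : Equiv.Perm (Fin n), s (c ∘ σ) (M.perm σ rfl x) = N.perm σ rfl y) :
    avg s c x = y := by
  rw [avg_apply]
  have h1 : ∀ σ : Equiv.Perm (Fin n),
      N.perm σ⁻¹ (comp_inv c σ) (s (c ∘ σ) (M.perm σ rfl x)) = y := by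
    intro σ
    have h2 : c = c ∘ (σ * σ⁻¹ : Equiv.Perm (Fin n)) := by rw [mul_inv_cancel]; rfl
    rw [h, N.perm_perm σ σ⁻¹ rfl (comp_inv c σ) h2]
    have key : ∀ (ρ : Equiv.Perm (Fin n)) (hρ : c = c ∘ ρ), 1 = ρ → N.perm ρ hρ y = y := by
      rintro ρ hρ rfl
      exact N.perm_one hρ y
    exact key _ h2 (mul_inv_cancel σ).symm
  simp only [h1, Finset.sum_const, Finset.card_univ, Fintype.card_perm, Fintype.card_fin]
  rw [← Nat.cast_smul_eq_nsmul k, smul_smul, inv_mul_cancel₀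
    (Nat.cast_ne_zero.2 (Nat.factorial_ne_zero n)), one_smul]

theorem map_avg {L : SymmModule k C n} (s : ∀ c, M.X c →ₗ[k] N.X c) (g : ∀ c, N.X c →ₗ[k] L.X c)
    (hg : ∀ {c f : Fin n → C} (σ : Equiv.Perm (Fin n)) (h : f = c ∘ σ) (y : N.X c),
      g f (N.perm σ h y) = L.perm σ h (g c y)) (c : Fin n → C) (x : M.X c) :
    g c (avg s c x) = avg (fun c => g c ∘ₗ s c) c x := by
  simp only [avg_apply, map_smul, map_sum, hg]
  rfl

end SymmModule

/-- The components of an operad with `n` inputs, output color `a` and degree `p`. -/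
def symmModule (P : DgOperad k C) (n : ℕ) (a : C) (p : ℤ) : SymmModule k C n where
  X c := P.X c a p
  perm {c f} σ h := LinearMap.comp (h ▸ LinearMap.id) (P.act σ)
  perm_one {c} h x := P.act_one x
  perm_perm σ τ h h' h'' x := by
    subst h h'
    exact (P.act_mul σ τ x).symm

end DgOperad

/-- Over a field the map splits over its range, and the splitting extends to the whole target. -/
theorem LinearMap.exists_generalizedInverse {k V W : Type*} [Field k] [AddCommGroup V] [Module k V]
    [AddCommGroup W] [Module k W] (f : V →ₗ[k] W) : ∃ g : W →ₗ[k] V, ∀ x, f (g (f x)) = f x := by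
  obtain ⟨g₀, hg₀⟩ := f.rangeRestrict.exists_rightInverse_of_surjective f.range_rangeRestrict
  obtain ⟨g, hg⟩ := LinearMap.exists_extend g₀
  refine ⟨g, fun x => ?_⟩
  have h1 : g (f x) = g₀ (f.rangeRestrict x) := LinearMap.congr_fun hg (f.rangeRestrict x)
  rw [h1]
  exact congrArg Subtype.val (LinearMap.congr_fun hg₀ (f.rangeRestrict x))

namespace DgOperad

variable {k : Type u} [Field k] {C : Type u}

/-! ### The homology of an augmented operad as an equivariant retract -/

section homology

variable {P : DgOperad k C}

theorem cls_eq_zero_iff {n : ℕ} {c : Fin n → C} {a : C} {p q : ℤ} (h : p + 1 = q)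
    {x : P.cycles c a p} : P.cls x = 0 ↔ ∃ w : P.X c a q, P.d h w = (x : P.X c a p) := by
  subst h
  rw [Submodule.Quotient.mk_eq_zero, mem_boundaries]

/-- The augmentation of a class. -/
def Augmentation.homologyEps (A : Augmentation P) {n : ℕ} {c : Fin n → C} {a : C} {p : ℤ} :
    P.homologyX c a p →ₗ[k] unitX k c a p :=
  Submodule.liftQ _ (A.eps ∘ₗ (P.cycles c a p).subtype) (by
    intro x hx
    obtain ⟨w, hw⟩ := P.mem_boundaries.1 hx
    change A.eps (x : P.X c a p) = 0
    rw [← hw, A.eps_d])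

/-- The augmentation of the homology of an augmented operad. -/
def Augmentation.homology (A : Augmentation P) : Augmentation P.homologyOperad where
  hom := Hom.mk (P := P.homologyOperad) (R := unit k C) (fun {n c a p} => A.homologyEps)
    (fun h x => map_zero A.homologyEps)
    (fun σ x => by
      obtain ⟨x, rfl⟩ := P.cls_surjective x
      exact A.eps_act σ _)
    (fun hu => A.eps_one hu)
    (fun hg h x y => by
      obtain ⟨x, rfl⟩ := P.cls_surjective x
      obtain ⟨y, rfl⟩ := P.cls_surjective y
      exact A.eps_comp hg h _ _)
  unitHom_comp := hom_ext fun {n c a p} x => by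
    by_cases hu : IsUnitPlace c a p
    · refine (congrArg A.homologyEps (smulOne_apply P.homologyOperad hu x)).trans
        ((LinearMap.map_smul A.homologyEps _ _).trans ?_)
      refine (congrArg (fun z => Subtype.val x • z) (A.eps_one hu)).trans ?_
      exact Subtype.ext (mul_one _)
    · exact (unitX_eq_zero hu _).trans (unitX_eq_zero hu _).symm

variable (P) in
/-- A deformation of an operad to its homology, as graded spaces with actions of the symmetric
groups and units. -/
structure Contraction where
  inj : SymmMap P.homologyOperad P
  proj : SymmMap P P.homologyOperad
  htpy : SymmDeriv P 1
  d_inj : ∀ {n : ℕ} {c : Fin n → C} {a : C} {p q : ℤ} (h : q + 1 = p)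
    (x : P.homologyOperad.X c a p), P.d h (inj.app x) = 0
  proj_d : ∀ {n : ℕ} {c : Fin n → C} {a : C} {p q : ℤ} (h : q + 1 = p) (x : P.X c a p),
    proj.app (P.d h x) = 0
  proj_inj : ∀ {n : ℕ} {c : Fin n → C} {a : C} {p : ℤ}
    (x : P.homologyOperad.X c a p), proj.app (inj.app x) = x
  proj_cls : ∀ {n : ℕ} {c : Fin n → C} {a : C} {p : ℤ} (x : P.cycles c a p),
    proj.app (x : P.X c a p) = P.cls x
  d_htpy : ∀ {n : ℕ} {c : Fin n → C} {a : C} {p q t : ℤ} (h : p + 1 = q) (h' : t + 1 = p)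
    (x : P.X c a p),
    P.d h (htpy.app h x) + htpy.app h' (P.d h' x) = x - inj.app (proj.app x)

-- A generalized inverse of the differential is averaged. Since the differential is equivariant, the
-- identity `d β d = d` survives.
variable (P) in
theorem exists_equivariant_section [CharZero k] (n : ℕ) (a : C) {p q : ℤ} (h : p + 1 = q) :
    ∃ β : ∀ c : Fin n → C, P.X c a p →ₗ[k] P.X c a q,
      (∀ (c : Fin n → C) (σ : Equiv.Perm (Fin n)) (x : P.X c a p),
        β (c ∘ σ) (P.act σ x) = P.act σ (β c x)) ∧
      ∀ (c : Fin n → C) (x : P.X c a q), P.d h (β c (P.d h x)) = P.d h x := by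
  choose β hβ using fun c : Fin n → C =>
    LinearMap.exists_generalizedInverse (P.d (c := c) (a := a) h)
  let s : ∀ c, (symmModule P n a p).X c →ₗ[k] (symmModule P n a q).X c := β
  refine ⟨SymmModule.avg s, fun c σ x => SymmModule.avg_perm s σ rfl x, fun c x => ?_⟩
  refine (SymmModule.map_avg (L := symmModule P n a p) s (fun c => P.d h) ?_ c _).trans ?_
  · intro c f σ hf y
    subst hf
    exact P.d_act h σ y
  · refine SymmModule.avg_eq_of_forall _ fun σ => ?_
    change P.d h (β _ (P.act σ (P.d h x))) = P.act σ (P.d h x)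
    rw [← P.d_act, hβ]

variable (P) in
/-- The cycles with `n` inputs, output color `a` and degree `p`. -/
def cyclesModule (n : ℕ) (a : C) (p : ℤ) : SymmModule k C n where
  X c := P.cycles c a p
  perm {c f} σ h := LinearMap.comp (h ▸ LinearMap.id) (P.cyclesAct σ)
  perm_one {c} h x := Subtype.ext (P.act_one x.1)
  perm_perm σ τ h h' h'' x := by
    subst h h'
    exact Subtype.ext (P.act_mul σ τ x.1).symm

/-- Averaging preserves sections of the equivariant map from cycles to homology. It also preserves
the normalization at units, because permutations carry units to units. -/
theorem exists_equivariant_cycles [CharZero k] (A : Augmentation P) (n : ℕ) (a : C) (p : ℤ) :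
    ∃ s : ∀ c : Fin n → C, P.homologyX c a p →ₗ[k] P.cycles c a p,
      (∀ (c : Fin n → C) (σ : Equiv.Perm (Fin n)) (x : P.homologyX c a p),
        s (c ∘ σ) (P.homologyAct σ x) = P.cyclesAct σ (s c x)) ∧
      (∀ (c : Fin n → C) (x : P.homologyX c a p), P.cls (s c x) = x) ∧
      ∀ (c : Fin n → C) (hu : IsUnitPlace c a p),
        (s c (P.homologyOperad.one hu) : P.X c a p) = P.one hu := by
  have key : ∀ c : Fin n → C, ∃ s : P.homologyX c a p →ₗ[k] P.cycles c a p,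
      (∀ x, P.cls (s x) = x) ∧ ∀ hu : IsUnitPlace c a p,
        s (P.homologyOperad.one hu) = ⟨P.one hu, P.d_one _ hu⟩ := by
    intro c
    obtain ⟨s, hs⟩ := (P.boundaries c a p).mkQ.exists_rightInverse_of_surjective
      (Submodule.range_mkQ _)
    have hs' : ∀ x, P.cls (s x) = x := fun x => LinearMap.congr_fun hs x
    by_cases hu : IsUnitPlace c a p
    · let z : P.cycles c a p := ⟨P.one hu, P.d_one _ hu⟩
      have hz : P.cls (z - s (P.cls z)) = 0 := by
        change P.cls z - P.cls (s (P.cls z)) = 0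
        rw [hs', sub_self]
      -- The section is corrected at the unit by its defect, weighted with the augmentation, which
      -- is `1` there. The defect is a boundary, so the result is still a section. Without an
      -- augmentation the unit could have class zero.
      refine ⟨s + ((LinearMap.toSpanSingleton k _ (z - s (P.cls z))) ∘ₗ
        (unitX k c a p).subtype ∘ₗ A.homologyEps), fun x => ?_, fun hu' => ?_⟩
      · change P.cls (s x) + ((A.homologyEps x : unitX k c a p) : k) • P.cls (z - s (P.cls z)) = x
        rw [hs', hz, smul_zero, add_zero]
      · change s (P.cls z) + ((A.eps (P.one hu) : unitX k c a p) : k) • (z - s (P.cls z)) = z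
        rw [A.eps_one, one_smul, add_sub_cancel]
    · exact ⟨s, hs', fun hu' => absurd hu' hu⟩
  choose β hβ hβ' using key
  let s : ∀ c, (symmModule P.homologyOperad n a p).X c →ₗ[k] (cyclesModule P n a p).X c := β
  refine ⟨SymmModule.avg s, fun c σ x => SymmModule.avg_perm s σ rfl x, fun c x => ?_,
    fun c hu => ?_⟩
  · refine (SymmModule.map_avg (L := symmModule P.homologyOperad n a p) s
      (fun c => (P.boundaries c a p).mkQ) ?_ c x).trans ?_
    · intro c f σ hf y
      subst hf
      rfl
    · exact SymmModule.avg_eq_of_forall _ fun σ => hβ _ _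
  · refine congrArg Subtype.val (SymmModule.avg_eq_of_forall s (y := ⟨P.one hu, P.d_one _ hu⟩)
      fun σ => ?_)
    have hu' := (isUnitPlace_perm σ).2 hu
    refine (congrArg (β (c ∘ σ)) (act_one' P.homologyOperad σ hu hu')).trans ?_
    rw [hβ' _ hu']
    exact Subtype.ext (act_one' P σ hu hu').symm

/-- With `d β d = d`, the map `1 - β d` projects onto the cycles. Subtracting the chosen
representatives leaves a map `res` with values in the boundaries, and `β` applied to it is the
homotopy. -/
theorem exists_contraction [CharZero k] (A : Augmentation P) : Nonempty (Contraction P) := by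
  choose β hβ hβd using fun (n : ℕ) (a : C) (p q : ℤ) (h : p + 1 = q) =>
    exists_equivariant_section P n a h
  choose s hs hsc hs1 using fun (n : ℕ) (a : C) (p : ℤ) => exists_equivariant_cycles A n a p
  let cyc : ∀ {n : ℕ} {c : Fin n → C} {a : C} {p : ℤ}, P.X c a p →ₗ[k] P.cycles c a p :=
    fun {n c a p} => LinearMap.codRestrict _
      (LinearMap.id - β n a (p - 1) p (sub_add_cancel p 1) c ∘ₗ P.d (sub_add_cancel p 1))
      (fun x => by
        rw [mem_cycles]
        simp [hβd])
  have cyc_coe : ∀ {n : ℕ} {c : Fin n → C} {a : C} {p t : ℤ} (h : t + 1 = p) (x : P.X c a p),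
      (cyc x : P.X c a p) = x - β n a t p h c (P.d h x) := by
    intro n c a p t h x
    obtain rfl : t = p - 1 := by omega
    rfl
  have cyc_cycle : ∀ {n : ℕ} {c : Fin n → C} {a : C} {p : ℤ} (x : P.cycles c a p),
      cyc (x : P.X c a p) = x := by
    intro n c a p x
    refine Subtype.ext ?_
    rw [cyc_coe (sub_add_cancel p 1), d_cycle, map_zero, sub_zero]
  have cyc_act : ∀ {n : ℕ} {c : Fin n → C} {a : C} {p : ℤ} (σ : Equiv.Perm (Fin n))
      (x : P.X c a p), cyc (P.act σ x) = P.cyclesAct σ (cyc x) := by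
    intro n c a p σ x
    refine Subtype.ext ?_
    change _ = P.act σ (cyc x : P.X c a p)
    rw [cyc_coe (sub_add_cancel p 1), cyc_coe (sub_add_cancel p 1), P.d_act, hβ, map_sub]
  have cyc_d : ∀ {n : ℕ} {c : Fin n → C} {a : C} {p q : ℤ} (h : q + 1 = p) (x : P.X c a p),
      P.cls (cyc (P.d h x)) = 0 := by
    intro n c a p q h x
    refine (cls_eq_zero_iff h).2 ⟨x, ?_⟩
    rw [cyc_coe (sub_add_cancel q 1), P.d_d, map_zero, sub_zero]
  let inj : SymmMap P.homologyOperad P :=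
    { app := fun {n c a p} => (P.cycles c a p).subtype ∘ₗ s n a p c
      app_act := fun σ x => congrArg Subtype.val (hs _ _ _ _ σ x)
      app_one := fun hu => hs1 _ _ _ _ hu }
  let proj : SymmMap P P.homologyOperad :=
    { app := fun {n c a p} => (P.boundaries c a p).mkQ ∘ₗ cyc
      app_act := fun σ x => congrArg P.cls (cyc_act σ x)
      app_one := fun hu => congrArg P.cls (cyc_cycle ⟨P.one hu, P.d_one _ hu⟩) }
  have proj_app : ∀ {n : ℕ} {c : Fin n → C} {a : C} {p : ℤ} (x : P.X c a p),
      proj.app x = P.cls (cyc x) := fun x => rfl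
  have inj_app : ∀ {n : ℕ} {c : Fin n → C} {a : C} {p : ℤ} (x : P.homologyX c a p),
      inj.app x = (s n a p c x : P.X c a p) := fun x => rfl
  let res : ∀ {n : ℕ} {c : Fin n → C} {a : C} {p : ℤ}, P.X c a p →ₗ[k] P.X c a p :=
    fun {n c a p} => (P.cycles c a p).subtype ∘ₗ cyc - inj.app ∘ₗ proj.app
  have res_apply : ∀ {n : ℕ} {c : Fin n → C} {a : C} {p : ℤ} (x : P.X c a p),
      res x = (cyc x : P.X c a p) - inj.app (proj.app x) := fun x => rfl
  have res_act : ∀ {n : ℕ} {c : Fin n → C} {a : C} {p : ℤ} (σ : Equiv.Perm (Fin n))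
      (x : P.X c a p), res (P.act σ x) = P.act σ (res x) := by
    intro n c a p σ x
    rw [res_apply, res_apply, proj.app_act, inj.app_act, cyc_act, map_sub]
    rfl
  have res_one : ∀ {n : ℕ} {c : Fin n → C} {a : C} {p : ℤ} (hu : IsUnitPlace c a p),
      res (P.one hu) = 0 := by
    intro n c a p hu
    rw [res_apply, proj.app_one, inj.app_one, cyc_cycle ⟨P.one hu, P.d_one _ hu⟩, sub_self]
  refine ⟨{ inj := inj, proj := proj
            htpy :=
              { app := fun {n c a p q} h => β n a p q h c ∘ₗ res
                app_act := fun {n c a p q} h σ x => by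
                  rw [LinearMap.comp_apply, LinearMap.comp_apply, res_act, hβ]
                app_one := fun {n c a p q} h hu => by
                  rw [LinearMap.comp_apply, res_one, map_zero] }
            d_inj := fun h x => P.d_cycle h (s _ _ _ _ x)
            proj_d := fun h x => cyc_d h x
            proj_inj := fun {n c a p} x => ?_
            proj_cls := fun x => congrArg P.cls (cyc_cycle x)
            d_htpy := fun {n c a p q t} h h' x => ?_ }⟩
  · exact (congrArg P.cls (cyc_cycle (s n a p c x))).trans (hsc n a p c x)
  · rw [LinearMap.comp_apply, LinearMap.comp_apply]
    have h1 : ∃ w, P.d h w = res x := by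
      have : P.cls (cyc x - s n a p c (P.cls (cyc x))) = 0 := by
        change P.cls (cyc x) - P.cls (s n a p c (P.cls (cyc x))) = 0
        rw [hsc, sub_self]
      exact (cls_eq_zero_iff h).1 this
    obtain ⟨w, hw⟩ := h1
    -- On boundaries `res` is the identity, so the second term of the homotopy formula supplies the
    -- `β d x` that is missing from `res x`.
    have h2 : res (P.d h' x) = P.d h' x := by
      have h0 : inj.app (proj.app (P.d h' x)) = 0 :=
        (congrArg inj.app (cyc_d h' x)).trans (map_zero inj.app)
      rw [res_apply, h0, sub_zero, cyc_coe (sub_add_cancel t 1), P.d_d, map_zero, sub_zero]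
    rw [h2, ← hw, hβd, hw, res_apply, cyc_coe h']
    abel

end homology

end DgOperad

namespace DgOperad

variable {k : Type u} [Field k] {C : Type u} {I : Type}

/-- The homology of a family of operads. -/
abbrev homologyFam (G : I → DgOperad k C) : I → DgOperad k C := fun ι => (G ι).homologyOperad

variable {G : I → DgOperad k C} (K : ∀ ι, Contraction (G ι))

/-! ### The homology of the complex of words -/

/-- The words in representing cycles. -/
def wordsInj {n : ℕ} {c : Fin n → C} {a : C} {p : ℤ} :
    (words (homologyFam G)).X c a p →ₗ[k] (words G).X c a p :=
  wordsMap (G := homologyFam G) fun ι => (K ι).inj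

/-- The words in homology classes. -/
def wordsProj {n : ℕ} {c : Fin n → C} {a : C} {p : ℤ} :
    (words G).X c a p →ₗ[k] (words (homologyFam G)).X c a p :=
  wordsMap (G' := homologyFam G) fun ι => (K ι).proj

/-- The extension of the homotopies to words, as a derivation. -/
def wordsHtpy {n : ℕ} {c : Fin n → C} {a : C} {p q : ℤ} (h : p + 1 = q) :
    (words G).X c a p →ₗ[k] (words G).X c a q :=
  wordsDeriv (fun ι => (K ι).htpy) h

/-- The commutator of the differential and the homotopy. -/
def wordsLaplace {n : ℕ} {c : Fin n → C} {a : C} {p : ℤ} :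
    (words G).X c a p →ₗ[k] (words G).X c a p :=
  wordsD G rfl ∘ₗ wordsHtpy K rfl + wordsHtpy K (sub_add_cancel p 1) ∘ₗ
    wordsD G (sub_add_cancel p 1)

variable {m n r : ℕ} {i : Fin m} {a b : C} {c f' : Fin m → C} {e : Fin n → C} {f : Fin r → C}
  {p q t : ℤ}

theorem wordsProj_inj (w : (words (homologyFam G)).X c a p) :
    wordsProj K (wordsInj K w) = w := by
  rw [wordsProj, wordsInj]
  induction w using words_induction with
  | zero => simp
  | add x y hx hy => rw [map_add, map_add, hx, hy]
  | smul s x hx => rw [map_smul, map_smul, hx]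
  | one hu => simp
  | perm σ h x hx => rw [wordsMap_perm, wordsMap_perm, hx]
  | graft ι hg h x y hx => rw [wordsMap_graft, wordsMap_graft, hx, (K ι).proj_inj]

theorem wordsD_inj (h : q + 1 = p) (w : (words (homologyFam G)).X c a p) :
    wordsD G h (wordsInj K w) = 0 := by
  rw [wordsInj]
  induction w using words_induction generalizing q with
  | zero => simp
  | add x y hx hy => rw [map_add, map_add, hx, hy, add_zero]
  | smul s x hx => rw [map_smul, map_smul, hx, smul_zero]
  | one hu => simp
  | perm σ _ x hx => rw [wordsMap_perm, wordsD_perm, hx, map_zero]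
  | graft ι hg h' x y hx =>
    rw [wordsMap_graft, wordsD_graft ι hg h' h (sub_add_cancel _ 1) (sub_add_cancel _ 1)
      (by omega) (by omega), hx, (K ι).d_inj]
    simp

theorem wordsProj_d (h : q + 1 = p) (w : (words G).X c a p) :
    wordsProj K (wordsD G h w) = 0 := by
  rw [wordsProj]
  induction w using words_induction generalizing q with
  | zero => simp
  | add x y hx hy => rw [map_add, map_add, hx, hy, add_zero]
  | smul s x hx => rw [map_smul, map_smul, hx, smul_zero]
  | one hu => simp
  | perm σ _ x hx => rw [wordsD_perm, wordsMap_perm, hx, map_zero]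
  | graft ι hg h' x y hx =>
    rw [wordsD_graft ι hg h' h (sub_add_cancel _ 1) (sub_add_cancel _ 1)
      (by omega) (by omega), map_add, map_smul, wordsMap_graft, wordsMap_graft, hx, (K ι).proj_d]
    simp

theorem wordsHtpy_graft (ι : I) {p' q' t' : ℤ} (hg : IsGraft i b c e f) (h : p + q = t)
    (ht : t + 1 = t') (hp : p + 1 = p') (hq : q + 1 = q') (h₁ : p' + q = t') (h₂ : p + q' = t')
    (x : (words G).X c a p) (y : (G ι).X e b q) :
    wordsHtpy K ht ((words G).graft ι hg h x y) =
      (words G).graft ι hg h₁ (wordsHtpy K hp x) y +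
        (-1 : k) ^ p • (words G).graft ι hg h₂ x ((K ι).htpy.app hq y) := by
  refine (wordsDeriv_graft _ ι hg h ht hp hq h₁ h₂ x y).trans ?_
  rw [one_mul]
  rfl

theorem wordsLaplace_apply (h : p + 1 = q) (h' : t + 1 = p) (w : (words G).X c a p) :
    wordsLaplace K w = wordsD G h (wordsHtpy K h w) + wordsHtpy K h' (wordsD G h' w) := by
  subst h
  obtain rfl : t = p - 1 := by omega
  rfl

theorem wordsLaplace_one (hu : IsUnitPlace c a p) : wordsLaplace K ((words G).one hu) = 0 := by
  rw [wordsLaplace_apply K rfl (sub_add_cancel p 1), wordsD_one, map_zero, add_zero]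
  exact map_zero _

theorem wordsLaplace_perm (σ : Equiv.Perm (Fin m)) (h : f' = c ∘ σ) (x : (words G).X c a p) :
    wordsLaplace K ((words G).perm σ h x) = (words G).perm σ h (wordsLaplace K x) := by
  rw [wordsLaplace_apply K rfl (sub_add_cancel p 1), wordsLaplace_apply K rfl (sub_add_cancel p 1),
    wordsD_perm, map_add]
  have h1 : ∀ {t s : ℤ} (hh : t + 1 = s) (y : (words G).X c a t),
      wordsHtpy K hh ((words G).perm σ h y) = (words G).perm σ h (wordsHtpy K hh y) :=
    fun hh y => wordsDeriv_perm _ hh σ h y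
  rw [h1, h1, wordsD_perm]

/-- The commutator of two odd derivations is a derivation, as the mixed terms have opposite signs.
On a letter it is given by the homotopy formula of the contraction. -/
theorem wordsLaplace_graft (ι : I) (hg : IsGraft i b c e f) (h : p + q = t)
    (x : (words G).X c a p) (y : (G ι).X e b q) :
    wordsLaplace K ((words G).graft ι hg h x y) =
      (words G).graft ι hg h (wordsLaplace K x) y +
        (words G).graft ι hg h x (y - (K ι).inj.app ((K ι).proj.app y)) := by
  rw [wordsLaplace_apply K rfl (sub_add_cancel t 1), wordsLaplace_apply K rfl (sub_add_cancel p 1),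
    wordsHtpy_graft K ι hg h rfl rfl rfl (by omega) (by omega), map_add, map_smul,
    wordsD_graft ι hg _ rfl rfl (sub_add_cancel q 1) h (by omega),
    wordsD_graft ι hg _ rfl (sub_add_cancel p 1) rfl (by omega) h,
    wordsD_graft ι hg h (sub_add_cancel t 1) (sub_add_cancel p 1) (sub_add_cancel q 1)
      (by omega) (by omega), map_add, map_smul,
    wordsHtpy_graft K ι hg _ (sub_add_cancel t 1) (sub_add_cancel p 1) rfl h (by omega),
    wordsHtpy_graft K ι hg _ (sub_add_cancel t 1) rfl (sub_add_cancel q 1) (by omega) h,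
    ← (K ι).d_htpy rfl (sub_add_cancel q 1) y, map_add, map_add, LinearMap.add_apply]
  simp only [smul_add, neg_one_zpow_smul_self]
  rw [neg_one_zpow_succ (rfl : p + 1 = p + 1), neg_one_zpow_succ (sub_add_cancel p 1)]
  simp only [neg_smul]
  abel

/-- The sums of eigenvectors with positive integral eigenvalues. -/
inductive EigSum : ∀ {n : ℕ} {c : Fin n → C} {a : C} {p : ℤ}, (words G).X c a p → Prop
  | zero {n : ℕ} {c : Fin n → C} {a : C} {p : ℤ} : EigSum (0 : (words G).X c a p)
  | add {n : ℕ} {c : Fin n → C} {a : C} {p : ℤ} {x y : (words G).X c a p} :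
      EigSum x → EigSum y → EigSum (x + y)
  | eig (l : ℕ) {n : ℕ} {c : Fin n → C} {a : C} {p : ℤ} {x : (words G).X c a p} :
      wordsLaplace K x = ((l + 1 : ℕ) : k) • x → EigSum x

namespace EigSum

variable {K}

theorem smul (s : k) {x : (words G).X c a p} (h : EigSum K x) : EigSum K (s • x) := by
  induction h with
  | zero =>
    rw [smul_zero]
    exact zero
  | add _ _ h h' =>
    rw [smul_add]
    exact h.add h'
  | eig l h => exact eig l (by rw [map_smul, h, smul_comm])

theorem perm (σ : Equiv.Perm (Fin m)) (hf : f' = c ∘ σ) {x : (words G).X c a p} (h : EigSum K x) :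
    EigSum K ((words G).perm σ hf x) := by
  induction h with
  | zero =>
    rw [map_zero]
    exact zero
  | add _ _ h h' =>
    rw [map_add]
    exact (h σ hf).add (h' σ hf)
  | eig l h => exact eig l (by rw [wordsLaplace_perm, h, map_smul])

/-- A letter that is a chosen representative contributes nothing to the eigenvalue. -/
theorem graft_zero (ι : I) (hg : IsGraft i b c e f) (hd : p + q = t)
    {x : (words G).X c a p} (h : EigSum K x) {y : (G ι).X e b q}
    (hy : (K ι).inj.app ((K ι).proj.app y) = y) : EigSum K ((words G).graft ι hg hd x y) := by
  induction h with
  | zero =>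
    rw [map_zero]
    exact zero
  | add _ _ h h' =>
    rw [map_add]
    exact (h hg hd).add (h' hg hd)
  | eig l h => exact eig l (by simp [wordsLaplace_graft, h, hy])

/-- A letter killed by the projection raises the eigenvalue by one. -/
theorem graft_one (ι : I) (hg : IsGraft i b c e f) (hd : p + q = t)
    {x : (words G).X c a p} (h : EigSum K x) {y : (G ι).X e b q}
    (hy : (K ι).proj.app y = 0) : EigSum K ((words G).graft ι hg hd x y) := by
  induction h with
  | zero =>
    rw [map_zero]
    exact zero
  | add _ _ h h' =>
    rw [map_add]
    exact (h hg hd).add (h' hg hd)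
  | eig l h =>
    refine eig (l + 1) ?_
    rw [wordsLaplace_graft, h, hy, map_smul, LinearMap.smul_apply, map_zero, sub_zero]
    push_cast
    simp only [add_smul, one_smul]

end EigSum

theorem wordsLaplace_inj (w : (words (homologyFam G)).X c a p) :
    wordsLaplace K (wordsInj K w) = 0 := by
  rw [wordsInj]
  induction w using words_induction with
  | zero => simp
  | add x y hx hy => rw [map_add, map_add, hx, hy, add_zero]
  | smul s x hx => rw [map_smul, map_smul, hx, smul_zero]
  | one hu => rw [wordsMap_one, wordsLaplace_one]
  | perm σ _ x hx => rw [wordsMap_perm, wordsLaplace_perm, hx, map_zero]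
  | graft ι hg h' x y hx =>
    rw [wordsMap_graft, wordsLaplace_graft, hx, (K ι).proj_inj]
    simp

/-- Both the word and the last letter split into a projected part and a complement. Of the four
products only the one of both projected parts has eigenvalue zero, and this is the term subtracted.
-/
theorem eigSum_sub (w : (words G).X c a p) :
    EigSum K (w - wordsInj K (wordsProj K w)) := by
  induction w using words_induction with
  | zero => simpa using EigSum.zero
  | add x y hx hy =>
    rw [map_add, map_add, add_sub_add_comm]
    exact hx.add hy
  | smul s x hx =>
    rw [map_smul, map_smul, ← smul_sub]
    exact hx.smul s
  | one hu =>
    simpa [wordsInj, wordsProj] using EigSum.zero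
  | perm σ h x hx =>
    rw [wordsProj, wordsInj, wordsMap_perm, wordsMap_perm, ← map_sub]
    exact hx.perm σ h
  | graft ι hg h x y hx =>
    have h1 : wordsInj K (wordsProj K ((words G).graft ι hg h x y)) =
        (words G).graft ι hg h (wordsInj K (wordsProj K x)) ((K ι).inj.app ((K ι).proj.app y)) := by
      rw [wordsProj, wordsInj, wordsMap_graft, wordsMap_graft]
      rfl
    have h2 : (K ι).proj.app (y - (K ι).inj.app ((K ι).proj.app y)) = 0 := by
      rw [map_sub, (K ι).proj_inj, sub_self]
    -- The projected word has eigenvalue zero and the last letter contributes one.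
    have h3 : EigSum K ((words G).graft ι hg h (wordsInj K (wordsProj K x))
        (y - (K ι).inj.app ((K ι).proj.app y))) := by
      refine EigSum.eig 0 ?_
      rw [wordsLaplace_graft, wordsLaplace_inj, h2, map_zero (K ι).inj.app, sub_zero]
      simp
    have h4 := (hx.graft_one ι hg h h2).add ((hx.graft_zero ι hg h (y := (K ι).inj.app
      ((K ι).proj.app y)) (by rw [(K ι).proj_inj])).add h3)
    convert h4 using 1
    rw [h1]
    simp only [map_sub, LinearMap.sub_apply]
    abel

/-- The product of the operators `N - 1, …, N - l` vanishes on the word, where `N` is the commutator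
of the differential and the homotopy. -/
def LaplaceAnn : ∀ (l : ℕ) {n : ℕ} {c : Fin n → C} {a : C} {p : ℤ}, (words G).X c a p → Prop
  | 0, _, _, _, _, x => x = 0
  | l + 1, _, _, _, _, x => LaplaceAnn l (wordsLaplace K x - ((l + 1 : ℕ) : k) • x)

namespace LaplaceAnn

variable {K} {l l' : ℕ}

theorem zero : LaplaceAnn K l (0 : (words G).X c a p) := by
  induction l with
  | zero => rfl
  | succ l ih => simpa [LaplaceAnn] using ih

theorem add {x y : (words G).X c a p} (hx : LaplaceAnn K l x) (hy : LaplaceAnn K l y) :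
    LaplaceAnn K l (x + y) := by
  induction l generalizing x y with
  | zero =>
    obtain rfl : x = 0 := hx
    simpa using hy
  | succ l ih =>
    have := ih hx hy
    rw [LaplaceAnn, map_add, smul_add, add_sub_add_comm]
    exact this

theorem smul (s : k) {x : (words G).X c a p} (hx : LaplaceAnn K l x) : LaplaceAnn K l (s • x) := by
  induction l generalizing x with
  | zero =>
    obtain rfl : x = 0 := hx
    exact smul_zero s
  | succ l ih =>
    have := ih hx
    rw [LaplaceAnn, map_smul, smul_comm, ← smul_sub]
    exact this

theorem laplace {x : (words G).X c a p} (hx : LaplaceAnn K l x) :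
    LaplaceAnn K l (wordsLaplace K x) := by
  induction l generalizing x with
  | zero =>
    obtain rfl : x = 0 := hx
    exact map_zero _
  | succ l ih =>
    have := ih hx
    rw [map_sub, map_smul] at this
    exact this

/-- The operators are polynomials in `N` and commute, so a further factor may be applied first. -/
theorem mono {x : (words G).X c a p} (hx : LaplaceAnn K l x) (h : l ≤ l') :
    LaplaceAnn K l' x := by
  induction h with
  | refl => exact hx
  | @step l' _ ih =>
    have := ih.laplace.add (ih.smul (-((l' + 1 : ℕ) : k)))
    rw [neg_smul, ← sub_eq_add_neg] at this
    exact this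

theorem exists_of_eigSum {x : (words G).X c a p} (hx : EigSum K x) : ∃ l, LaplaceAnn K l x := by
  induction hx with
  | zero => exact ⟨0, zero⟩
  | add _ _ h h' =>
    obtain ⟨l, h⟩ := h
    obtain ⟨l', h'⟩ := h'
    exact ⟨max l l', (h.mono (le_max_left _ _)).add (h'.mono (le_max_right _ _))⟩
  | eig l h => exact ⟨l + 1, by rw [LaplaceAnn, h, sub_self]; exact zero⟩

/-- On cycles `N = dh`. If `N x - (l + 1) x` bounds `y`, then `(l + 1) x` bounds `h x - y`.
Annihilating polynomials are used because the eigenvectors that sum to a cycle are not known to be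
cycles. -/
theorem exists_wordsD_eq [CharZero k] {x : (words G).X c a p} (hx : LaplaceAnn K l x)
    (ht : t + 1 = p) (hq : p + 1 = q) (hd : wordsD G ht x = 0) : ∃ y, wordsD G hq y = x := by
  induction l generalizing x with
  | zero => exact ⟨0, by rw [map_zero]; exact hx.symm⟩
  | succ l ih =>
    have h1 : wordsLaplace K x = wordsD G hq (wordsHtpy K hq x) := by
      rw [wordsLaplace_apply K hq ht, hd, map_zero, add_zero]
    obtain ⟨y, hy⟩ := ih hx (by rw [map_sub, map_smul, hd, h1, wordsD_wordsD]; simp)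
    refine ⟨((l + 1 : ℕ) : k)⁻¹ • (wordsHtpy K hq x - y), ?_⟩
    rw [map_smul, map_sub, hy, ← h1, sub_sub_cancel, smul_smul,
      inv_mul_cancel₀ (Nat.cast_ne_zero.2 (Nat.succ_ne_zero l)), one_smul]

end LaplaceAnn

theorem exists_wordsD_eq_sub [CharZero k] (ht : t + 1 = p) (hq : p + 1 = q) {w : (words G).X c a p}
    (hw : wordsD G ht w = 0) : ∃ y, wordsD G hq y = w - wordsInj K (wordsProj K w) := by
  obtain ⟨l, hl⟩ := LaplaceAnn.exists_of_eigSum (eigSum_sub K w)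
  exact hl.exists_wordsD_eq ht hq (by rw [map_sub, hw, wordsD_inj, sub_self])

end DgOperad

/-! ### Words in cycles and words in homology classes -/

namespace DgOperad

variable {k : Type u} [Field k] {C : Type u}

section comparison

variable {I : Type} {G : I → DgOperad k C}

/-- The boundaries of the complex of words. -/
def wordsBdry (G : I → DgOperad k C) {n : ℕ} (c : Fin n → C) (a : C) (p : ℤ) :
    Submodule k ((words G).X c a p) :=
  LinearMap.range (wordsD G (c := c) (a := a) (rfl : p + 1 = p + 1))

variable {m n r : ℕ} {i : Fin m} {a b : C} {c f' : Fin m → C} {e : Fin n → C} {f : Fin r → C}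
  {p q t : ℤ}

theorem perm_mem_wordsBdry {x : (words G).X c a p} (hx : x ∈ wordsBdry G c a p)
    (σ : Equiv.Perm (Fin m)) (h : f' = c ∘ σ) : (words G).perm σ h x ∈ wordsBdry G f' a p := by
  obtain ⟨y, rfl⟩ := hx
  exact ⟨(words G).perm σ h y, wordsD_perm _ σ h y⟩

theorem graft_mem_wordsBdry_left (κ : I) (hg : IsGraft i b c e f) (h : p + q = t)
    {x : (words G).X c a p} (hx : x ∈ wordsBdry G c a p) (y : (G κ).cycles e b q) :
    (words G).graft κ hg h x (y : (G κ).X e b q) ∈ wordsBdry G f a t := by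
  obtain ⟨z, rfl⟩ := hx
  refine ⟨(words G).graft κ hg (by omega) z (y : (G κ).X e b q), ?_⟩
  rw [wordsD_graft κ hg _ rfl rfl (sub_add_cancel q 1) h (by omega), d_cycle]
  simp

/-- In the Leibniz rule for the graft of `y` only one term remains, as the word is a cycle. -/
theorem graft_mem_wordsBdry_right (κ : I) (hg : IsGraft i b c e f) (h : p + q = t)
    {x : (words G).X c a p} (hx : wordsD G (sub_add_cancel p 1) x = 0)
    (y : (G κ).X e b (q + 1)) :
    (words G).graft κ hg h x ((G κ).d rfl y) ∈ wordsBdry G f a t := by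
  refine ⟨(-1 : k) ^ p • (words G).graft κ hg (by omega) x y, ?_⟩
  rw [map_smul, wordsD_graft κ hg _ rfl (sub_add_cancel p 1) rfl (by omega) h, hx, map_zero,
    LinearMap.zero_apply, zero_add, neg_one_zpow_smul_self]

variable (A : ∀ ι, Augmentation (G ι))

theorem op_mem_wordsBdry (κ : I) (hg : IsGraft i b c e f) (h : p + q = t)
    {x : (words G).X c a p} (hx : x ∈ wordsBdry G c a p) (y : (G κ).cycles e b q) :
    op A κ hg h x (y : (G κ).X e b q) ∈ wordsBdry G f a t := by
  obtain ⟨z, rfl⟩ := hx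
  refine ⟨op A κ hg (by omega) z (y : (G κ).X e b q), ?_⟩
  rw [wordsD_op A κ hg _ rfl rfl (sub_add_cancel q 1) h (by omega), d_cycle]
  simp

/-- The augmentations of the homology operads. -/
abbrev homologyAug : ∀ ι, Augmentation (homologyFam G ι) := fun ι => (A ι).homology

theorem homology_bar_cls {P : DgOperad k C} (A : Augmentation P) (x : P.cycles c a p)
    (hx : A.bar (x : P.X c a p) ∈ P.cycles c a p) :
    A.homology.bar (P.cls x) = P.cls ⟨A.bar (x : P.X c a p), hx⟩ := by
  have key : P.homologyOperad.smulOne c a p (A.eps (x : P.X c a p)) =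
      P.cls ⟨P.smulOne c a p (A.eps (x : P.X c a p)), P.d_smulOne _ _⟩ := by
    by_cases hu : IsUnitPlace c a p
    · rw [smulOne_apply P.homologyOperad hu]
      exact congrArg P.cls (Subtype.ext (smulOne_apply P hu _).symm)
    · have h0 := unitX_eq_zero hu (A.eps (x : P.X c a p))
      rw [h0, map_zero]
      refine (congrArg P.cls (Subtype.ext ?_) : P.cls 0 = _)
      exact (map_zero _).symm
  exact congrArg (fun z => P.cls x - z) key

variable (K : ∀ ι, Contraction (G ι))

/-- The homotopy applied to the cycle bounds the difference. -/
theorem sub_inj_cls {P : DgOperad k C} (K : Contraction P) (x : P.cycles c a p)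
    {x' : P.homologyOperad.X c a p} (hx : P.cls x = x') :
    ∃ y, P.d rfl y = (x : P.X c a p) - K.inj.app x' := by
  subst hx
  refine ⟨K.htpy.app rfl x, ?_⟩
  have := K.d_htpy rfl (sub_add_cancel p 1) (x : P.X c a p)
  rw [d_cycle, map_zero, add_zero, K.proj_cls] at this
  exact this

theorem wordsInj_perm (σ : Equiv.Perm (Fin m)) (h : f' = c ∘ σ)
    (x : (words (homologyFam G)).X c a p) :
    wordsInj K ((words (homologyFam G)).perm σ h x) = (words G).perm σ h (wordsInj K x) :=
  wordsMap_perm _ σ h x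

theorem wordsInj_graft (ι : I) (hg : IsGraft i b c e f) (h : p + q = t)
    (x : (words (homologyFam G)).X c a p) (y : (homologyFam G ι).X e b q) :
    wordsInj K ((words (homologyFam G)).graft ι hg h x y) =
      (words G).graft ι hg h (wordsInj K x) ((K ι).inj.app y) :=
  wordsMap_graft _ ι hg h x y

/-- Representatives are not multiplicative, but at the letter that carries the input the product of
representatives and the representative of the product differ by a boundary. All other letters are
cycles, so the words differ by a boundary. -/
theorem mult_inj_sub_mem (κ : I) (hg : IsGraft i b c e f) (h : p + q = t)
    (u : (words (homologyFam G)).X c a p) (s : (G κ).cycles e b q)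
    {s' : (homologyFam G κ).X e b q} (hs : (G κ).cls s = s') :
    mult A κ hg h (wordsInj K u) (s : (G κ).X e b q) -
      wordsInj K (mult (homologyAug A) κ hg h u s') ∈ wordsBdry G f a t := by
  induction u using words_induction generalizing r f t with
  | zero => simp
  | add x y hx hy =>
    simp only [map_add, LinearMap.add_apply]
    rw [add_sub_add_comm]
    exact Submodule.add_mem _ (hx hg h) (hy hg h)
  | smul l x hx =>
    simp only [map_smul, LinearMap.smul_apply]
    rw [← smul_sub]
    exact Submodule.smul_mem _ _ (hx hg h)
  | one hu =>
    rw [mult_one, map_zero, sub_zero, wordsInj, wordsMap_one, mult_one]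
    exact Submodule.zero_mem _
  | perm σ hc x hx =>
    obtain ⟨ρ, f₀, hρ, h', hf⟩ := exists_perm_graft σ hc hg
    have := perm_mem_wordsBdry (hx h' h) ρ hf
    rw [mult_perm (homologyAug A) κ σ ρ h' hc hf hg hρ, wordsInj_perm, wordsInj_perm,
      mult_perm A κ σ ρ h' hc hf hg hρ, ← map_sub]
    exact this
  | @graft ι m n₀ r₀ i₀ a b₀ c e₀ f₀ p₁ p₂ p h₀ d₀ u x hx =>
    let z : (G ι).cycles e₀ b₀ p₂ := ⟨(K ι).inj.app x, (K ι).d_inj _ x⟩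
    have hz : (G ι).cls z = x := ((K ι).proj_cls z).symm.trans ((K ι).proj_inj x)
    rw [wordsInj_graft]
    obtain ⟨j₀, hj₀⟩ | ⟨i₁, hi₁⟩ := pos_cases h₀.arity i₀ i
    · by_cases hι : κ = ι
      · subst hι
        obtain ⟨f₁, g₁, g₂⟩ := h₀.assoc hg hj₀
        rw [mult_graft_inner A κ h₀ hg g₁ g₂ hj₀ d₀ h rfl (by omega),
          mult_graft_inner (homologyAug A) κ h₀ hg g₁ g₂ hj₀ d₀ h rfl (by omega), wordsInj_graft, ← map_sub]
        have hb : ∀ {n : ℕ} {c : Fin n → C} {a : C} {p : ℤ} (x : (G κ).cycles c a p),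
            (A κ).bar (x : (G κ).X c a p) ∈ (G κ).cycles c a p := fun x => by
          rw [mem_cycles, (A κ).d_bar, d_cycle]
        have h1 : (G κ).cls ((G κ).cyclesComp g₁ rfl ⟨_, hb z⟩ ⟨_, hb s⟩) =
            (homologyFam G κ).comp g₁ rfl ((homologyAug A κ).bar x)
              ((homologyAug A κ).bar s') := by
          subst hs
          have h2 : (homologyAug A κ).bar x = (G κ).cls ⟨_, hb z⟩ :=
            (congrArg _ hz.symm).trans (homology_bar_cls (A κ) z (hb z))
          exact (congrArg₂ (fun x y => (homologyFam G κ).comp g₁ rfl x y) h2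
            (homology_bar_cls (A κ) s (hb s))).symm
        -- By `h1` the product of the projected representatives lies in the product of the classes,
        -- so its difference from the chosen representative is `d y`.
        obtain ⟨y, hy⟩ := sub_inj_cls (K κ) _ h1
        refine (congrArg (· ∈ wordsBdry G f a t) (congrArg _ hy)).mp ?_
        exact graft_mem_wordsBdry_right κ g₂ _ (wordsD_inj K _ u) y
      · rw [mult_graft_inner_ne A κ hι h₀ hg hj₀,
          mult_graft_inner_ne (homologyAug A) κ hι h₀ hg hj₀, map_zero, sub_zero]
        exact Submodule.zero_mem _
    · obtain ⟨s₁, f₁, hs₁, g₁, g₂⟩ := h₀.comm hg hi₁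
      rw [mult_graft_outer A κ ι h₀ hg g₁ g₂ hi₁ hs₁ d₀ h rfl (by omega),
        mult_graft_outer (homologyAug A) κ ι h₀ hg g₁ g₂ hi₁ hs₁ d₀ h rfl (by omega), map_smul,
        wordsInj_graft, ← smul_sub, ← LinearMap.sub_apply, ← map_sub]
      exact Submodule.smul_mem _ _ (graft_mem_wordsBdry_left ι g₂ _ (hx g₁ rfl) z)

theorem wordsInj_graftUnit (hg : IsGraft i b c e f) (h : p + q = t)
    (u : (words (homologyFam G)).X c a p) (y : unitX k e b q) :
    wordsInj K (graftUnit (homologyFam G) hg h u y) = graftUnit G hg h (wordsInj K u) y := by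
  by_cases hu : IsUnitPlace e b q
  · obtain rfl := hu.arity_right hg
    obtain rfl := hu.eq_of_isGraft hg
    have hq := hu.2.2
    obtain rfl : t = p := by omega
    rw [graftUnit, graftUnit, dif_pos hu, dif_pos hu]
    exact map_smul (wordsInj K) _ _
  · rw [graftUnit, graftUnit, dif_neg hu, dif_neg hu]
    exact map_zero (wordsInj K)

theorem op_inj_sub_mem (κ : I) (hg : IsGraft i b c e f) (h : p + q = t)
    (u : (words (homologyFam G)).X c a p) (s : (G κ).cycles e b q)
    {s' : (homologyFam G κ).X e b q} (hs : (G κ).cls s = s') :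
    op A κ hg h (wordsInj K u) (s : (G κ).X e b q) -
      wordsInj K (op (homologyAug A) κ hg h u s') ∈ wordsBdry G f a t := by
  obtain ⟨y, hy⟩ := sub_inj_cls (K κ) s hs
  have h1 := graft_mem_wordsBdry_right κ hg h (wordsD_inj K (sub_add_cancel p 1) u) y
  rw [hy, map_sub] at h1
  have h2 := mult_inj_sub_mem A K κ hg h u s hs
  have h3 : wordsInj K ((words (homologyFam G)).graft κ hg h u s') =
      (words G).graft κ hg h (wordsInj K u) ((K κ).inj.app s') :=
    wordsInj_graft K κ hg h u _
  have h4 := wordsInj_graftUnit K hg h u ((A κ).eps (s : (G κ).X e b q))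
  have h5 := Submodule.add_mem _ h1 h2
  have h6 : op A κ hg h (wordsInj K u) (s : (G κ).X e b q) =
      (words G).graft κ hg h (wordsInj K u) (s : (G κ).X e b q) +
      mult A κ hg h (wordsInj K u) (s : (G κ).X e b q) +
        graftUnit G hg h (wordsInj K u) ((A κ).eps (s : (G κ).X e b q)) := rfl
  have h7 : op (homologyAug A) κ hg h u s' =
      (words (homologyFam G)).graft κ hg h u s' +
      mult (homologyAug A) κ hg h u s' +
        graftUnit (homologyFam G) hg h u ((A κ).eps (s : (G κ).X e b q)) := by
    subst hs
    rfl
  rw [h6, h7, map_add, map_add, h3, h4]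
  convert h5 using 1
  abel

end comparison

/-! ### The homology of the free product -/

section

variable {G : Bool → DgOperad k C}

/-- The canonical morphism from the free product of the homology operads. -/
def homologyDesc (G : Bool → DgOperad k C) :
    freeProduct (homologyFam G true) (homologyFam G false) ⟶
      (freeProduct (G true) (G false)).homologyOperad :=
  freeDesc (homologyMap (inc G true)) (homologyMap (inc G false))

variable {m n r : ℕ} {i : Fin m} {a b : C} {c f' : Fin m → C} {e : Fin n → C} {f : Fin r → C}
  {p q t : ℤ}

theorem homologyDesc_inc (κ : Bool) (x : (G κ).cycles c a p) :
    Hom.app (homologyDesc G) (Hom.app (inc (homologyFam G) κ) ((G κ).cls x)) =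
      (freeProduct (G true) (G false)).cls (cyclesMap (inc G κ) c a p x) := by
  cases κ <;> rfl

variable (A : ∀ ι, Augmentation (G ι)) (K : ∀ ι, Contraction (G ι))

/-- A word in homology classes is represented by the same word in cycles. At each letter,
`op_mem_wordsBdry` propagates the boundary accumulated so far, and `op_inj_sub_mem` bounds the new
discrepancy. -/
theorem exists_cycle_of_isWord {ℓ : ℕ}
    {x : (freeProduct (homologyFam G true) (homologyFam G false)).X c a p}
    (hx : IsWord (G := homologyFam G) ℓ x) :
    ∃ z : (freeProduct (G true) (G false)).cycles c a p,
      Hom.app (homologyDesc G) x = (freeProduct (G true) (G false)).cls z ∧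
      toWords A (z : (freeProduct (G true) (G false)).X c a p) -
        wordsInj K (toWords (G := homologyFam G) (homologyAug A) x) ∈ wordsBdry G c a p := by
  induction hx with
  | zero =>
    refine ⟨0, map_zero _, ?_⟩
    simp
  | add _ _ hx hy =>
    obtain ⟨z, hz, hz'⟩ := hx
    obtain ⟨y, hy, hy'⟩ := hy
    refine ⟨z + y, ?_, ?_⟩
    · rw [map_add, hz, hy]
      rfl
    · simp only [map_add, Submodule.coe_add]
      rw [add_sub_add_comm]
      exact Submodule.add_mem _ hz' hy'
  | smul s _ hx =>
    obtain ⟨z, hz, hz'⟩ := hx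
    refine ⟨s • z, ?_, ?_⟩
    · rw [map_smul, hz]
      rfl
    · simp only [map_smul, Submodule.coe_smul]
      rw [← smul_sub]
      exact Submodule.smul_mem _ _ hz'
  | one hu =>
    refine ⟨⟨_, (freeProduct (G true) (G false)).d_one _ hu⟩, Hom.app_one (homologyDesc G) hu, ?_⟩
    rw [toWords_one, toWords_one, wordsInj, wordsMap_one, sub_self]
    exact Submodule.zero_mem _
  | act σ _ hx =>
    obtain ⟨z, hz, hz'⟩ := hx
    refine ⟨(freeProduct (G true) (G false)).cyclesAct σ z, ?_, ?_⟩
    · rw [Hom.app_act, hz]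
      rfl
    · have := perm_mem_wordsBdry hz' σ rfl
      rw [map_sub] at this
      rw [toWords_act, wordsInj, wordsMap_perm]
      refine (congrArg (fun w => w - _ ∈ wordsBdry G _ _ _) ?_).mp this
      exact (toWords_act A σ _).symm
  | @comp ℓ κ m n r i a b c e f p q t hg hd x y _ hx =>
    obtain ⟨z, hz, hz'⟩ := hx
    obtain ⟨s, hs⟩ := (G κ).cls_surjective y
    refine ⟨(freeProduct (G true) (G false)).cyclesComp hg hd z (cyclesMap (inc G κ) e b q s),
      ?_, ?_⟩
    · rw [Hom.app_comp, hz, ← hs]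
      exact congrArg _ (homologyDesc_inc κ s)
    · have h1 := op_mem_wordsBdry A κ hg hd hz' s
      have h2 := op_inj_sub_mem A K κ hg hd (toWords (G := homologyFam G) (homologyAug A) x) s hs
      rw [toWords_comp_inc]
      have h3 := Submodule.add_mem _ h1 h2
      rw [map_sub, LinearMap.sub_apply, sub_add_sub_cancel,
        ← toWords_comp_inc A κ hg hd (z : (freeProduct (G true) (G false)).X c a p)
          (s : (G κ).X e b q)] at h3
      exact h3

theorem exists_cycle (x : (freeProduct (homologyFam G true) (homologyFam G false)).X c a p) :
    ∃ z : (freeProduct (G true) (G false)).cycles c a p,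
      Hom.app (homologyDesc G) x = (freeProduct (G true) (G false)).cls z ∧
      toWords A (z : (freeProduct (G true) (G false)).X c a p) -
        wordsInj K (toWords (G := homologyFam G) (homologyAug A) x) ∈ wordsBdry G c a p := by
  obtain ⟨ℓ, h⟩ := IsWord.exists_isWord (G := homologyFam G) x
  exact exists_cycle_of_isWord A K h

theorem homologyDesc_injective (A : ∀ ι, Augmentation (G ι)) (K : ∀ ι, Contraction (G ι))
    {x : (freeProduct (homologyFam G true) (homologyFam G false)).X c a p}
    (hx : Hom.app (homologyDesc G) x = 0) : x = 0 := by
  obtain ⟨z, hz, y, hy⟩ := exists_cycle A K x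
  rw [hz] at hx
  obtain ⟨v, hv⟩ := (cls_eq_zero_iff rfl).1 hx
  refine toWords_injective (G := homologyFam G) (homologyAug A) ?_
  rw [← hv, toWords_d] at hy
  -- The projection kills boundaries and is a left inverse of `wordsInj`, so the normal form of `x`
  -- is zero.
  have h1 := congrArg (wordsProj K) hy
  rw [map_sub, wordsProj_d, wordsProj_d, wordsProj_inj, zero_sub] at h1
  exact neg_eq_zero.1 h1.symm

theorem homologyDesc_surjective [CharZero k] (A : ∀ ι, Augmentation (G ι))
    (K : ∀ ι, Contraction (G ι))
    (y : (freeProduct (G true) (G false)).homologyX c a p) :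
    ∃ x : (freeProduct (homologyFam G true) (homologyFam G false)).X c a p,
      Hom.app (homologyDesc G) x = y := by
  obtain ⟨z, rfl⟩ := (freeProduct (G true) (G false)).cls_surjective y
  obtain ⟨x, hx⟩ := toWords_surjective (G := homologyFam G) (homologyAug A)
    (wordsProj K (toWords A (z : (freeProduct (G true) (G false)).X c a p)))
  obtain ⟨z', hz', v, hv⟩ := exists_cycle A K x
  obtain ⟨v', hv'⟩ := exists_wordsD_eq_sub K (sub_add_cancel p 1) rfl
    (w := toWords A (z : (freeProduct (G true) (G false)).X c a p)) (by
      rw [← toWords_d, d_cycle, map_zero])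
  refine ⟨x, hz'.trans ?_⟩
  -- The normal forms of `z` and `z'` are homologous to the same word in representatives, through
  -- `v'` and `v`; the preimage of `v' - v` bounds `z - z'`.
  obtain ⟨u, hu⟩ := toWords_surjective A (v' - v)
  have h1 : (freeProduct (G true) (G false)).cls (z - z') = 0 := by
    refine (cls_eq_zero_iff rfl).2 ⟨u, ?_⟩
    refine sub_eq_zero.1 (toWords_injective A ?_)
    rw [map_sub, toWords_d, hu, map_sub, hv, hv', hx, Submodule.coe_sub, map_sub]
    abel
  exact (sub_eq_zero.1 h1).symm

end

/-- A morphism with bijective components is an isomorphism. -/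
theorem isIso_of_bijective {P R : DgOperad k C} (F : P ⟶ R)
    (h : ∀ {n : ℕ} {c : Fin n → C} {a : C} {p : ℤ},
      Function.Bijective (Hom.app F : P.X c a p →ₗ[k] R.X c a p)) : IsIso F := by
  let e : ∀ {n : ℕ} (c : Fin n → C) (a : C) (p : ℤ), P.X c a p ≃ₗ[k] R.X c a p :=
    fun c a p => LinearEquiv.ofBijective (Hom.app F) h
  have he : ∀ {n : ℕ} {c : Fin n → C} {a : C} {p : ℤ} (x : P.X c a p),
      (e c a p).symm (Hom.app F x) = x := fun x => (e _ _ _).symm_apply_apply x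
  have he' : ∀ {n : ℕ} {c : Fin n → C} {a : C} {p : ℤ} (x : R.X c a p),
      Hom.app F ((e c a p).symm x) = x := fun x => (e _ _ _).apply_symm_apply x
  let F' : R ⟶ P := Hom.mk (P := R) (R := P) (fun {n c a p} => ((e c a p).symm : _ →ₗ[k] _))
    (fun hd x => h.1 (by
      rw [Hom.app_d]
      exact (he' _).trans (congrArg _ (he' x).symm)))
    (fun σ x => h.1 (by
      rw [Hom.app_act]
      exact (he' _).trans (congrArg _ (he' x).symm)))
    (fun hu => h.1 (by
      rw [Hom.app_one]
      exact he' _))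
    (fun hg hd x y => h.1 (by
      rw [Hom.app_comp]
      exact (he' _).trans (congrArg₂ (fun x y => R.comp hg hd x y) (he' x).symm (he' y).symm)))
  exact ⟨F', hom_ext fun x => he x, hom_ext fun x => he' x⟩

theorem isIso_homologyDesc [CharZero k] (G : Bool → DgOperad k C)
    (hG : ∀ κ, (G κ).IsAugmented) : IsIso (homologyDesc G) := by
  let A : ∀ κ, Augmentation (G κ) := fun κ => ⟨(hG κ).choose, (hG κ).choose_spec⟩
  let K : ∀ κ, Contraction (G κ) := fun κ => (exists_contraction (A κ)).some
  exact isIso_of_bijective _ ⟨(injective_iff_map_eq_zero _).2 fun x => homologyDesc_injective A K,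
    homologyDesc_surjective A K⟩

/-- The canonical morphism from the coproduct of the homologies to the homology of the coproduct
is an isomorphism. -/
theorem isIso_coprodComparison_homology [CharZero k] {S Q : DgOperad k C} (hS : S.IsAugmented)
    (hQ : Q.IsAugmented) : IsIso (coprodComparison (homology k C) S Q) := by
  let G : Bool → DgOperad k C := fun κ => cond κ S Q
  have h1 : IsIso (homologyDesc G) := isIso_homologyDesc G (by rintro ⟨⟩ <;> assumption)
  let e₁ : (homology k C).obj S ⨿ (homology k C).obj Q ≅
      freeProduct (homologyFam G true) (homologyFam G false) :=
    (colimit.isColimit _).coconePointUniqueUpToIso (freeIsColimit S.homologyOperad Q.homologyOperad)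
  let e₂ : freeProduct (G true) (G false) ≅ S ⨿ Q :=
    (freeIsColimit S Q).coconePointUniqueUpToIso (colimit.isColimit _)
  -- Both sides agree after restriction to the two summands, so the comparison morphism is
  -- `homologyDesc` up to the isomorphisms between the chosen and the constructed coproducts.
  have h2 : coprodComparison (homology k C) S Q =
      e₁.hom ≫ homologyDesc G ≫ (homology k C).map e₂.hom := by
    have i₁ : coprod.inl ≫ e₁.hom = freeInl S.homologyOperad Q.homologyOperad :=
      IsColimit.comp_coconePointUniqueUpToIso_hom (colimit.isColimit _)
        (freeIsColimit S.homologyOperad Q.homologyOperad) ⟨WalkingPair.left⟩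
    have i₂ : coprod.inr ≫ e₁.hom = freeInr S.homologyOperad Q.homologyOperad :=
      IsColimit.comp_coconePointUniqueUpToIso_hom (colimit.isColimit _)
        (freeIsColimit S.homologyOperad Q.homologyOperad) ⟨WalkingPair.right⟩
    have j₁ : freeInl S Q ≫ e₂.hom = coprod.inl :=
      IsColimit.comp_coconePointUniqueUpToIso_hom (freeIsColimit S Q)
        (colimit.isColimit _) ⟨WalkingPair.left⟩
    have j₂ : freeInr S Q ≫ e₂.hom = coprod.inr :=
      IsColimit.comp_coconePointUniqueUpToIso_hom (freeIsColimit S Q)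
        (colimit.isColimit _) ⟨WalkingPair.right⟩
    refine coprod.hom_ext ?_ ?_
    · rw [coprodComparison_inl, ← j₁, Functor.map_comp, ← Category.assoc, i₁]
      rfl
    · rw [coprodComparison_inr, ← j₂, Functor.map_comp, ← Category.assoc, i₂]
      rfl
  rw [h2]
  have h3 : IsIso ((homology k C).map e₂.hom) := inferInstance
  have h4 : IsIso e₁.hom := inferInstance
  exact @IsIso.comp_isIso _ _ _ _ _ _ _ h4 (@IsIso.comp_isIso _ _ _ _ _ _ _ h1 h3)

end DgOperad

/-- The canonical morphism `H(S) * H(Q) ⟶ H(S * Q)` is a natural isomorphism. -/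
theorem mainTheorem8 (k : Type u) [Field k] [CharZero k] (C : Type u) :
    ∃ Φ : ∀ S Q : DgOperad k C, S.IsAugmented → Q.IsAugmented →
        ((DgOperad.homology k C).obj S ⨿ (DgOperad.homology k C).obj Q ≅
          (DgOperad.homology k C).obj (S ⨿ Q)),
      (∀ (S Q : DgOperad k C) (hS : S.IsAugmented) (hQ : Q.IsAugmented),
        coprod.inl ≫ (Φ S Q hS hQ).hom =
            (DgOperad.homology k C).map (coprod.inl : S ⟶ S ⨿ Q) ∧
          coprod.inr ≫ (Φ S Q hS hQ).hom =
            (DgOperad.homology k C).map (coprod.inr : Q ⟶ S ⨿ Q)) ∧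
      (∀ (S S' Q Q' : DgOperad k C) (hS : S.IsAugmented) (hS' : S'.IsAugmented)
        (hQ : Q.IsAugmented) (hQ' : Q'.IsAugmented) (F : S ⟶ S') (G : Q ⟶ Q'),
        coprod.map ((DgOperad.homology k C).map F) ((DgOperad.homology k C).map G) ≫
            (Φ S' Q' hS' hQ').hom =
          (Φ S Q hS hQ).hom ≫ (DgOperad.homology k C).map (coprod.map F G)) := by
  refine ⟨fun S Q hS hQ =>
    have := DgOperad.isIso_coprodComparison_homology hS hQ
    asIso (coprodComparison (DgOperad.homology k C) S Q), fun S Q hS hQ => ⟨?_, ?_⟩, ?_⟩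
  · exact coprodComparison_inl (DgOperad.homology k C)
  · exact coprodComparison_inr (DgOperad.homology k C)
  · intro S S' Q Q' hS hS' hQ hQ' F G
    exact (coprodComparison_natural (DgOperad.homology k C) F G).symm
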